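/- **Setting.** Let $d\in\mathbb N$, $S^1=\mathbb R/2\pi\mathbb Z$, and write $\dot c=\partial_t c$, $c'=\partial_\theta c$ for (weak) derivatives of $c=c(t,\theta)$ on $[0,1]\times S^1$. For $k,\ell\in\mathbb N$ let $$H^{k,\ell}=\{f\in L^2([0,1]\times S^1;\mathbb R^d): \text{the weak derivatives } f^{(k,0)},f^{(0,\ell)},f^{(k,\ell)} \text{ exist in } L^2\},$$ where $f^{(i,j)}=\partial_t^i\partial_\theta^j f$, with inner product $$\langle f,g\rangle_{H^{k,\ell}}=\langle f,g\rangle_{L^2}+\langle f^{(k,0)},g^{(k,0)}\rangle_{L^2}+\langle f^{(0,\ell)},g^{(0,\ell)}\rangle_{L^2}+\langle f^{(k,\ell)},g^{(k,\ell)}\rangle_{L^2}.$$ Let $U$ be the set of all $c\in H^{1,2}$ whose spatial derivative $c'$ (which has a continuous representative) satisfies $c'(t,\theta)\ne0$ for all $(t,\theta)\in[0,1]\times S^1$. For constants $a_0,a_1,a_2\in\mathbb R$ let $$E(c)=\int_0^1\!\!\int_0^{2\pi} a_0|c'|\langle\dot c,\dot c\rangle+\frac{a_1}{|c'|}\langle\dot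 c',\dot c'\rangle+\frac{a_2}{|c'|^7}\langle c',c''\rangle^2\langle\dot c',\dot c'\rangle-\frac{2a_2}{|c'|^5}\langle c',c''\rangle\langle\dot c',\dot c''\rangle+\frac{a_2}{|c'|^3}\langle\dot c'',\dot c''\rangle\,d\theta\,dt .$$ For degrees $n_t,n_\theta$ and positive integers $N_t,N_\theta$, let $B_i$ be all the normalized B-splines of degree $n_t$ with the knots $t_i$, $0\le i\le 2n_t+N_t$, given by $t_i=0$ for $i<n_t$, $t_i=(i-n_t)/N_t$ for $n_t\le i<n_t+N_t$ and $t_i=1$ for $i\ge n_t+N_t$. Let $C_j$, $1\le j\le N_\theta$, be the $2\pi$-periodic normalized B-splines of degree $n_\theta$ with the uniform knots $\theta_j=2\pi(j-n_\theta)/N_\theta$. For integers $k\le n_t$ and $\ell\le n_\theta$ let $\mathcal S_{N_t,N_\theta}$ be the orthogonal projection of $H^{k,\ell}$ onto the space of tensor product splines $\sum_{i,j}B_i(t)C_j(\theta)\,c_{i,j}$, $c_{i,j}\in\mathbb R^d$, with respect to $\langle\cdot,\cdot\rangle_{H^{k,\ell}}$. **Lemma 3.2.** Let $1\le k\le n_t$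 and $2\le\ell\le n_\theta$ (so $n_t\ge1$ and $n_\theta\ge2$). Then for every $c\in U\cap H^{k,\ell}$ the integrand of $E(c)$ is integrable; for all sufficiently large $N_t,N_\theta$ one has $\mathcal S_{N_t,N_\theta}c\in U$, with integrable energy integrand; and $$\lim_{N_t,N_\theta\to\infty}E(\mathcal S_{N_t,N_\theta}c)=E(c).$$ In particular, for $k=1$, $\ell=2$ this holds for every $c\in U$ and the $H^{1,2}$-orthogonal projections, and for $k=n_t$, $\ell=n_\theta$ it holds for every $c\in U\cap H^{n_t,n_\theta}$ and the $H^{n_t,n_\theta}$-orthogonal projections. -/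

import Mathlib

open MeasureTheory Filter Topology Set
open scoped ContDiff

noncomputable section

namespace CurvePath

/-- The target space `ℝ^d` with its Euclidean norm. -/
abbrev Vec (d : ℕ) := EuclideanSpace ℝ (Fin d)

/-- Lebesgue measure on the cylinder `[0,1] × S¹`, where the circle `S¹ = ℝ / 2πℤ` is represented by
the fundamental domain `[0, 2π]` (its end points are a null set). -/
def cyl : Measure (ℝ × ℝ) := volume.restrict (Icc 0 1 ×ˢ Icc 0 (2 * Real.pi))

/-- `L²([0,1] × S¹; ℝ^d)`. -/
abbrev L2 (d : ℕ) := Lp (Vec d) 2 cyl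

/-! ### Weak derivatives on `[0,1] × S¹` -/

/-- `∂ₜ φ`, for a function `φ(t, θ)`. -/
def dt (φ : ℝ × ℝ → ℝ) : ℝ × ℝ → ℝ := fun p => fderiv ℝ φ p (1, 0)

/-- `∂_θ φ`, for a function `φ(t, θ)`. -/
def dθ (φ : ℝ × ℝ → ℝ) : ℝ × ℝ → ℝ := fun p => fderiv ℝ φ p (0, 1)

/-- `∂ₜⁱ ∂_θʲ φ`. -/
def partialDeriv (i j : ℕ) (φ : ℝ × ℝ → ℝ) : ℝ × ℝ → ℝ := dt^[i] (dθ^[j] φ)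

/-- Test functions on `(0,1) × S¹`: smooth functions, `2π`-periodic in `θ`, with compact support in
`(0,1) × S¹`. -/
structure IsTest (φ : ℝ × ℝ → ℝ) : Prop where
  smooth : ContDiff ℝ ∞ φ
  periodic : ∀ t θ, φ (t, θ + 2 * Real.pi) = φ (t, θ)
  support : ∃ K : Set ℝ, IsCompact K ∧ K ⊆ Ioo 0 1 ∧ ∀ p : ℝ × ℝ, p.1 ∉ K → φ p = 0

/-- `g` is the weak derivative `f^{(i,j)} = ∂ₜⁱ ∂_θʲ f` on `[0,1] × S¹`. -/
def IsWeakDeriv {d : ℕ} (i j : ℕ) (f g : L2 d) : Prop :=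
  ∀ φ, IsTest φ →
    ∫ p, partialDeriv i j φ p • f p ∂cyl = (-1 : ℝ) ^ (i + j) • ∫ p, φ p • g p ∂cyl

open scoped Classical in
/-- The weak derivative `∂ₜⁱ ∂_θʲ f ∈ L²` (it is unique, see `IsWeakDeriv.unique`), and `0` if `f`
has none. -/
def weakDeriv {d : ℕ} (i j : ℕ) (f : L2 d) : L2 d :=
  if h : ∃ g, IsWeakDeriv i j f g then h.choose else 0

instance : IsFiniteMeasure cyl := by
  unfold cyl
  refine ⟨?_⟩
  rw [Measure.restrict_apply_univ]
  exact (isCompact_Icc.prod isCompact_Icc).measure_lt_top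

theorem contDiff_dt {φ : ℝ × ℝ → ℝ} (h : ContDiff ℝ ∞ φ) : ContDiff ℝ ∞ (dt φ) :=
  (h.fderiv_right (m := ∞) (by simp)).clm_apply contDiff_const

theorem contDiff_dθ {φ : ℝ × ℝ → ℝ} (h : ContDiff ℝ ∞ φ) : ContDiff ℝ ∞ (dθ φ) :=
  (h.fderiv_right (m := ∞) (by simp)).clm_apply contDiff_const

theorem contDiff_partialDeriv {φ : ℝ × ℝ → ℝ} (i j : ℕ) (h : ContDiff ℝ ∞ φ) :
    ContDiff ℝ ∞ (partialDeriv i j φ) := by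
  unfold partialDeriv
  have h1 : ContDiff ℝ ∞ (dθ^[j] φ) := by
    induction j with
    | zero => exact h
    | succ n ih => rw [Function.iterate_succ_apply']; exact contDiff_dθ ih
  induction i with
  | zero => exact h1
  | succ n ih => rw [Function.iterate_succ_apply']; exact contDiff_dt ih

theorem integrable_smul {d : ℕ} {ψ : ℝ × ℝ → ℝ} (h : Continuous ψ) (f : L2 d) :
    Integrable (fun p => ψ p • f p) cyl := by
  have hf : Integrable f cyl := (Lp.memLp f).integrable (by norm_num)
  obtain ⟨C, hC⟩ := ((isCompact_Icc (a := (0:ℝ)) (b := 1)).prod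
    (isCompact_Icc (a := (0:ℝ)) (b := 2 * Real.pi))).exists_bound_of_continuousOn h.continuousOn
  refine hf.bdd_smul C h.aestronglyMeasurable ?_
  unfold cyl
  rw [ae_restrict_iff' (measurableSet_Icc.prod measurableSet_Icc)]
  exact Eventually.of_forall hC

theorem IsWeakDeriv.add {d i j : ℕ} {f g f' g' : L2 d} (h : IsWeakDeriv i j f g)
    (h' : IsWeakDeriv i j f' g') : IsWeakDeriv i j (f + f') (g + g') := by
  intro φ hφ
  have c1 := (contDiff_partialDeriv i j hφ.smooth).continuous
  have c2 := hφ.smooth.continuous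
  have e1 : ∫ p, partialDeriv i j φ p • (f + f' : L2 d) p ∂cyl
      = ∫ p, (partialDeriv i j φ p • f p + partialDeriv i j φ p • f' p) ∂cyl := by
    refine integral_congr_ae ?_
    filter_upwards [Lp.coeFn_add f f'] with p hp
    rw [hp, Pi.add_apply, smul_add]
  have e2 : ∫ p, φ p • (g + g' : L2 d) p ∂cyl = ∫ p, (φ p • g p + φ p • g' p) ∂cyl := by
    refine integral_congr_ae ?_
    filter_upwards [Lp.coeFn_add g g'] with p hp
    rw [hp, Pi.add_apply, smul_add]
  rw [e1, e2, integral_add (integrable_smul c1 f) (integrable_smul c1 f'),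
    integral_add (integrable_smul c2 g) (integrable_smul c2 g'), smul_add, h φ hφ, h' φ hφ]

theorem IsWeakDeriv.smul {d i j : ℕ} (r : ℝ) {f g : L2 d} (h : IsWeakDeriv i j f g) :
    IsWeakDeriv i j (r • f) (r • g) := by
  intro φ hφ
  have e1 : ∫ p, partialDeriv i j φ p • (r • f : L2 d) p ∂cyl
      = ∫ p, r • (partialDeriv i j φ p • f p) ∂cyl := by
    refine integral_congr_ae ?_
    filter_upwards [Lp.coeFn_smul r f] with p hp
    rw [hp, Pi.smul_apply, smul_comm]
  have e2 : ∫ p, φ p • (r • g : L2 d) p ∂cyl = ∫ p, r • (φ p • g p) ∂cyl := by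
    refine integral_congr_ae ?_
    filter_upwards [Lp.coeFn_smul r g] with p hp
    rw [hp, Pi.smul_apply, smul_comm]
  rw [e1, e2, integral_smul, integral_smul, h φ hφ, smul_comm]

theorem IsWeakDeriv.zero {d i j : ℕ} : IsWeakDeriv i j (0 : L2 d) 0 := by
  intro φ hφ
  have e (ψ : ℝ × ℝ → ℝ) : ∫ p, ψ p • (0 : L2 d) p ∂cyl = 0 := by
    rw [← integral_zero (ℝ × ℝ) (Vec d) (μ := cyl)]
    refine integral_congr_ae ?_
    filter_upwards [Lp.coeFn_zero (Vec d) 2 cyl] with p hp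
    rw [hp]; simp
  rw [e, e, smul_zero]

/-- The periodization of a smooth function with compact support in `(0,1) × (0,2π)` is a test
function that agrees with it on `(0,1) × (0,2π)`. -/
theorem exists_test {φ : ℝ × ℝ → ℝ} (h : ContDiff ℝ ∞ φ) (hc : HasCompactSupport φ)
    (hs : tsupport φ ⊆ Ioo 0 1 ×ˢ Ioo 0 (2 * Real.pi)) :
    ∃ ψ, IsTest ψ ∧ ∀ p ∈ Ioo (0:ℝ) 1 ×ˢ Ioo 0 (2 * Real.pi), ψ p = φ p := by
  have hpi : (0:ℝ) < 2 * Real.pi := by positivity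
  have hz : ∀ p, φ p ≠ 0 → p.2 ∈ Ioo 0 (2 * Real.pi) :=
    fun p hp => (hs (subset_tsupport φ hp)).2
  refine ⟨fun p => ∑ᶠ m : ℤ, φ (p.1, p.2 + m * (2 * Real.pi)), ⟨?_, ?_, ?_⟩, ?_⟩
  · rw [← contMDiff_iff_contDiff]
    refine contMDiff_finsum (fun m => ?_) ?_
    · rw [contMDiff_iff_contDiff]
      exact h.comp (contDiff_fst.prodMk (contDiff_snd.add contDiff_const))
    · intro p
      refine ⟨{q | q.2 ∈ Ioo (p.2 - 1) (p.2 + 1)},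
        (isOpen_Ioo.preimage continuous_snd).mem_nhds (by simp), ?_⟩
      refine (finite_Icc ⌊(-p.2 - 1) / (2 * Real.pi)⌋ ⌈(2 * Real.pi - p.2 + 1) / (2 * Real.pi)⌉).subset ?_
      rintro m ⟨q, hq1, hq2⟩
      have h1 := hz _ hq1
      simp only [mem_Ioo, mem_ofPred_eq] at h1 hq2
      constructor
      · have : ((⌊(-p.2 - 1) / (2 * Real.pi)⌋ : ℤ) : ℝ) ≤ m :=
          (Int.floor_le _).trans (by rw [div_le_iff₀ hpi]; linarith)
        exact_mod_cast this
      · have : (m : ℝ) ≤ (⌈(2 * Real.pi - p.2 + 1) / (2 * Real.pi)⌉ : ℤ) :=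
          le_trans (by rw [le_div_iff₀ hpi]; linarith) (Int.le_ceil _)
        exact_mod_cast this
  · intro t θ
    simp only
    rw [← finsum_comp_equiv (Equiv.addRight (1:ℤ)) (f := fun m : ℤ => φ (t, θ + m * (2 * Real.pi)))]
    refine finsum_congr fun m => ?_
    congr 2
    simp
    ring
  · refine ⟨Prod.fst '' tsupport φ, hc.isCompact.image continuous_fst, ?_, ?_⟩
    · rintro _ ⟨p, hp, rfl⟩
      exact (hs hp).1
    · intro p hp
      refine (finsum_congr fun m => ?_).trans finsum_zero
      by_contra hne
      exact hp ⟨_, subset_tsupport φ hne, rfl⟩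
  · intro p hp
    simp only
    rw [finsum_eq_single _ (0:ℤ)]
    · simp
    · intro m hm
      by_contra hne
      have h1 := hz _ hne
      have h2 := hp.2
      simp only [mem_Ioo] at h1 h2
      rcases lt_or_gt_of_ne hm with hm | hm
      · have : (m : ℝ) ≤ -1 := by exact_mod_cast Int.le_sub_one_of_lt hm
        nlinarith
      · have : (1 : ℝ) ≤ m := by exact_mod_cast hm
        nlinarith

theorem cyl_eq : cyl = volume.restrict (Ioo (0:ℝ) 1 ×ˢ Ioo 0 (2 * Real.pi)) := by
  unfold cyl
  refine Measure.restrict_congr_set ?_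
  rw [Measure.volume_eq_prod]
  exact (Measure.set_prod_ae_eq Ioo_ae_eq_Icc Ioo_ae_eq_Icc).symm

theorem integral_cyl {V : Type*} [NormedAddCommGroup V] [NormedSpace ℝ V] (F : ℝ × ℝ → V) :
    ∫ p, F p ∂cyl = ∫ p in Ioo (0:ℝ) 1 ×ˢ Ioo 0 (2 * Real.pi), F p := by
  rw [cyl_eq]

theorem ae_cyl {P : ℝ × ℝ → Prop} :
    (∀ᵐ p ∂cyl, P p) ↔ ∀ᵐ p, p ∈ Ioo (0:ℝ) 1 ×ˢ Ioo 0 (2 * Real.pi) → P p := by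
  rw [cyl_eq, ae_restrict_iff' (isOpen_Ioo.prod isOpen_Ioo).measurableSet]

/-- Weak derivatives are unique. -/
theorem IsWeakDeriv.unique {d i j : ℕ} {f g g' : L2 d} (h : IsWeakDeriv i j f g)
    (h' : IsWeakDeriv i j f g') : g = g' := by
  have key : ∀ φ, IsTest φ → ∫ p, φ p • (g p - g' p) ∂cyl = 0 := by
    intro φ hφ
    have c2 := hφ.smooth.continuous
    have e := (h φ hφ).symm.trans (h' φ hφ)
    have e' := smul_right_injective (Vec d) (pow_ne_zero (i + j) (by norm_num : (-1:ℝ) ≠ 0)) e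
    simp only [smul_sub]
    rw [integral_sub (integrable_smul c2 g) (integrable_smul c2 g')]
    exact sub_eq_zero.2 e'
  set Ω : Set (ℝ × ℝ) := Ioo (0:ℝ) 1 ×ˢ Ioo 0 (2 * Real.pi) with hΩ
  have hΩo : IsOpen Ω := isOpen_Ioo.prod isOpen_Ioo
  have hint : Integrable (fun p => g p - g' p) cyl :=
    ((Lp.memLp g).integrable (by norm_num)).sub ((Lp.memLp g').integrable (by norm_num))
  have hint' : IntegrableOn (fun p => g p - g' p) Ω volume := by
    rw [IntegrableOn, ← cyl_eq]; exact hint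
  have hae := hΩo.ae_eq_zero_of_integral_contDiff_smul_eq_zero hint'.locallyIntegrableOn (by
    intro φ hφ hc hs
    obtain ⟨ψ, hψ, heq⟩ := exists_test hφ hc hs
    rw [← key ψ hψ, integral_cyl, ← setIntegral_eq_integral_of_forall_compl_eq_zero (s := Ω)]
    · refine setIntegral_congr_fun hΩo.measurableSet fun p hp => ?_
      rw [heq p hp]
    · intro p hp
      rw [image_eq_zero_of_notMem_tsupport fun hm => hp (hs hm), zero_smul])
  rw [Lp.ext_iff, EventuallyEq, ae_cyl]
  filter_upwards [hae] with p hp hpΩ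
  exact sub_eq_zero.1 (hp hpΩ)

/-! ### Mixed order Sobolev spaces -/

/-- The mixed order Sobolev space `H^{k,l}([0,1] × S¹; ℝ^d)` of all `f ∈ L²` with weak derivatives
`f^{(k,0)}, f^{(0,l)}, f^{(k,l)} ∈ L²`.  A function `f` is stored as the tuple
`(f, f^{(k,0)}, f^{(0,l)}, f^{(k,l)})`, which it determines, so that the inner product inherited from
the `ℓ²` sum of four copies of `L²` is
`⟪f, g⟫ + ⟪f^{(k,0)}, g^{(k,0)}⟫ + ⟪f^{(0,l)}, g^{(0,l)}⟫ + ⟪f^{(k,l)}, g^{(k,l)}⟫`. -/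
def MixedSobolev (k l d : ℕ) : Submodule ℝ (PiLp 2 fun _ : Fin 4 => L2 d) where
  carrier := {u | IsWeakDeriv k 0 (u 0) (u 1) ∧ IsWeakDeriv 0 l (u 0) (u 2) ∧
    IsWeakDeriv k l (u 0) (u 3)}
  add_mem' h h' := ⟨h.1.add h'.1, h.2.1.add h'.2.1, h.2.2.add h'.2.2⟩
  zero_mem' := ⟨.zero, .zero, .zero⟩
  smul_mem' r _ h := ⟨h.1.smul r, h.2.1.smul r, h.2.2.smul r⟩

/-- The `L²` function underlying an element of `H^{k,l}`. -/
def MixedSobolev.fn {k l d : ℕ} : MixedSobolev k l d →ₗ[ℝ] L2 d where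
  toFun u := (u : PiLp 2 fun _ : Fin 4 => L2 d) 0
  map_add' _ _ := rfl
  map_smul' _ _ := rfl

theorem MixedSobolev.fn_injective {k l d : ℕ} :
    Function.Injective (MixedSobolev.fn (k := k) (l := l) (d := d)) := by
  intro u v h
  have h0 : (u : PiLp 2 fun _ : Fin 4 => L2 d) 0 = (v : PiLp 2 fun _ : Fin 4 => L2 d) 0 := h
  obtain ⟨u1, u2, u3⟩ := u.2
  obtain ⟨v1, v2, v3⟩ := v.2
  rw [h0] at u1 u2 u3
  apply Subtype.ext
  ext1 i
  fin_cases i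
  · exact h0
  · exact u1.unique v1
  · exact u2.unique v2
  · exact u3.unique v3

/-! ### Tensor product B-splines -/

/-- The normalized B-spline of degree `n` with knots `τ i, …, τ (i + n + 1)`, by the Cox–de Boor
recursion; fractions with vanishing denominator are read as `0`. -/
def bspline (τ : ℕ → ℝ) : ℕ → ℕ → ℝ → ℝ
  | 0, i, x => (Ico (τ i) (τ (i + 1))).indicator 1 x
  | n + 1, i, x =>
      (x - τ i) / (τ (i + n + 1) - τ i) * bspline τ n i x +
      (τ (i + n + 2) - x) / (τ (i + n + 2) - τ (i + 1)) * bspline τ n (i + 1) x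

/-- The uniform knots on `[0,1]` with full multiplicity at the end points
(`i = 0, …, 2 n + N`). -/
def knotT (n N i : ℕ) : ℝ :=
  if i < n then 0 else if i < n + N then ((i : ℝ) - n) / N else 1

/-- The uniform knots for periodic splines on `[0,2π]` (`j = 0, …, 2 n + N`). -/
def knotθ (n N j : ℕ) : ℝ := 2 * Real.pi * ((j : ℝ) - n) / N

/-- The basis functions `B_i` on `[0,1]`, `i = 0, …, n + N - 1`.  The value at the single point
`t = 1` is immaterial, since splines are used as elements of `L²`. -/
def basisT (n N i : ℕ) (t : ℝ) : ℝ := bspline (knotT n N) n i t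

/-- The basis functions `C_j` on `S¹`, `j = 0, …, N - 1`: the `2π`-periodizations of the B-splines
with the knots `knotθ`. -/
def basisθ (n N j : ℕ) (θ : ℝ) : ℝ :=
  ∑ᶠ m : ℤ, bspline (knotθ n N) n j (θ + m * (2 * Real.pi))

/-- The tensor product spline `∑ᵢ ∑ⱼ B_i(t) C_j(θ) a_{ij}` with control points `a_{ij} ∈ ℝ^d`. -/
def spline {d : ℕ} (nt nθ Nt Nθ : ℕ) (a : Fin (nt + Nt) → Fin Nθ → Vec d) (p : ℝ × ℝ) : Vec d :=
  ∑ i : Fin (nt + Nt), ∑ j : Fin Nθ, (basisT nt Nt i p.1 * basisθ nθ Nθ j p.2) • a i j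

/-- The pairs consisting of a control net and the `L²` function it represents. -/
def splineGraph (nt nθ Nt Nθ d : ℕ) :
    Submodule ℝ ((Fin (nt + Nt) → Fin Nθ → Vec d) × L2 d) where
  carrier := {x | x.2 =ᵐ[cyl] spline nt nθ Nt Nθ x.1}
  add_mem' {x y} hx hy := by
    filter_upwards [hx, hy, Lp.coeFn_add x.2 y.2] with p h1 h2 h3
    simp only [Prod.snd_add, Prod.fst_add]
    rw [h3, Pi.add_apply, h1, h2]
    simp [spline, smul_add, Finset.sum_add_distrib]
  zero_mem' := by
    filter_upwards [Lp.coeFn_zero (Vec d) 2 cyl] with p h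
    simp only [Prod.snd_zero, Prod.fst_zero]
    rw [h]
    simp [spline]
  smul_mem' r x hx := by
    filter_upwards [hx, Lp.coeFn_smul r x.2] with p h1 h2
    simp only [Prod.smul_snd, Prod.smul_fst]
    rw [h2, Pi.smul_apply, h1]
    simp only [spline, Finset.smul_sum, Pi.smul_apply]
    exact Finset.sum_congr rfl fun i _ => Finset.sum_congr rfl fun j _ => smul_comm _ _ _

/-- The span of the tensor product splines `B_i ⊗ C_j` (with coefficients in `ℝ^d`), as a subspace
of `H^{k,l}`. -/
def splineSpace (k l nt nθ Nt Nθ d : ℕ) : Submodule ℝ (MixedSobolev k l d) :=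
  ((splineGraph nt nθ Nt Nθ d).map (LinearMap.snd ℝ _ _)).comap MixedSobolev.fn

theorem mem_splineSpace {k l nt nθ Nt Nθ d : ℕ} {u : MixedSobolev k l d} :
    u ∈ splineSpace k l nt nθ Nt Nθ d ↔ ∃ a, MixedSobolev.fn u =ᵐ[cyl] spline nt nθ Nt Nθ a := by
  constructor
  · rintro ⟨⟨a, f⟩, h, rfl⟩
    exact ⟨a, h⟩
  · rintro ⟨a, h⟩
    exact ⟨(a, MixedSobolev.fn u), h, rfl⟩

instance (nt nθ Nt Nθ d : ℕ) : FiniteDimensional ℝ (splineGraph nt nθ Nt Nθ d) := by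
  refine FiniteDimensional.of_injective
    ((LinearMap.fst ℝ _ _).comp (splineGraph nt nθ Nt Nθ d).subtype) ?_
  rintro ⟨⟨a, f⟩, h⟩ ⟨⟨b, g⟩, h'⟩ (rfl : a = b)
  have : f = g := Lp.ext (EventuallyEq.trans h (EventuallyEq.symm h'))
  subst this
  rfl

instance (k l nt nθ Nt Nθ d : ℕ) : FiniteDimensional ℝ (splineSpace k l nt nθ Nt Nθ d) := by
  refine FiniteDimensional.of_injective (MixedSobolev.fn.restrict
    (p := splineSpace k l nt nθ Nt Nθ d)
    (q := (splineGraph nt nθ Nt Nθ d).map (LinearMap.snd ℝ _ _)) fun _ h => h) ?_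
  intro u v h
  exact Subtype.ext (MixedSobolev.fn_injective (congrArg Subtype.val h))

theorem hasOrthogonalProjection_of_finite {V : Type*} [NormedAddCommGroup V]
    [InnerProductSpace ℝ V] (S : Submodule ℝ V) (_ : FiniteDimensional ℝ S) :
    S.HasOrthogonalProjection := inferInstance

instance (k l nt nθ Nt Nθ d : ℕ) : (splineSpace k l nt nθ Nt Nθ d).HasOrthogonalProjection :=
  hasOrthogonalProjection_of_finite _ inferInstance

/-- The spline approximation operator: the orthogonal projection of `H^{k,l}` onto the span of the
tensor product splines of degrees `nt`, `nθ`. -/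
def splineProj {k l d : ℕ} (nt nθ Nt Nθ : ℕ) (c : MixedSobolev k l d) : MixedSobolev k l d :=
  (splineSpace k l nt nθ Nt Nθ d).starProjection c

/-! ### The energy -/

/-- The set `U` of all `c ∈ H^{1,2}` such that (the continuous representative of) `c' = ∂_θ c` has no
zero on `[0,1] × S¹`. -/
def immersedPaths (d : ℕ) : Set (L2 d) :=
  {c | c ∈ range (MixedSobolev.fn (k := 1) (l := 2) (d := d)) ∧
    ∃ g : ℝ × ℝ → Vec d, ContinuousOn g (Icc 0 1 ×ˢ univ) ∧
      (∀ t ∈ Icc (0:ℝ) 1, ∀ θ, g (t, θ + 2 * Real.pi) = g (t, θ)) ∧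
      weakDeriv 0 1 c =ᵐ[cyl] g ∧
      ∀ t ∈ Icc (0:ℝ) 1, ∀ θ, g (t, θ) ≠ 0}

/-- The integrand of the energy, in terms of the values `c' = u`, `c'' = v`, `ċ = x`, `ċ' = y`,
`ċ'' = z` at a point. -/
def density {d : ℕ} (a₀ a₁ a₂ : ℝ) (u v x y z : Vec d) : ℝ :=
  a₀ * ‖u‖ * inner ℝ x x + a₁ / ‖u‖ * inner ℝ y y
    + a₂ / ‖u‖ ^ 7 * inner ℝ u v ^ 2 * inner ℝ y y
    - 2 * a₂ / ‖u‖ ^ 5 * inner ℝ u v * inner ℝ y z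
    + a₂ / ‖u‖ ^ 3 * inner ℝ z z

/-- The integrand of the energy of the path `c`. -/
def energyDensity {d : ℕ} (a₀ a₁ a₂ : ℝ) (c : L2 d) (p : ℝ × ℝ) : ℝ :=
  density a₀ a₁ a₂ (weakDeriv 0 1 c p) (weakDeriv 0 2 c p) (weakDeriv 1 0 c p)
    (weakDeriv 1 1 c p) (weakDeriv 1 2 c p)

/-- The energy `E(c)` of a path of curves for the second order Sobolev metric with constants
`a₀, a₁, a₂`. -/
def energy {d : ℕ} (a₀ a₁ a₂ : ℝ) (c : L2 d) : ℝ := ∫ p, energyDensity a₀ a₁ a₂ c p ∂cyl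

end CurvePath

end

open CurvePath

noncomputable section

namespace CurvePath

section

/-! ### B-splines -/

/-! The theorem combines two independent facts: the projections converge strongly to the identity on
`H^{k,l}` (`tendsto_splineProj`), and on `H^{k,l}` the set `U` is open
(`eventually_mem_immersedPaths`) and the energy is continuous on it (`tendsto_energy`).

Strong convergence. An orthogonal projection gives the best approximation, so the elements for which
convergence holds form a closed subspace. It therefore suffices to approximate a family with dense
span by splines. The family consists of the products `q(t) cos(mθ + a) v` with `q` smooth. For one
factor, the derivative of top order is approximated by step functions and integrated back up.
Primitives of splines are splines of one degree more (`IsSplineT.primitive`, `IsSplineθ.primitive`).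
On the circle the step functions are cell averages, because a primitive is periodic only if the
integral vanishes, and averaging preserves the integral.

Density (`topologicalClosure_trigProducts`). If `u` is orthogonal to all these products, let `W` and
`W'` be Fourier coefficients in `θ` of `u` and of `∂ₜᵏ u`. The `θ`-derivatives only contribute a
factor `1 + m^{2l}`, so that `∫ (q W + q^{(k)} W') = 0` for all smooth `q`. Test functions `q` show
that `W'` also has a weak derivative of order `k`, namely a multiple of `W`. Hence `W` and `W'` have
continuous representatives, and smooth `q` with `q ≈ W`, `q^{(k)} ≈ W'` uniformly yield `∫ (W² +
W'²) = 0`. Completeness of the trigonometric system then gives `u = 0`.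

Continuity of the energy. Completing a square writes the integrand as `a₀|·|² + a₁|·|² + a₂|·|²` of
three weighted derivatives (`density_eq`), so `L²` continuity of these three functions is enough.
The weights are continuous functions of `|c'|`, and `c'` depends on `c` continuously in the supremum
norm. The only nonlinear term of concern is `⟪c', c''⟫ ċ'`. Here `c''` is bounded in time with
values in `L²(dθ)`, because `c''` and `ċ''` are in `L²`. Moreover `ċ'` is square integrable in time
with values in `L^∞(dθ)`, because `ċ'` and `ċ''` are in `L²`. So the product is in `L²`.

These embeddings are proved first for jets (`IsJet`), which are bounded families of derivatives from
the right. That notion covers both smooth products and splines, whose top derivatives jump. The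
estimates then extend to `H^{k,l}` by density. -/

theorem bspline_shift (τ : ℕ → ℝ) (n i : ℕ) (x : ℝ) :
    bspline τ n (i + 1) x = bspline (fun j => τ (j + 1)) n i x := by
  induction n generalizing i with
  | zero => simp [bspline]
  | succ n ih =>
    simp only [bspline]
    rw [ih, ih]
    simp only [show i + 1 + n + 1 = i + n + 1 + 1 by ring, show i + 1 + n + 2 = i + n + 2 + 1 by ring]

theorem bspline_translate (τ : ℕ → ℝ) (n i : ℕ) (x s : ℝ) :
    bspline (fun j => τ j + s) n i (x + s) = bspline τ n i x := by
  induction n generalizing i with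
  | zero => simp [bspline, indicator]
  | succ n ih =>
    simp only [bspline, ih]
    congr 2
    · congr 1 <;> ring
    · congr 1 <;> ring

theorem bspline_eq_zero {τ : ℕ → ℝ} (hτ : Monotone τ) (n i : ℕ) {x : ℝ}
    (hx : x ∉ Ico (τ i) (τ (i + n + 1))) : bspline τ n i x = 0 := by
  induction n generalizing i with
  | zero => simp only [bspline]; exact indicator_of_notMem hx _
  | succ n ih =>
    simp only [bspline]
    rw [ih i, ih (i + 1)]
    · simp
    · intro h
      refine hx ⟨(hτ (by omega)).trans h.1, ?_⟩
      convert h.2 using 2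
      ring
    · intro h
      exact hx ⟨h.1, h.2.trans_le (hτ (by omega))⟩

theorem bspline_nonneg {τ : ℕ → ℝ} (hτ : Monotone τ) (n i : ℕ) (x : ℝ) : 0 ≤ bspline τ n i x := by
  induction n generalizing i with
  | zero => simp only [bspline]; exact indicator_nonneg (fun _ _ => zero_le_one) x
  | succ n ih =>
    by_cases hx : x ∈ Ico (τ i) (τ (i + (n + 1) + 1))
    · simp only [bspline]
      refine add_nonneg (mul_nonneg (div_nonneg ?_ ?_) (ih i)) (mul_nonneg (div_nonneg ?_ ?_) (ih _))
      · linarith [hx.1]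
      · linarith [hτ (show i ≤ i + n + 1 by omega)]
      · have := hx.2
        rw [show i + (n + 1) + 1 = i + n + 2 by ring] at this
        linarith
      · linarith [hτ (show i + 1 ≤ i + n + 2 by omega)]
    · rw [bspline_eq_zero hτ _ _ hx]

theorem bspline_pos {τ : ℕ → ℝ} (hτ : StrictMono τ) (n i : ℕ) {x : ℝ}
    (hx : x ∈ Ioo (τ i) (τ (i + n + 1))) : 0 < bspline τ n i x := by
  induction n generalizing i with
  | zero => simp only [bspline]; rw [indicator_of_mem (show x ∈ Ico _ _ from ⟨hx.1.le, hx.2⟩)]; simp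
  | succ n ih =>
    simp only [bspline]
    have h1 : 0 < (x - τ i) / (τ (i + n + 1) - τ i) :=
      div_pos (by linarith [hx.1]) (by linarith [hτ (show i < i + n + 1 by omega)])
    have hx2 := hx.2
    rw [show i + (n + 1) + 1 = i + n + 2 by ring] at hx2
    have h2 : 0 < (τ (i + n + 2) - x) / (τ (i + n + 2) - τ (i + 1)) :=
      div_pos (by linarith) (by linarith [hτ (show i + 1 < i + n + 2 by omega)])
    have m1 := mul_nonneg h1.le (bspline_nonneg hτ.monotone n i x)
    have m2 := mul_nonneg h2.le (bspline_nonneg hτ.monotone n (i + 1) x)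
    rcases lt_or_ge x (τ (i + n + 1)) with h | h
    · have := mul_pos h1 (ih i ⟨hx.1, h⟩)
      linarith
    -- Here the second summand is positive. In degree zero `x` may be the left end of the next cell,
    -- which the open interval in the induction hypothesis excludes, so this case is computed
    -- directly.
    · rcases Nat.eq_zero_or_pos n with rfl | hn
      · have : bspline τ 0 (i + 1) x = 1 := by
          simp only [bspline]
          rw [indicator_of_mem (show x ∈ Ico _ _ from ⟨by simpa using h, by simpa using hx2⟩)]; simp
        rw [this] at m2 ⊢
        linarith
      · have := mul_pos h2 (ih (i + 1) ⟨(hτ (show i + 1 < i + n + 1 by omega)).trans_le h, by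
          convert hx2 using 2; ring⟩)
        linarith

/-- The derivative of a B-spline from the right, in terms of B-splines of lower degree. -/
theorem hasDerivWithinAt_bspline {τ : ℕ → ℝ} (hτ : Monotone τ) (n i : ℕ) (x : ℝ) :
    HasDerivWithinAt (bspline τ (n + 1) i)
      ((n + 1) * (bspline τ n i x / (τ (i + n + 1) - τ i)
        - bspline τ n (i + 1) x / (τ (i + n + 2) - τ (i + 1)))) (Ici x) x := by
  -- The product rule in the Cox–de Boor recursion.
  have step : ∀ (n i : ℕ) (D D' : ℝ), HasDerivWithinAt (bspline τ n i) D (Ici x) x →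
      HasDerivWithinAt (bspline τ n (i + 1)) D' (Ici x) x →
      HasDerivWithinAt (bspline τ (n + 1) i)
        (1 / (τ (i + n + 1) - τ i) * bspline τ n i x + (x - τ i) / (τ (i + n + 1) - τ i) * D +
          (-1 / (τ (i + n + 2) - τ (i + 1)) * bspline τ n (i + 1) x +
            (τ (i + n + 2) - x) / (τ (i + n + 2) - τ (i + 1)) * D')) (Ici x) x := by
    intro n i D D' h h'
    have e1 := (((hasDerivWithinAt_id x (Ici x)).sub_const (τ i)).div_const
      (τ (i + n + 1) - τ i)).mul h
    have e2 := (((hasDerivWithinAt_id x (Ici x)).const_sub (τ (i + n + 2))).div_const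
      (τ (i + n + 2) - τ (i + 1))).mul h'
    exact e1.add e2
  induction n generalizing i with
  | zero =>
    -- Indicators of half-open intervals `[a, b)` are locally constant to the right of every point.
    -- This is why derivatives from the right exist everywhere, including at knots.
    have h0 : ∀ i, HasDerivWithinAt (bspline τ 0 i) 0 (Ici x) x := by
      intro i
      have : bspline τ 0 i =ᶠ[𝓝[≥] x] fun _ => bspline τ 0 i x := by
        simp only [bspline]
        by_cases hx : x ∈ Ico (τ i) (τ (i + 1))
        · filter_upwards [Ico_mem_nhdsGE hx.2] with y hy
          rw [indicator_of_mem hx, indicator_of_mem (show y ∈ Ico _ _ from ⟨hx.1.trans hy.1, hy.2⟩)]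
          rfl
        · rw [mem_Ico, not_and_or, not_le, not_lt] at hx
          rcases hx with hx | hx
          · filter_upwards [Ico_mem_nhdsGE hx] with y hy
            rw [indicator_of_notMem (fun h => absurd h.1 (by linarith [hy.2])),
              indicator_of_notMem (fun h => absurd h.1 (by linarith))]
          · filter_upwards [self_mem_nhdsWithin] with y (hy : x ≤ y)
            rw [indicator_of_notMem (fun h => absurd h.2 (by linarith)),
              indicator_of_notMem (fun h => absurd h.2 (by linarith))]
      exact (hasDerivWithinAt_const x _ _).congr_of_eventuallyEq this rfl
    convert step 0 i 0 0 (h0 i) (h0 (i + 1)) using 1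
    push_cast
    ring
  | succ n ih =>
    convert step (n + 1) i _ _ (ih i) (ih (i + 1)) using 1
    simp only [bspline]
    set B0 := bspline τ n i x
    set B1 := bspline τ n (i + 1) x
    set B2 := bspline τ n (i + 1 + 1) x
    simp only [show i + (n + 1) + 1 = i + n + 2 by ring, show i + (n + 1) + 2 = i + n + 3 by ring,
      show i + 1 + n + 1 = i + n + 2 by ring, show i + 1 + n + 2 = i + n + 3 by ring,
      show i + 1 + 1 = i + 2 by ring]
    -- The product rule and the claimed formula differ by a multiple of this expression. If the
    -- first gap vanishes, division by zero makes the expression zero. Otherwise the two larger gaps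
    -- are positive and both quotients equal one.
    have key : B1 / (τ (i + n + 2) - τ (i + 1)) * ((τ (i + n + 3) - τ (i + 1)) /
        (τ (i + n + 3) - τ (i + 1)) - (τ (i + n + 2) - τ i) / (τ (i + n + 2) - τ i)) = 0 := by
      rcases eq_or_ne (τ (i + n + 2) - τ (i + 1)) 0 with h | h
      · rw [h]; simp
      · have h1 := hτ (show i + 1 ≤ i + n + 2 by omega)
        have h2 := hτ (show i ≤ i + 1 by omega)
        have h3 := hτ (show i + n + 2 ≤ i + n + 3 by omega)
        have h4 : τ (i + 1) < τ (i + n + 2) := lt_of_le_of_ne h1 fun h' => h (by rw [h']; ring)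
        rw [div_self (by linarith), div_self (by linarith)]
        ring
    push_cast
    simp only [div_eq_mul_inv] at key ⊢
    linear_combination (-(n + 1 : ℝ)) * key

/-- For simple knots this is a hat function. When two of its knots coincide it degenerates to a ramp
whose only jump is at the double knot, and this jump is invisible from a set on one side of the
knot. With a triple knot it vanishes. -/
theorem continuousOn_bspline_one {τ : ℕ → ℝ} (hτ : Monotone τ) {S : Set ℝ}
    (hS : ∀ i, τ i = τ (i + 1) → S ⊆ Ici (τ i) ∨ S ⊆ Iio (τ i)) (i : ℕ) :
    ContinuousOn (bspline τ 1 i) S := by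
  have hab := hτ (show i ≤ i + 1 by omega)
  have hbc := hτ (show i + 1 ≤ i + 2 by omega)
  have h1 := hS i
  have h2 := hS (i + 1)
  have e : ∀ x, bspline τ 1 i x = (x - τ i) / (τ (i + 1) - τ i) *
      (if τ i ≤ x ∧ x < τ (i + 1) then 1 else 0) + (τ (i + 2) - x) / (τ (i + 2) - τ (i + 1)) *
      (if τ (i + 1) ≤ x ∧ x < τ (i + 2) then 1 else 0) := by
    intro x
    simp [bspline, indicator]
  rw [show i + 1 + 1 = i + 2 by ring] at h2
  generalize τ i = a at *
  generalize τ (i + 1) = b at *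
  generalize τ (i + 2) = c at *
  have z : (∀ x ∈ S, bspline τ 1 i x = 0) → ContinuousOn (bspline τ 1 i) S := fun h =>
    (continuousOn_const (c := (0:ℝ))).congr h
  have dn : ∀ u v : ℝ, u < v → ∀ x, u ≤ x → 0 ≤ (x - u) / (v - u) := fun u v h x hx =>
    div_nonneg (by linarith) (by linarith)
  rcases hab.eq_or_lt with hab | hab <;> rcases hbc.eq_or_lt with hbc | hbc
  · subst hab; subst hbc
    exact z fun x _ => by rw [e]; simp
  · subst hab
    rcases h1 rfl with h | h
    · refine ContinuousOn.congr (f := fun x => max 0 ((c - x) / (c - a))) (by fun_prop) ?_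
      intro x hx
      have hx : a ≤ x := h hx
      rw [e]
      simp only
      rcases lt_or_ge x c with h' | h'
      · rw [max_eq_right (div_nonneg (by linarith) (by linarith))]
        simp [hx, h']
      · rw [max_eq_left (div_nonpos_of_nonpos_of_nonneg (by linarith) (by linarith))]
        simp [not_lt.2 h']
    · refine z fun x hx => ?_
      have hx : x < a := h hx
      rw [e]
      simp [not_le.2 hx]
  · subst hbc
    rcases h2 rfl with h | h
    · refine z fun x hx => ?_
      have hx : b ≤ x := h hx
      rw [e]
      simp [not_lt.2 hx]
    · refine ContinuousOn.congr (f := fun x => max 0 ((x - a) / (b - a))) (by fun_prop) ?_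
      intro x hx
      have hx : x < b := h hx
      rw [e]
      simp only
      rcases le_or_gt a x with h' | h'
      · rw [max_eq_right (dn a b hab x h')]
        simp [hx, h']
      · rw [max_eq_left (div_nonpos_of_nonpos_of_nonneg (by linarith) (by linarith))]
        simp [not_le.2 h']
  · refine ContinuousOn.congr (f := fun x => max 0 (min ((x - a) / (b - a)) ((c - x) / (c - b))))
      (by fun_prop) ?_
    intro x hx
    have p1 : 0 < b - a := by linarith
    have p2 : 0 < c - b := by linarith
    rw [e]
    simp only
    rcases lt_or_ge x a with h | h
    · rw [max_eq_left ((min_le_left _ _).trans (div_nonpos_of_nonpos_of_nonneg (by linarith) p1.le))]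
      simp [not_le.2 h, not_le.2 (h.trans hab)]
    rcases lt_or_ge x b with h' | h'
    · rw [min_eq_left, max_eq_right (dn a b hab x h)]
      · simp [h, h', not_le.2 h']
      · calc (x - a) / (b - a) ≤ 1 := by rw [div_le_one p1]; linarith
          _ ≤ (c - x) / (c - b) := by rw [one_le_div p2]; linarith
    rw [min_eq_right]
    · rcases lt_or_ge x c with h'' | h''
      · rw [max_eq_right (div_nonneg (by linarith) p2.le)]
        simp [h', h'', not_lt.2 h']
      · rw [max_eq_left (div_nonpos_of_nonpos_of_nonneg (by linarith) p2.le)]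
        simp [not_lt.2 h', not_lt.2 h'']
    · calc (c - x) / (c - b) ≤ 1 := by rw [div_le_one p2]; linarith
        _ ≤ (x - a) / (b - a) := by rw [one_le_div p1]; linarith

/-- B-splines of positive degree are continuous on every set that lies on one side of every
multiple knot. -/
theorem continuousOn_bspline {τ : ℕ → ℝ} (hτ : Monotone τ) {S : Set ℝ}
    (hS : ∀ i, τ i = τ (i + 1) → S ⊆ Ici (τ i) ∨ S ⊆ Iio (τ i)) (n i : ℕ) :
    ContinuousOn (bspline τ (n + 1) i) S := by
  induction n generalizing i with
  | zero => exact continuousOn_bspline_one hτ hS i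
  | succ n ih =>
    have h1 := ih i
    have h2 := ih (i + 1)
    show ContinuousOn (fun x => (x - τ i) / (τ (i + (n + 1) + 1) - τ i) * bspline τ (n + 1) i x +
      (τ (i + (n + 1) + 2) - x) / (τ (i + (n + 1) + 2) - τ (i + 1)) * bspline τ (n + 1) (i + 1) x) S
    fun_prop

theorem continuous_bspline {τ : ℕ → ℝ} (hτ : StrictMono τ) (n i : ℕ) :
    Continuous (bspline τ (n + 1) i) := by
  rw [← continuousOn_univ]
  exact continuousOn_bspline hτ.monotone (fun i h => absurd h (hτ (Nat.lt_succ_self i)).ne) n i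

theorem measurable_bspline (τ : ℕ → ℝ) (n i : ℕ) : Measurable (bspline τ n i) := by
  induction n generalizing i with
  | zero => exact measurable_one.indicator measurableSet_Ico
  | succ n ih =>
    have h1 := ih i
    have h2 := ih (i + 1)
    show Measurable (fun x => (x - τ i) / (τ (i + n + 1) - τ i) * bspline τ n i x +
      (τ (i + n + 2) - x) / (τ (i + n + 2) - τ (i + 1)) * bspline τ n (i + 1) x)
    fun_prop

/-- Summation by parts: it converts the derivative of a spline into a spline of lower degree whose
coefficients are differences. -/
theorem sum_range_mul_sub (a β : ℕ → ℝ) (M : ℕ) :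
    ∑ i ∈ Finset.range (M + 1), a i * (β i - β (i + 1)) =
      a 0 * β 0 + ∑ i ∈ Finset.range M, (a (i + 1) - a i) * β (i + 1) - a M * β (M + 1) := by
  induction M with
  | zero => simp; ring
  | succ M ih => rw [Finset.sum_range_succ, ih, Finset.sum_range_succ _ M]; ring

end

section

/-! ### Knots -/

theorem knotT_mono (n N : ℕ) : Monotone (knotT n N) := by
  refine monotone_nat_of_le_succ fun i => ?_
  have hN : (0:ℝ) ≤ N := Nat.cast_nonneg N
  unfold knotT
  split_ifs with h1 h2 h3 h4 h5
  · exact le_rfl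
  · have : (n : ℝ) ≤ (i + 1 : ℕ) := by exact_mod_cast not_lt.1 h2
    exact div_nonneg (by linarith) hN
  · exact zero_le_one
  · omega
  · push_cast
    gcongr
    linarith
  · have : (i : ℝ) ≤ n + N := by exact_mod_cast h4.le
    exact div_le_one_of_le₀ (by linarith) hN
  · omega
  · omega
  · exact le_rfl

/-- Raising the degree adds one more knot at `0`. Together with `bspline_shift` this identifies the
B-splines in the derivative of a spline with the basis of one degree less. -/
theorem knotT_succ (n N i : ℕ) : knotT (n + 1) N (i + 1) = knotT n N i := by
  unfold knotT
  push_cast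
  simp only [add_lt_add_iff_right, show n + 1 + N = n + N + 1 by ring]
  congr 3
  ring

theorem knotT_eq_zero {n N i : ℕ} (hN : 0 < N) (h : i ≤ n) : knotT n N i = 0 := by
  unfold knotT
  split_ifs with h1 h2
  · rfl
  · rw [show i = n by omega]; simp
  · omega

theorem knotT_of_le {n N i : ℕ} (hN : 0 < N) (h1 : n ≤ i) (h2 : i ≤ n + N) :
    knotT n N i = ((i : ℝ) - n) / N := by
  have hN' : (N : ℝ) ≠ 0 := by positivity
  unfold knotT
  rw [if_neg (by omega)]
  split_ifs with h
  · rfl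
  · rw [show i = n + N by omega]
    push_cast
    field_simp
    ring

theorem knotθ_strictMono (n : ℕ) {N : ℕ} (hN : 0 < N) : StrictMono (knotθ n N) := by
  intro i j hij
  have : (i : ℝ) < j := by exact_mod_cast hij
  have hN' : (0:ℝ) < N := by positivity
  unfold knotθ
  gcongr

theorem knotθ_succ (n N i : ℕ) : knotθ (n + 1) N (i + 1) = knotθ n N i := by
  unfold knotθ
  push_cast
  ring

theorem knotθ_add (n : ℕ) {N : ℕ} (hN : 0 < N) (i : ℕ) :
    knotθ n N (i + N) = knotθ n N i + 2 * Real.pi := by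
  have hN' : (N : ℝ) ≠ 0 := by positivity
  unfold knotθ
  push_cast
  field_simp
  ring

/-! ### Splines on `[0,1]` -/

/-- `s` agrees on `[0,1)` with a spline of degree `n` on the uniform grid with `N` cells. -/
def IsSplineT (n N : ℕ) (s : ℝ → ℝ) : Prop :=
  ∃ a : ℕ → ℝ, ∀ x ∈ Ico (0:ℝ) 1, s x = ∑ i ∈ Finset.range (n + N), a i * basisT n N i x

/-- Because `0` is a knot of multiplicity `n + 1`, the value of a spline there is its first
coefficient. This fixes the constant of integration below. -/
theorem bspline_knotT_zero {n N : ℕ} (hN : 0 < N) (i : ℕ) :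
    bspline (knotT n N) n i 0 = if i = 0 then 1 else 0 := by
  have hN' : (0:ℝ) < N := by positivity
  induction n generalizing i with
  | zero =>
    simp only [bspline, indicator, mem_Ico, Pi.one_apply]
    congr 1
    rw [eq_iff_iff]
    constructor
    · intro h
      by_contra hi
      have h1 : knotT 0 N 1 = 1 / N := by rw [knotT_of_le hN (by omega) (by omega)]; simp
      have h2 := knotT_mono 0 N (show 1 ≤ i by omega)
      have : (0:ℝ) < 1 / N := by positivity
      linarith [h.1]
    · rintro rfl
      rw [knotT_eq_zero hN le_rfl, knotT_of_le hN (by omega) (by omega)]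
      simp [hN]
  | succ n ih =>
    have e : ∀ i, bspline (knotT (n + 1) N) n (i + 1) 0 = if i = 0 then 1 else 0 := by
      intro i
      rw [bspline_shift]
      simp only [knotT_succ]
      exact ih i
    have hk : knotT (n + 1) N (n + 2) = 1 / N := by
      rw [knotT_of_le hN (by omega) (by omega)]
      push_cast
      congr 1
      ring
    simp only [bspline]
    rw [e]
    rcases i with _ | i
    · rw [knotT_eq_zero hN (Nat.zero_le _)]
      rw [show 0 + n + 2 = n + 2 by ring, show 0 + 1 = 1 by ring, hk, knotT_eq_zero hN (i := 1) (by omega)]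
      simp [hN.ne']
    · rw [e]
      rcases i with _ | i
      · rw [knotT_eq_zero hN (i := 0 + 1) (by omega)]
        simp
      · simp

/-- Suitable partial sums of the coefficients of `s` give a spline with the right derivative `s` and
the initial value of `S`. A continuous function is determined by these two data. -/
theorem IsSplineT.primitive {n N : ℕ} (hN : 0 < N) {s S : ℝ → ℝ} (hs : IsSplineT n N s)
    (hSc : ContinuousOn S (Icc 0 1))
    (hSd : ∀ x ∈ Ico (0:ℝ) 1, HasDerivWithinAt S (s x) (Ici x) x) : IsSplineT (n + 1) N S := by
  obtain ⟨g, hg⟩ := hs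
  have hN' : (0:ℝ) < N := by positivity
  set τ := knotT (n + 1) N with hτd
  have hτ : Monotone τ := knotT_mono _ _
  have e : ∀ i x, bspline τ n (i + 1) x = basisT n N i x := by
    intro i x
    rw [bspline_shift]
    simp only [hτd, knotT_succ]
    rfl
  -- The increments are chosen to cancel the factor `(n + 1) / (knot gap)` in the derivative
  -- formula.
  set a : ℕ → ℝ := fun i => S 0 +
    ∑ r ∈ Finset.range i, g r * (τ (r + n + 2) - τ (r + 1)) / (n + 1) with ha
  have hstep : ∀ i, a (i + 1) - a i = g i * (τ (i + n + 2) - τ (i + 1)) / (n + 1) := by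
    intro i
    simp only [ha, Finset.sum_range_succ]
    ring
  set β : ℝ → ℕ → ℝ := fun x i => bspline τ n i x / (τ (i + n + 1) - τ i) with hβ
  set h : ℝ → ℝ := fun x => ∑ i ∈ Finset.range (n + 1 + N), a i * basisT (n + 1) N i x with hh
  -- The only multiple knots are `0` and `1`, and `[0,1)` lies on one side of each.
  have hcont : ContinuousOn h (Ico 0 1) := by
    refine continuousOn_finsetSum _ fun i _ => continuousOn_const.mul ?_
    refine continuousOn_bspline hτ (fun i hi => ?_) n i
    by_cases h1 : i + 1 ≤ n + 1
    · left
      rw [hτd, knotT_eq_zero hN (by omega)]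
      exact fun x hx => hx.1
    · right
      by_cases h2 : i + 1 ≤ n + 1 + N
      · exfalso
        rw [hτd, knotT_of_le hN (by omega) (by omega), knotT_of_le hN (by omega) (by omega),
          div_left_inj' hN'.ne'] at hi
        push_cast at hi
        linarith
      · rw [hτd, knotT, if_neg (by omega), if_neg (by omega)]
        exact fun x hx => hx.2
  -- A vanishing gap would read a fraction as zero and lose the coefficient `g i`.
  have hpos : ∀ i < n + N, τ (i + n + 2) - τ (i + 1) ≠ 0 := by
    intro i hi
    have h1 : (0:ℝ) < 1 / N := by positivity
    have h2 : τ (i + n + 2) > τ (i + 1) := by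
      by_cases hin : i ≤ n
      · rw [hτd, knotT_eq_zero hN (i := i + 1) (by omega)]
        have := hτ (show n + 2 ≤ i + n + 2 by omega)
        have h3 : τ (n + 2) = 1 / N := by
          rw [hτd, knotT_of_le hN (by omega) (by omega)]
          push_cast
          congr 1
          ring
        linarith
      · have := hτ (show i + 2 ≤ i + n + 2 by omega)
        refine lt_of_lt_of_le ?_ this
        rw [hτd, knotT_of_le hN (by omega) (by omega), knotT_of_le hN (by omega) (by omega)]
        push_cast
        gcongr
        norm_num
    linarith
  have hderiv : ∀ x ∈ Ico (0:ℝ) 1, HasDerivWithinAt h (s x) (Ici x) x := by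
    intro x hx
    have h1 : HasDerivWithinAt h (∑ i ∈ Finset.range (n + 1 + N), a i *
        ((n + 1) * (β x i - β x (i + 1)))) (Ici x) x := by
      refine HasDerivWithinAt.fun_sum fun i _ => ?_
      have := (hasDerivWithinAt_bspline hτ n i x).const_mul (a i)
      have e2 : β x (i + 1) = bspline τ n (i + 1) x / (τ (i + n + 2) - τ (i + 1)) := by
        simp only [hβ]
        rw [show i + 1 + n + 1 = i + n + 2 by ring]
      rw [e2]
      exact this
    have h2 : ∑ i ∈ Finset.range (n + 1 + N), a i * ((n + 1) * (β x i - β x (i + 1))) = s x := by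
      have h3 : ∑ i ∈ Finset.range (n + 1 + N), a i * ((n + 1) * (β x i - β x (i + 1))) =
          (n + 1) * ∑ i ∈ Finset.range (n + N + 1), a i * (β x i - β x (i + 1)) := by
        rw [Finset.mul_sum, show n + 1 + N = n + N + 1 by ring]
        exact Finset.sum_congr rfl fun i _ => by ring
      -- Both boundary terms of the summation by parts vanish because their `n + 2` knots coincide,
      -- at `0` and at `1` respectively, and division by zero gives zero.
      have b0 : β x 0 = 0 := by
        simp only [hβ]
        rw [hτd, knotT_eq_zero hN (by omega), knotT_eq_zero hN (by omega)]
        simp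
      have b1 : β x (n + N + 1) = 0 := by
        simp only [hβ]
        rw [hτd, knotT, if_neg (by omega), if_neg (by omega), knotT, if_neg (by omega),
          if_neg (by omega)]
        simp
      rw [h3, sum_range_mul_sub, b0, b1, hg x hx]
      simp only [mul_zero, zero_add, sub_zero]
      rw [Finset.mul_sum]
      refine Finset.sum_congr rfl fun i hi => ?_
      have := hpos i (Finset.mem_range.1 hi)
      rw [hstep]
      simp only [hβ]
      rw [e, show i + 1 + n + 1 = i + n + 2 by ring]
      have : (n:ℝ) + 1 ≠ 0 := by positivity
      field_simp
    rwa [h2] at h1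
  have h0 : S 0 = h 0 := by
    simp only [hh]
    rw [Finset.sum_eq_single 0]
    · simp [basisT, bspline_knotT_zero hN, ha]
    · intro i _ hi
      simp [basisT, bspline_knotT_zero hN, hi]
    · intro h'
      simp at h'
  refine ⟨a, fun x hx => ?_⟩
  refine eq_of_has_deriv_right_eq (a := 0) (b := x) (f' := s) (fun y hy => hSd y ⟨hy.1, hy.2.trans hx.2⟩)
    (fun y hy => hderiv y ⟨hy.1, hy.2.trans hx.2⟩) (hSc.mono (Icc_subset_Icc le_rfl hx.2.le))
    (hcont.mono fun y hy => ⟨hy.1, hy.2.trans_lt hx.2⟩) h0 x (right_mem_Icc.2 hx.1)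

/-! ### Periodic splines -/

/-- `s` agrees on `[0,2π)` with a periodic spline of degree `n` on the uniform grid with `N`
cells. -/
def IsSplineθ (n N : ℕ) (s : ℝ → ℝ) : Prop :=
  ∃ a : ℕ → ℝ, ∀ x ∈ Ico (0:ℝ) (2 * Real.pi),
    s x = ∑ j ∈ Finset.range N, a j * basisθ n N j x

/-- The terms of the periodization of a B-spline that do not vanish on `[0,2π)`. -/
def wrap (τ : ℕ → ℝ) (n j : ℕ) (x : ℝ) : ℝ := bspline τ n j x + bspline τ n j (x - 2 * Real.pi)

theorem knotθ_lower {n N : ℕ} (hN : n + 1 ≤ N) (j : ℕ) : -(2 * Real.pi) ≤ knotθ n N j := by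
  have hN' : (0:ℝ) < N := by exact_mod_cast (by omega : 0 < N)
  unfold knotθ
  rw [le_div_iff₀ hN']
  have h1 : (n : ℝ) + 1 ≤ N := by exact_mod_cast hN
  have h2 : (0:ℝ) ≤ j := Nat.cast_nonneg j
  nlinarith [Real.pi_pos]

theorem knotθ_upper {n N i : ℕ} (hN : 0 < N) (hi : i ≤ n + N) : knotθ n N i ≤ 2 * Real.pi := by
  have hN' : (0:ℝ) < N := by exact_mod_cast hN
  unfold knotθ
  rw [div_le_iff₀ hN']
  have h1 : (i : ℝ) ≤ n + N := by exact_mod_cast hi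
  nlinarith [Real.pi_pos]

/-- For `N ≥ n + 1` the knots of the B-spline lie in `[-2π, 2π]`, so only the translates with `m =
0` and `m = -1` can meet the fundamental domain. -/
theorem basisθ_eq {n N j : ℕ} (hN : n + 1 ≤ N) (hj : j < N) {x : ℝ}
    (hx : x ∈ Ico (0:ℝ) (2 * Real.pi)) : basisθ n N j x = wrap (knotθ n N) n j x := by
  have hN0 : 0 < N := by omega
  have hm := (knotθ_strictMono n hN0).monotone
  unfold basisθ wrap
  rw [finsum_eq_sum_of_support_subset (s := {0, -1})]
  · rw [Finset.sum_pair (by decide)]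
    simp [sub_eq_add_neg]
  · intro m hsupp
    by_contra hne
    simp only [Finset.coe_insert, Finset.coe_singleton, mem_insert_iff, mem_singleton_iff,
      not_or] at hne
    refine hsupp (bspline_eq_zero hm n j ?_)
    rintro ⟨h1, h2⟩
    have h3 := knotθ_lower hN j
    have h4 := knotθ_upper (n := n) hN0 (show j + n + 1 ≤ n + N by omega)
    have := Real.pi_pos
    rcases lt_or_ge m 1 with h | h
    · have : (m : ℝ) ≤ -2 := by exact_mod_cast (by omega : m ≤ -2)
      nlinarith [hx.2]
    · have : (1 : ℝ) ≤ m := by exact_mod_cast h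
      nlinarith [hx.1]

theorem hasDerivWithinAt_wrap {τ : ℕ → ℝ} (hτ : Monotone τ) (n j : ℕ) (x : ℝ) :
    HasDerivWithinAt (wrap τ (n + 1) j)
      ((n + 1) * (wrap τ n j x / (τ (j + n + 1) - τ j)
        - wrap τ n (j + 1) x / (τ (j + n + 2) - τ (j + 1)))) (Ici x) x := by
  have h1 := hasDerivWithinAt_bspline hτ n j x
  have h2 : HasDerivWithinAt (fun y => bspline τ (n + 1) j (y - 2 * Real.pi)) _ (Ici x) x :=
    HasDerivWithinAt.scomp (h := fun y => y - 2 * Real.pi) (t' := Ici (x - 2 * Real.pi)) x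
      (hasDerivWithinAt_bspline hτ n j (x - 2 * Real.pi))
      ((hasDerivWithinAt_id x (Ici x)).sub_const (2 * Real.pi)) (fun y (hy : x ≤ y) => by
        simpa using hy)
  refine (h1.add h2).congr_deriv ?_
  simp only [wrap, one_smul]
  ring

/-- As on the interval, but the cyclic summation by parts leaves a defect `G` times one nonnegative
B-spline. Since `S` and the candidate `h` are both periodic, the integral of the defect is zero,
whence `G = 0`. The remaining additive constant is itself a spline. -/
theorem IsSplineθ.primitive {n N : ℕ} (hN : n + 2 ≤ N) {s S : ℝ → ℝ} (hs : IsSplineθ n N s)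
    (hSc : ContinuousOn S (Icc 0 (2 * Real.pi)))
    (hSd : ∀ x ∈ Ico (0:ℝ) (2 * Real.pi), HasDerivWithinAt S (s x) (Ici x) x)
    (hper : S 0 = S (2 * Real.pi)) : IsSplineθ (n + 1) N S := by
  obtain ⟨g, hg⟩ := hs
  have hN0 : 0 < N := by omega
  have hN' : (0:ℝ) < N := by positivity
  have hpi := Real.pi_pos
  set τ := knotθ (n + 1) N with hτd
  have hτ : StrictMono τ := knotθ_strictMono _ hN0
  set δ : ℝ := 2 * Real.pi / N with hδ
  have hδ0 : 0 < δ := by positivity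
  have hgap : ∀ i r, τ (i + r) - τ i = r * δ := by
    intro i r
    simp only [hτd, knotθ, hδ]
    push_cast
    ring
  have hd : ∀ j x, HasDerivWithinAt (wrap τ (n + 1) j)
      (δ⁻¹ * (wrap τ n j x - wrap τ n (j + 1) x)) (Ici x) x := by
    intro j x
    refine (hasDerivWithinAt_wrap hτ.monotone n j x).congr_deriv ?_
    rw [show j + n + 1 = j + (n + 1) by ring, show j + n + 2 = j + 1 + (n + 1) by ring, hgap, hgap]
    push_cast
    field_simp
  have hc : ∀ j, Continuous (wrap τ (n + 1) j) := by
    intro j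
    have := continuous_bspline hτ n j
    unfold wrap
    fun_prop
  have e : ∀ j x, wrap τ n (j + 1) x = wrap (knotθ n N) n j x := by
    intro j x
    simp only [wrap]
    rw [bspline_shift, bspline_shift]
    simp only [hτd, knotθ_succ]
  have htop : τ (n + 1 + N) = 2 * Real.pi := by
    have h0 : τ (n + 1) = 0 := by simp [hτd, knotθ]
    rw [hτd, knotθ_add _ hN0, ← hτd, h0, zero_add]
  -- the two ends of the cyclic range of indices
  have hcyc : ∀ x ∈ Ico (0:ℝ) (2 * Real.pi), wrap τ n 0 x = wrap τ n N x := by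
    intro x hx
    have h1 : bspline τ n 0 x = 0 := by
      refine bspline_eq_zero hτ.monotone _ _ fun h => ?_
      have := h.2
      rw [zero_add, hτd, knotθ] at this
      simp at this
      linarith [hx.1]
    have h2 : bspline τ n N (x - 2 * Real.pi) = 0 := by
      refine bspline_eq_zero hτ.monotone _ _ fun h => ?_
      have := h.1
      have h3 : 0 < τ N := by
        have : τ (n + 1) = 0 := by simp [hτd, knotθ]
        rw [← this]
        exact hτ (by omega)
      linarith [hx.2]
    have h3 : bspline τ n N x = bspline τ n 0 (x - 2 * Real.pi) := by
      have sh : ∀ r (τ : ℕ → ℝ) , bspline τ n r x = bspline (fun j => τ (j + r)) n 0 x := by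
        intro r
        induction r with
        | zero => intro τ; rfl
        | succ r ih =>
          intro τ
          rw [bspline_shift, ih]
          simp only [show ∀ j, j + r + 1 = j + (r + 1) from fun j => by ring]
      rw [sh]
      simp only [hτd, knotθ_add _ hN0]
      conv_lhs => rw [show x = (x - 2 * Real.pi) + 2 * Real.pi by ring]
      rw [bspline_translate]
    simp only [wrap]
    rw [h1, h2, h3]
    ring
  -- The two summands change roles, while the translates at `2π` and `-2π` vanish. A knot at exactly
  -- `-2π` would require `N = n + 1`, which `hN` excludes.
  have hends : ∀ j < N, wrap τ (n + 1) j 0 = wrap τ (n + 1) j (2 * Real.pi) := by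
    intro j hj
    have h1 : bspline τ (n + 1) j (2 * Real.pi) = 0 := by
      refine bspline_eq_zero hτ.monotone _ _ fun h => ?_
      have := h.2
      have h2 := hτ.monotone (show j + (n + 1) + 1 ≤ n + 1 + N by omega)
      linarith
    have h2 : bspline τ (n + 1) j (0 - 2 * Real.pi) = 0 := by
      refine bspline_eq_zero hτ.monotone _ _ fun h => ?_
      have h3 := h.1
      have h4 := knotθ_lower (n := n + 1) hN j
      have h5 : knotθ (n + 1) N j = -(2 * Real.pi) := le_antisymm (by rw [← hτd]; linarith) h4
      rw [knotθ, div_eq_iff hN'.ne'] at h5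
      have h6 : (j : ℝ) - (n + 1 : ℕ) = -N := by
        have : 2 * Real.pi * (((j : ℝ) - (n + 1 : ℕ)) + N) = 0 := by linarith
        have := (mul_eq_zero.1 this).resolve_left (by positivity)
        linarith
      have h7 : (j : ℤ) - (n + 1 : ℕ) = -N := by exact_mod_cast h6
      have h8 : j = 0 ∧ N = n + 1 := by omega
      omega
    simp only [wrap]
    rw [h1, h2, sub_self]
    ring
  obtain ⟨M, rfl⟩ : ∃ M, N = M + 1 := ⟨N - 1, by omega⟩
  set a : ℕ → ℝ := fun i => ∑ r ∈ Finset.range i, δ * g r with ha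
  -- The sum of all coefficients of `s`: it measures the failure of the coefficients `a` to close up
  -- cyclically.
  set G : ℝ := g M + δ⁻¹ * a M with hG
  set h : ℝ → ℝ := fun x => ∑ j ∈ Finset.range (M + 1), a j * wrap τ (n + 1) j x with hh
  have hhd : ∀ x ∈ Ico (0:ℝ) (2 * Real.pi),
      HasDerivWithinAt h (s x - G * wrap τ n (M + 1) x) (Ici x) x := by
    intro x hx
    have h1 : HasDerivWithinAt h (∑ j ∈ Finset.range (M + 1), a j *
        (δ⁻¹ * (wrap τ n j x - wrap τ n (j + 1) x))) (Ici x) x :=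
      HasDerivWithinAt.fun_sum fun j _ => (hd j x).const_mul (a j)
    refine h1.congr_deriv ?_
    have h3 : ∑ j ∈ Finset.range (M + 1), a j * (δ⁻¹ * (wrap τ n j x - wrap τ n (j + 1) x)) =
        δ⁻¹ * ∑ j ∈ Finset.range (M + 1), a j * (wrap τ n j x - wrap τ n (j + 1) x) := by
      rw [Finset.mul_sum]
      exact Finset.sum_congr rfl fun i _ => by ring
    have h4 : a 0 = 0 := by simp [ha]
    have h5 : ∀ j, a (j + 1) - a j = δ * g j := by
      intro j
      simp only [ha, Finset.sum_range_succ]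
      ring
    have h6 : s x = ∑ j ∈ Finset.range (M + 1), g j * wrap τ n (j + 1) x := by
      rw [hg x hx]
      refine Finset.sum_congr rfl fun j hj => ?_
      rw [basisθ_eq (by omega) (Finset.mem_range.1 hj) hx, e]
    rw [h3, sum_range_mul_sub, h4, h6, Finset.sum_range_succ]
    simp only [h5]
    have h7 : ∑ j ∈ Finset.range M, δ * g j * wrap τ n (j + 1) x =
        δ * ∑ j ∈ Finset.range M, g j * wrap τ n (j + 1) x := by
      rw [Finset.mul_sum]
      exact Finset.sum_congr rfl fun i _ => by ring
    rw [h7, hG]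
    field_simp
    ring
  have hhc : Continuous h := continuous_finsetSum _ fun j _ => continuous_const.mul (hc j)
  have hhper : h 0 = h (2 * Real.pi) :=
    Finset.sum_congr rfl fun j hj => by rw [hends j (Finset.mem_range.1 hj)]
  have hG0 : G = 0 := by
    by_contra hne
    have hwm : Measurable (wrap τ n (M + 1)) := by
      have := measurable_bspline τ n (M + 1)
      unfold wrap
      fun_prop
    have hw0 : ∀ x, 0 ≤ wrap τ n (M + 1) x := fun x =>
      add_nonneg (bspline_nonneg hτ.monotone _ _ _) (bspline_nonneg hτ.monotone _ _ _)
    -- Boundedness supplies integrability also in degree zero, where continuity is not available. On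
    -- the support of each B-spline in the recursion its weight lies in `[0,1]`.
    have hbd : ∀ (τ : ℕ → ℝ), Monotone τ → ∀ n j, ∃ C, ∀ x, |bspline τ n j x| ≤ C := by
      intro τ hτ n
      induction n with
      | zero =>
        intro j
        refine ⟨1, fun x => ?_⟩
        simp only [bspline, indicator]
        split_ifs <;> simp
      | succ n ih =>
        intro j
        obtain ⟨C1, h1⟩ := ih j
        obtain ⟨C2, h2⟩ := ih (j + 1)
        have hC1 : 0 ≤ C1 := (abs_nonneg _).trans (h1 0)
        have hC2 : 0 ≤ C2 := (abs_nonneg _).trans (h2 0)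
        refine ⟨C1 + C2, fun x => ?_⟩
        have aux : ∀ u v C B w : ℝ, |B| ≤ C → (B ≠ 0 → 0 ≤ w ∧ w ≤ v - u) → |w / (v - u) * B| ≤ C := by
          intro u v C B w hB hw
          rcases eq_or_ne B 0 with rfl | hB0
          · simpa using hB
          · rw [abs_mul]
            obtain ⟨w1, w2⟩ := hw hB0
            have : |w / (v - u)| ≤ 1 := by
              rw [abs_of_nonneg (div_nonneg w1 (w1.trans w2))]
              exact div_le_one_of_le₀ w2 (w1.trans w2)
            calc _ ≤ 1 * |B| := by gcongr
              _ ≤ C := by rwa [one_mul]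
        simp only [bspline]
        refine (abs_add_le _ _).trans (add_le_add (aux _ _ _ _ _ (h1 x) ?_) (aux _ _ _ _ _ (h2 x) ?_))
        · intro hB
          have := not_imp_comm.1 (bspline_eq_zero hτ n j) hB
          constructor <;> linarith [this.1, this.2]
        · intro hB
          have := not_imp_comm.1 (bspline_eq_zero hτ n (j + 1)) hB
          rw [show j + 1 + n + 1 = j + n + 2 by ring] at this
          constructor <;> linarith [this.1, this.2]
    have hwi : IntervalIntegrable (wrap τ n (M + 1)) volume 0 (2 * Real.pi) := by
      obtain ⟨C, hC⟩ := hbd τ hτ.monotone n (M + 1)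
      rw [intervalIntegrable_iff]
      refine Measure.integrableOn_of_bounded (M := C + C) ?_ hwm.aestronglyMeasurable ?_
      · rw [uIoc_of_le (by positivity)]
        exact measure_Ioc_lt_top.ne
      · exact Eventually.of_forall fun x => by
          simp only [wrap]
          exact (abs_add_le _ _).trans (add_le_add (hC _) (hC _))
    have hD : ∫ x in (0:ℝ)..(2 * Real.pi), -(G * wrap τ n (M + 1) x) =
        (h (2 * Real.pi) - S (2 * Real.pi)) - (h 0 - S 0) := by
      refine intervalIntegral.integral_eq_sub_of_hasDeriv_right (f := fun x => h x - S x) ?_ ?_ ?_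
      · rw [uIcc_of_le (by positivity)]
        exact hhc.continuousOn.sub hSc
      · intro x hx
        rw [min_eq_left (by positivity), max_eq_right (by positivity)] at hx
        have hx' : x ∈ Ico 0 (2 * Real.pi) := ⟨hx.1.le, hx.2⟩
        have h5 := ((hhd x hx').sub (hSd x hx')).mono Ioi_subset_Ici_self
        rw [show s x - G * wrap τ n (M + 1) x - s x = -(G * wrap τ n (M + 1) x) by ring] at h5
        exact h5
      · exact (hwi.const_mul G).neg
    rw [hhper, hper, intervalIntegral.integral_neg, intervalIntegral.integral_const_mul] at hD
    have h0 : ∫ x in (0:ℝ)..(2 * Real.pi), wrap τ n (M + 1) x = 0 := by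
      have : G * ∫ x in (0:ℝ)..(2 * Real.pi), wrap τ n (M + 1) x = 0 := by linarith
      exact (mul_eq_zero.1 this).resolve_left hne
    have hpos : 0 < ∫ x in (0:ℝ)..(2 * Real.pi), wrap τ n (M + 1) x := by
      rw [intervalIntegral.integral_pos_iff_support_of_nonneg_ae (Eventually.of_forall hw0) hwi]
      refine ⟨by positivity, ?_⟩
      -- This B-spline starts at `τ (M + 1)` and its last knot is `2π`, so its unshifted copy is
      -- positive on the whole interval.
      have hsub : Ioo (τ (M + 1)) (2 * Real.pi) ⊆
          Function.support (wrap τ n (M + 1)) ∩ Ioc 0 (2 * Real.pi) := by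
        intro x hx
        have h3 : 0 ≤ τ (M + 1) := by
          have : τ (n + 1) = 0 := by simp [hτd, knotθ]
          rw [← this]
          exact hτ.monotone (by omega)
        refine ⟨?_, lt_of_le_of_lt h3 hx.1, hx.2.le⟩
        have := bspline_pos hτ n (M + 1) (x := x) ⟨hx.1, by
          rw [show M + 1 + n + 1 = n + 1 + (M + 1) by ring, htop]; exact hx.2⟩
        have h4 := bspline_nonneg hτ.monotone n (M + 1) (x - 2 * Real.pi)
        simp only [Function.mem_support, wrap]
        linarith
      refine lt_of_lt_of_le ?_ (measure_mono hsub)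
      rw [Real.volume_Ioo, ENNReal.ofReal_pos, ← htop]
      linarith [hτ (show M + 1 < n + 1 + (M + 1) by omega)]
    linarith
  -- constants are splines
  have hone : ∃ κ : ℝ, κ ≠ 0 ∧ ∀ x ∈ Icc (0:ℝ) (2 * Real.pi),
      ∑ j ∈ Finset.range (M + 1), wrap τ (n + 1) j x = κ := by
    have hder : ∀ x ∈ Ico (0:ℝ) (2 * Real.pi),
        HasDerivWithinAt (fun x => ∑ j ∈ Finset.range (M + 1), wrap τ (n + 1) j x) 0 (Ici x) x := by
      intro x hx
      have h1 := HasDerivWithinAt.fun_sum (u := Finset.range (M + 1)) fun j _ => hd j x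
      refine h1.congr_deriv ?_
      -- The sum telescopes to the difference of the two ends of the cyclic range, which coincide.
      rw [← Finset.mul_sum, Finset.sum_range_sub', hcyc x hx]
      simp
    have hcst := constant_of_has_deriv_right_zero
      (continuous_finsetSum _ fun j _ => hc j).continuousOn hder
    refine ⟨_, ?_, hcst⟩
    obtain ⟨x, hx1, hx2⟩ : (Ioo (τ M) (τ (M + 1))).Nonempty := nonempty_Ioo.2 (hτ (by omega))
    have hx0 : x ∈ Icc (0:ℝ) (2 * Real.pi) := by
      constructor
      · have : τ (n + 1) = 0 := by simp [hτd, knotθ]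
        have := hτ.monotone (show n + 1 ≤ M by omega)
        linarith
      · have := hτ.monotone (show M + 1 ≤ n + 1 + (M + 1) by omega)
        linarith
    rw [← hcst x hx0]
    have hnn : ∀ j ∈ Finset.range (M + 1), 0 ≤ wrap τ (n + 1) j x := fun j _ =>
      add_nonneg (bspline_nonneg hτ.monotone _ _ _) (bspline_nonneg hτ.monotone _ _ _)
    refine (Finset.sum_pos' hnn ⟨M, by simp, ?_⟩).ne'
    have := bspline_pos hτ (n + 1) M (x := x) ⟨hx1, hx2.trans (hτ (by omega))⟩
    have h4 := bspline_nonneg hτ.monotone (n + 1) M (x - 2 * Real.pi)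
    simp only [wrap]
    linarith
  obtain ⟨κ, hκ, hone⟩ := hone
  have heq : ∀ x ∈ Icc (0:ℝ) (2 * Real.pi), h x + (S 0 - h 0) = S x := by
    refine eq_of_has_deriv_right_eq (f' := s) (fun x hx => ?_) hSd (by fun_prop) hSc (by ring)
    have := (hhd x hx).add_const (S 0 - h 0)
    rwa [hG0, zero_mul, sub_zero] at this
  refine ⟨fun j => a j + (S 0 - h 0) / κ, fun x hx => ?_⟩
  have hx' : x ∈ Icc (0:ℝ) (2 * Real.pi) := ⟨hx.1, hx.2.le⟩
  rw [← heq x hx']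
  have : ∀ j ∈ Finset.range (M + 1), (a j + (S 0 - h 0) / κ) * basisθ (n + 1) (M + 1) j x =
      a j * wrap τ (n + 1) j x + (S 0 - h 0) / κ * wrap τ (n + 1) j x := by
    intro j hj
    rw [basisθ_eq (by omega) (Finset.mem_range.1 hj) hx]
    ring
  rw [Finset.sum_congr rfl this, Finset.sum_add_distrib, ← Finset.mul_sum, hone x hx']
  field_simp
  rfl

end

section

/-! ### Chains of derivatives in one variable -/

/-- `g 0, …, g k` are bounded measurable functions on `[0,L]`, each of which, except for the last, is
continuous and has the next one as its derivative from the right. -/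
structure IsChain {E : Type*} [NormedAddCommGroup E] [NormedSpace ℝ E] (L : ℝ) (k : ℕ)
    (g : ℕ → ℝ → E) : Prop where
  meas : ∀ j ≤ k, StronglyMeasurable (g j)
  bdd : ∀ j ≤ k, ∃ C, ∀ x ∈ Icc 0 L, ‖g j x‖ ≤ C
  cont : ∀ j < k, ContinuousOn (g j) (Icc 0 L)
  deriv : ∀ j < k, ∀ x ∈ Ico 0 L, HasDerivWithinAt (g j) (g (j + 1) x) (Ici x) x

theorem IsChain.mono {E : Type*} [NormedAddCommGroup E] [NormedSpace ℝ E] {L : ℝ} {k m : ℕ}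
    {g : ℕ → ℝ → E} (h : IsChain L k g) (hm : m ≤ k) : IsChain L m g :=
  ⟨fun j hj => h.meas j (hj.trans hm), fun j hj => h.bdd j (hj.trans hm),
    fun j hj => h.cont j (hj.trans_le hm), fun j hj => h.deriv j (hj.trans_le hm)⟩

/-- A smooth function together with all its derivatives. -/
def IsDerivSeq (g : ℕ → ℝ → ℝ) : Prop := ∀ j x, HasDerivAt (g j) (g (j + 1) x) x

theorem IsDerivSeq.continuous {g : ℕ → ℝ → ℝ} (h : IsDerivSeq g) (j : ℕ) : Continuous (g j) :=
  continuous_iff_continuousAt.2 fun x => (h j x).continuousAt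

theorem IsDerivSeq.shift {g : ℕ → ℝ → ℝ} (h : IsDerivSeq g) : IsDerivSeq fun j => g (j + 1) :=
  fun j x => h (j + 1) x

theorem IsDerivSeq.isChain {g : ℕ → ℝ → ℝ} (h : IsDerivSeq g) (L : ℝ) (k : ℕ) : IsChain L k g where
  meas j _ := (h.continuous j).stronglyMeasurable
  bdd j _ := isCompact_Icc.exists_bound_of_continuousOn (h.continuous j).continuousOn
  cont j _ := (h.continuous j).continuousOn
  deriv j _ x _ := (h j x).hasDerivWithinAt

/-- The sequence `f, g 0, g 1, …`. -/
def seqCons {α : Type*} (f : α) (g : ℕ → α) : ℕ → α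
  | 0 => f
  | j + 1 => g j

theorem IsChain.cons {L : ℝ} {k : ℕ} {g : ℕ → ℝ → ℝ} (h : IsChain L k g) {f : ℝ → ℝ}
    (hf : Continuous f) (hd : ∀ x ∈ Ico 0 L, HasDerivWithinAt f (g 0 x) (Ici x) x) :
    IsChain L (k + 1) (seqCons f g) where
  meas j hj := by
    cases j with
    | zero => exact hf.stronglyMeasurable
    | succ j => exact h.meas j (by omega)
  bdd j hj := by
    cases j with
    | zero => exact isCompact_Icc.exists_bound_of_continuousOn hf.continuousOn
    | succ j => exact h.bdd j (by omega)
  cont j hj := by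
    cases j with
    | zero => exact hf.continuousOn
    | succ j => exact h.cont j (by omega)
  deriv j hj := by
    cases j with
    | zero => exact hd
    | succ j => exact h.deriv j (by omega)

/-- A primitive on `[0,L]`. -/
def prim (L c : ℝ) (f : ℝ → ℝ) (x : ℝ) : ℝ := c + ∫ s in (0:ℝ)..x, (Icc 0 L).indicator f s

theorem integrable_indicator_of_bdd {L C : ℝ} {f : ℝ → ℝ} (hm : StronglyMeasurable f)
    (hb : ∀ x ∈ Icc 0 L, ‖f x‖ ≤ C) : Integrable ((Icc 0 L).indicator f) := by
  rw [integrable_indicator_iff measurableSet_Icc]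
  refine Measure.integrableOn_of_bounded (M := C) measure_Icc_lt_top.ne hm.aestronglyMeasurable ?_
  rw [ae_restrict_iff' measurableSet_Icc]
  exact Eventually.of_forall hb

/-- The cutoff in `prim` makes the integrand integrable on the whole line, so continuity holds
without restriction to `[0, L]`. -/
theorem continuous_prim {L C c : ℝ} {f : ℝ → ℝ} (hm : StronglyMeasurable f)
    (hb : ∀ x ∈ Icc 0 L, ‖f x‖ ≤ C) : Continuous (prim L c f) :=
  continuous_const.add (intervalIntegral.continuous_primitive
    (fun _ _ => (integrable_indicator_of_bdd hm hb).intervalIntegrable) 0)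

theorem hasDerivWithinAt_prim {L C c : ℝ} {f : ℝ → ℝ} (hm : StronglyMeasurable f)
    (hb : ∀ x ∈ Icc 0 L, ‖f x‖ ≤ C) {x : ℝ} (hx : x ∈ Ico 0 L)
    (hc : ContinuousWithinAt f (Ici x) x) : HasDerivWithinAt (prim L c f) (f x) (Ici x) x := by
  have e : (Icc 0 L).indicator f =ᶠ[𝓝[≥] x] f := by
    filter_upwards [Ico_mem_nhdsGE hx.2] with y hy
    exact indicator_of_mem (show y ∈ Icc 0 L from ⟨hx.1.trans hy.1, hy.2.le⟩) f
  have hx' : (Icc 0 L).indicator f x = f x :=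
    indicator_of_mem (show x ∈ Icc 0 L from ⟨hx.1, hx.2.le⟩) f
  have h1 : HasDerivWithinAt (fun u => ∫ s in (0:ℝ)..u, (Icc 0 L).indicator f s)
      ((Icc 0 L).indicator f x) (Ici x) x :=
    intervalIntegral.integral_hasDerivWithinAt_right
      (integrable_indicator_of_bdd hm hb).intervalIntegrable
      (t := Ioi x)
      ((hm.indicator measurableSet_Icc).stronglyMeasurableAtFilter)
      ((hc.congr_of_eventuallyEq e hx').mono Ioi_subset_Ici_self)
  rw [hx'] at h1
  exact h1.const_add c

theorem prim_zero (L c : ℝ) (f : ℝ → ℝ) : prim L c f 0 = c := by simp [prim]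

theorem prim_end {L : ℝ} (hL : 0 ≤ L) (c : ℝ) (f : ℝ → ℝ) :
    prim L c f L = c + ∫ s in (0:ℝ)..L, f s := by
  unfold prim
  congr 1
  refine intervalIntegral.integral_congr fun x hx => ?_
  rw [uIcc_of_le hL] at hx
  exact indicator_of_mem hx f

/-! ### Step functions -/

/-- The step function on `[0,L)` with `N` equal cells and values `a 0, …, a (N-1)`. -/
def stepFn (L : ℝ) (N : ℕ) (a : ℕ → ℝ) (x : ℝ) : ℝ :=
  ∑ i ∈ Finset.range N, a i * (Ico (L * i / N) (L * (i + 1) / N)).indicator 1 x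

theorem measurable_stepFn (L : ℝ) (N : ℕ) (a : ℕ → ℝ) : Measurable (stepFn L N a) :=
  Finset.measurable_fun_sum _ fun _ _ =>
    (measurable_one.indicator measurableSet_Ico).const_mul _

theorem stepFn_eq {L : ℝ} (hL : 0 < L) {N i : ℕ} (a : ℕ → ℝ) (hi : i < N) {x : ℝ}
    (hx : x ∈ Ico (L * i / N) (L * (i + 1) / N)) : stepFn L N a x = a i := by
  have hN : (0:ℝ) < N := by exact_mod_cast (by omega : 0 < N)
  unfold stepFn
  rw [Finset.sum_eq_single i, indicator_of_mem hx]
  · simp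
  · intro j _ hji
    rw [indicator_of_notMem, mul_zero]
    intro h
    have h1 : L * j / N < L * (i + 1) / N := h.1.trans_lt hx.2
    have h2 : L * i / N < L * (j + 1) / N := hx.1.trans_lt h.2
    rw [div_lt_div_iff_of_pos_right hN, mul_lt_mul_iff_right₀ hL] at h1 h2
    have h3 : j < i + 1 := by exact_mod_cast h1
    have h4 : i < j + 1 := by exact_mod_cast h2
    omega
  · intro h
    exact absurd (Finset.mem_range.2 hi) h

theorem exists_cell {L : ℝ} (hL : 0 < L) {N : ℕ} (hN : 0 < N) {x : ℝ} (hx : x ∈ Ico 0 L) :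
    ∃ i < N, x ∈ Ico (L * i / N) (L * (i + 1) / N) := by
  have hN' : (0:ℝ) < N := by exact_mod_cast hN
  have h0 : 0 ≤ x * N / L := by have := hx.1; positivity
  refine ⟨⌊x * N / L⌋₊, ?_, ?_, ?_⟩
  · rw [Nat.floor_lt h0, div_lt_iff₀ hL]
    nlinarith [hx.2]
  · rw [div_le_iff₀ hN']
    have := Nat.floor_le h0
    rw [le_div_iff₀ hL] at this
    linarith
  · rw [lt_div_iff₀ hN']
    have := Nat.lt_floor_add_one (x * N / L)
    rw [div_lt_iff₀ hL] at this
    linarith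

theorem continuousWithinAt_stepFn {L : ℝ} (hL : 0 < L) {N : ℕ} (hN : 0 < N) (a : ℕ → ℝ) {x : ℝ}
    (hx : x ∈ Ico 0 L) : ContinuousWithinAt (stepFn L N a) (Ici x) x := by
  obtain ⟨i, hi, hxi⟩ := exists_cell hL hN hx
  have e : stepFn L N a =ᶠ[𝓝[≥] x] fun _ => a i := by
    filter_upwards [Ico_mem_nhdsGE hxi.2] with y hy
    exact stepFn_eq hL a hi ⟨hxi.1.trans hy.1, hy.2⟩
  exact continuousWithinAt_const.congr_of_eventuallyEq e (stepFn_eq hL a hi hxi)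

theorem bdd_stepFn (L : ℝ) (N : ℕ) (a : ℕ → ℝ) : ∃ C, ∀ x, ‖stepFn L N a x‖ ≤ C := by
  refine ⟨∑ i ∈ Finset.range N, ‖a i‖, fun x => (norm_sum_le _ _).trans ?_⟩
  refine Finset.sum_le_sum fun i _ => ?_
  rw [norm_mul]
  refine mul_le_of_le_one_right (norm_nonneg _) ?_
  by_cases h : x ∈ Ico (L * i / N) (L * (i + 1) / N) <;> simp [h]

theorem integral_stepFn {L : ℝ} (hL : 0 < L) {N : ℕ} (hN : 0 < N) (a : ℕ → ℝ) :
    ∫ x in (0:ℝ)..L, stepFn L N a x = ∑ i ∈ Finset.range N, a i * (L / N) := by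
  have hN' : (0:ℝ) < N := by exact_mod_cast hN
  have hi : ∀ i, Integrable ((Ico (L * i / N) (L * (i + 1) / N)).indicator (1 : ℝ → ℝ)) := by
    intro i
    rw [integrable_indicator_iff measurableSet_Ico]
    exact integrableOn_const (by simp)
  unfold stepFn
  rw [intervalIntegral.integral_finsetSum]
  · refine Finset.sum_congr rfl fun i hiN => ?_
    rw [intervalIntegral.integral_const_mul]
    congr 1
    have hiN' : (i : ℝ) + 1 ≤ N := by exact_mod_cast Finset.mem_range.1 hiN
    have h0 : 0 ≤ L * i / N := by positivity
    have h1 : L * (i + 1) / N ≤ L := by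
      rw [div_le_iff₀ hN']
      nlinarith
    have h2 : L * i / N ≤ L * (i + 1) / N := by
      gcongr
      linarith
    rw [intervalIntegral.integral_of_le hL.le, integral_Ioc_eq_integral_Ioo, ← integral_Ico_eq_integral_Ioo,
      setIntegral_indicator measurableSet_Ico,
      inter_eq_self_of_subset_right (Ico_subset_Ico h0 h1)]
    simp only [Pi.one_apply, integral_const, smul_eq_mul, mul_one, Measure.real,
      Measure.restrict_apply MeasurableSet.univ, univ_inter, Real.volume_Ico]
    rw [ENNReal.toReal_ofReal (by linarith)]
    ring
  · intro i _
    exact ((hi i).const_mul _).intervalIntegrable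

/-- Cell averages approximate a continuous function uniformly and preserve its integral. -/
theorem exists_stepFn {L : ℝ} (hL : 0 < L) {f : ℝ → ℝ} (hf : Continuous f) {ε : ℝ} (hε : 0 < ε) :
    ∃ N₀, ∀ N ≥ N₀, 0 < N ∧ ∃ a : ℕ → ℝ, (∀ x ∈ Ico 0 L, |stepFn L N a x - f x| ≤ ε) ∧
      ∫ x in (0:ℝ)..L, stepFn L N a x = ∫ x in (0:ℝ)..L, f x := by
  obtain ⟨δ, hδ, hδf⟩ := Metric.uniformContinuousOn_iff.1
    ((isCompact_Icc (a := (0:ℝ)) (b := L)).uniformContinuousOn_of_continuous hf.continuousOn) ε hε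
  obtain ⟨N₀, hN₀⟩ := exists_nat_gt (L / δ)
  refine ⟨N₀ + 1, fun N hN => ?_⟩
  have hN0 : 0 < N := by omega
  have hN' : (0:ℝ) < N := by exact_mod_cast hN0
  have hlen : L / N < δ := by
    rw [div_lt_iff₀ hN']
    rw [div_lt_iff₀ hδ] at hN₀
    have : (N₀ : ℝ) ≤ N := by exact_mod_cast (by omega : N₀ ≤ N)
    nlinarith
  refine ⟨hN0, fun i => N / L * ∫ x in (L * i / N)..(L * (i + 1) / N), f x, ?_, ?_⟩
  · intro x hx
    obtain ⟨i, hi, hxi⟩ := exists_cell hL hN0 hx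
    rw [stepFn_eq hL _ hi hxi]
    have hiN' : (i : ℝ) + 1 ≤ N := by exact_mod_cast hi
    have h0 : 0 ≤ L * i / N := by positivity
    have h1 : L * (i + 1) / N ≤ L := by
      rw [div_le_iff₀ hN']
      nlinarith
    have h2 : L * i / N ≤ L * (i + 1) / N := by
      gcongr
      linarith
    have hw : L * (i + 1) / N - L * i / N = L / N := by ring
    have e : N / L * (∫ y in (L * i / N)..(L * (i + 1) / N), f y) - f x =
        N / L * ∫ y in (L * i / N)..(L * (i + 1) / N), (f y - f x) := by
      rw [intervalIntegral.integral_sub (hf.intervalIntegrable _ _) (by simp),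
        intervalIntegral.integral_const, hw, smul_eq_mul]
      field_simp
    rw [e, abs_mul, abs_of_pos (by positivity)]
    have hb : ‖∫ y in (L * i / N)..(L * (i + 1) / N), (f y - f x)‖ ≤
        ε * |L * (i + 1) / N - L * i / N| := by
      refine intervalIntegral.norm_integral_le_of_norm_le_const fun y hy => ?_
      rw [uIoc_of_le h2] at hy
      have := hδf y ⟨h0.trans hy.1.le, hy.2.trans h1⟩ x ⟨hx.1, hx.2.le⟩ (by
        rw [Real.dist_eq, abs_lt]
        constructor <;> linarith [hy.1, hy.2, hxi.1, hxi.2])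
      rw [Real.dist_eq] at this
      exact this.le
    rw [hw, abs_of_pos (by positivity), Real.norm_eq_abs] at hb
    calc _ ≤ N / L * (ε * (L / N)) := by gcongr
      _ = ε := by field_simp
  · rw [integral_stepFn hL hN0]
    have h3 : ∀ i ∈ Finset.range N, (N / L * ∫ x in (L * i / N)..(L * (i + 1) / N), f x) * (L / N) =
        ∫ x in (L * (i : ℕ) / N)..(L * ((i + 1 : ℕ) : ℝ) / N), f x := by
      intro i _
      push_cast
      field_simp
    rw [Finset.sum_congr rfl h3,
      intervalIntegral.sum_integral_adjacent_intervals (a := fun i : ℕ => L * (i : ℝ) / N)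
        fun i _ => hf.intervalIntegrable _ _]
    congr 1
    · simp
    · field_simp

theorem isSplineT_stepFn {N : ℕ} (hN : 0 < N) (a : ℕ → ℝ) : IsSplineT 0 N (stepFn 1 N a) := by
  refine ⟨a, fun x _ => ?_⟩
  unfold stepFn
  rw [zero_add]
  refine Finset.sum_congr rfl fun i hi => ?_
  have hi := Finset.mem_range.1 hi
  simp only [basisT, bspline]
  rw [knotT_of_le hN (by omega) (by omega), knotT_of_le hN (by omega) (by omega)]
  simp

theorem isSplineθ_stepFn {N : ℕ} (hN : 0 < N) (a : ℕ → ℝ) :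
    IsSplineθ 0 N (stepFn (2 * Real.pi) N a) := by
  refine ⟨a, fun x hx => ?_⟩
  unfold stepFn
  refine Finset.sum_congr rfl fun j hj => ?_
  rw [basisθ_eq (by omega) (Finset.mem_range.1 hj) hx]
  simp only [wrap, bspline]
  have : x - 2 * Real.pi ∉ Ico (knotθ 0 N j) (knotθ 0 N (j + 1)) := by
    intro h
    have h1 : 0 ≤ knotθ 0 N j := by
      have := Real.pi_pos
      simp only [knotθ]
      simp
      positivity
    linarith [h.1, hx.2]
  rw [indicator_of_notMem this]
  simp [knotθ]

/-! ### Approximation of smooth functions by splines -/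

/-- A smooth function on `[0,1]` and its derivatives up to order `n` are uniform limits of splines of
degree `n` and their derivatives. -/
theorem exists_splineT (n : ℕ) {g : ℕ → ℝ → ℝ} (hg : IsDerivSeq g) {ε : ℝ} (hε : 0 < ε) :
    ∃ N₀, ∀ N ≥ N₀, 0 < N ∧ ∃ s, IsChain 1 n s ∧
      (∀ x ∈ Ico (0:ℝ) 1, ContinuousWithinAt (s 0) (Ici x) x) ∧ IsSplineT n N (s 0) ∧
      ∀ j ≤ n, ∀ x ∈ Ico (0:ℝ) 1, |s j x - g j x| ≤ ε := by
  induction n generalizing g with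
  | zero =>
    obtain ⟨N₀, h⟩ := exists_stepFn one_pos (hg.continuous 0) hε
    refine ⟨N₀, fun N hN => ?_⟩
    obtain ⟨hN0, a, ha, -⟩ := h N hN
    refine ⟨hN0, fun _ => stepFn 1 N a, ⟨fun _ _ => (measurable_stepFn _ _ _).stronglyMeasurable,
      fun _ _ => ?_, fun j hj => absurd hj (by omega), fun j hj => absurd hj (by omega)⟩,
      fun x hx => continuousWithinAt_stepFn one_pos hN0 a hx, isSplineT_stepFn hN0 a, ?_⟩
    · obtain ⟨C, hC⟩ := bdd_stepFn 1 N a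
      exact ⟨C, fun x _ => hC x⟩
    · intro j hj x hx
      rw [show j = 0 by omega]
      exact ha x hx
  | succ n ih =>
    obtain ⟨N₀, h⟩ := ih hg.shift
    refine ⟨N₀, fun N hN => ?_⟩
    obtain ⟨hN0, s, hs, hsc, hsp, hse⟩ := h N hN
    obtain ⟨C, hC⟩ := hs.bdd 0 (Nat.zero_le _)
    have hm := hs.meas 0 (Nat.zero_le _)
    -- The approximation of `g'` is integrated from the exact initial value, so the error at `x` is
    -- at most `ε x`.
    set S := prim 1 (g 0 0) (s 0) with hS
    have hScont : Continuous S := continuous_prim hm hC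
    have hSd : ∀ x ∈ Ico (0:ℝ) 1, HasDerivWithinAt S (s 0 x) (Ici x) x := fun x hx =>
      hasDerivWithinAt_prim hm hC hx (hsc x hx)
    refine ⟨hN0, seqCons S s, hs.cons hScont hSd, fun x _ => hScont.continuousWithinAt,
      hsp.primitive hN0 hScont.continuousOn hSd, ?_⟩
    intro j hj x hx
    cases j with
    | succ j => exact hse j (by omega) x hx
    | zero =>
      have hD := norm_image_sub_le_of_norm_deriv_right_le_segment (f := fun x => S x - g 0 x)
        (f' := fun x => s 0 x - g 1 x) (a := 0) (b := 1) (C := ε)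
        (hScont.sub (hg.continuous 0)).continuousOn
        (fun y hy => (hSd y hy).sub (hg 0 y).hasDerivWithinAt)
        (fun y hy => hse 0 (Nat.zero_le _) y hy) x ⟨hx.1, hx.2.le⟩
      simp only [hS, prim_zero, sub_self, sub_zero, Real.norm_eq_abs] at hD
      calc |S x - g 0 x| ≤ ε * x := hD
        _ ≤ ε := mul_le_of_le_one_right hε.le hx.2.le

/-- A smooth periodic function and its derivatives up to order `n` are uniform limits of periodic
splines of degree `n` and their derivatives. -/
theorem exists_splineθ (n : ℕ) {g : ℕ → ℝ → ℝ} (hg : IsDerivSeq g)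
    (hper : ∀ j, g j 0 = g j (2 * Real.pi)) {ε : ℝ} (hε : 0 < ε) :
    ∃ N₀, ∀ N ≥ N₀, 0 < N ∧ ∃ s, IsChain (2 * Real.pi) n s ∧
      (∀ x ∈ Ico (0:ℝ) (2 * Real.pi), ContinuousWithinAt (s 0) (Ici x) x) ∧
      IsSplineθ n N (s 0) ∧
      ∫ x in (0:ℝ)..(2 * Real.pi), s 0 x = ∫ x in (0:ℝ)..(2 * Real.pi), g 0 x ∧
      (∀ j < n, s j 0 = s j (2 * Real.pi)) ∧
      ∀ j ≤ n, ∀ x ∈ Ico (0:ℝ) (2 * Real.pi), |s j x - g j x| ≤ ε := by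
  have hpi : 0 < 2 * Real.pi := by positivity
  induction n generalizing g ε with
  | zero =>
    obtain ⟨N₀, h⟩ := exists_stepFn hpi (hg.continuous 0) hε
    refine ⟨N₀, fun N hN => ?_⟩
    obtain ⟨hN0, a, ha, hint⟩ := h N hN
    refine ⟨hN0, fun _ => stepFn _ N a, ⟨fun _ _ => (measurable_stepFn _ _ _).stronglyMeasurable,
      fun _ _ => ?_, fun j hj => absurd hj (by omega), fun j hj => absurd hj (by omega)⟩,
      fun x hx => continuousWithinAt_stepFn hpi hN0 a hx, isSplineθ_stepFn hN0 a, hint,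
      fun j hj => absurd hj (by omega), ?_⟩
    · obtain ⟨C, hC⟩ := bdd_stepFn (2 * Real.pi) N a
      exact ⟨C, fun x _ => hC x⟩
    · intro j hj x hx
      rw [show j = 0 by omega]
      exact ha x hx
  | succ n ih =>
    set L := 2 * Real.pi with hL
    -- Integration costs `η L` for the oscillation of the error and another `η L` for its initial
    -- value.
    set η := ε / (2 * L + 1) with hη
    have hη0 : 0 < η := by positivity
    have hηε : η ≤ ε := div_le_self hε.le (by linarith)
    have hηL : η * (2 * L) ≤ ε := by
      rw [hη, div_mul_eq_mul_div, div_le_iff₀ (by positivity)]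
      nlinarith
    obtain ⟨N₀, h⟩ := ih hg.shift (fun j => hper (j + 1)) hη0
    -- The summand `n + 2` secures the lower bound on `N` in `IsSplineθ.primitive`.
    refine ⟨N₀ + n + 2, fun N hN => ?_⟩
    obtain ⟨hN0, s, hs, hsc, hsp, hint, hsper, hse⟩ := h N (by omega)
    obtain ⟨C, hC⟩ := hs.bdd 0 (Nat.zero_le _)
    have hm := hs.meas 0 (Nat.zero_le _)
    have hPc : Continuous (prim L 0 (s 0)) := continuous_prim hm hC
    -- The constant of integration is spent on matching the integral of `g 0` rather than its
    -- initial value, since the next integration needs equal integrals to stay periodic.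
    set c := (∫ x in (0:ℝ)..L, (g 0 x - prim L 0 (s 0) x)) / L with hc
    set S := prim L c (s 0) with hS
    have hScont : Continuous S := continuous_prim hm hC
    have hSd : ∀ x ∈ Ico (0:ℝ) L, HasDerivWithinAt S (s 0 x) (Ici x) x := fun x hx =>
      hasDerivWithinAt_prim hm hC hx (hsc x hx)
    -- The integral of `s 0` equals that of `g'`, which vanishes by periodicity of `g`.
    have hSper : S 0 = S L := by
      have h1 : ∫ x in (0:ℝ)..L, g 1 x = g 0 L - g 0 0 :=
        intervalIntegral.integral_eq_sub_of_hasDerivAt (fun x _ => hg 0 x)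
          ((hg.continuous 1).intervalIntegrable _ _)
      rw [hS, prim_zero, prim_end hpi.le, hint]
      simp only [zero_add]
      rw [h1, hper 0]
      ring
    have hSint : ∫ x in (0:ℝ)..L, S x = ∫ x in (0:ℝ)..L, g 0 x := by
      have e : ∀ x, S x = c + prim L 0 (s 0) x := fun x => by simp [hS, prim]
      simp only [e]
      rw [intervalIntegral.integral_add (by simp) (hPc.intervalIntegrable _ _),
        intervalIntegral.integral_const, hc, intervalIntegral.integral_sub
        ((hg.continuous 0).intervalIntegrable _ _) (hPc.intervalIntegrable _ _), smul_eq_mul]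
      field_simp
      ring
    refine ⟨hN0, seqCons S s, hs.cons hScont hSd, fun x _ => hScont.continuousWithinAt,
      hsp.primitive (by omega) hScont.continuousOn hSd hSper, hSint, ?_, ?_⟩
    · intro j hj
      cases j with
      | zero => exact hSper
      | succ j => exact hsper j (by omega)
    intro j hj x hx
    cases j with
    | succ j => exact (hse j (by omega) x hx).trans hηε
    | zero =>
      have hDc : Continuous fun x => S x - g 0 x := hScont.sub (hg.continuous 0)
      have hD : ∀ y ∈ Icc 0 L, |S y - g 0 y - (S 0 - g 0 0)| ≤ η * L := by
        intro y hy
        have := norm_image_sub_le_of_norm_deriv_right_le_segment (f := fun x => S x - g 0 x)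
          (f' := fun x => s 0 x - g 1 x) (a := 0) (b := L) (C := η) hDc.continuousOn
          (fun y hy => (hSd y hy).sub (hg 0 y).hasDerivWithinAt)
          (fun y hy => hse 0 (Nat.zero_le _) y hy) y hy
        refine this.trans ?_
        have := hy.2
        gcongr
        linarith
      -- The error has mean zero, so its initial value is bounded by its oscillation.
      have h0 : |S 0 - g 0 0| ≤ η * L := by
        have h1 : ∫ y in (0:ℝ)..L, (S y - g 0 y - (S 0 - g 0 0)) = -(L * (S 0 - g 0 0)) := by
          rw [intervalIntegral.integral_sub (hDc.intervalIntegrable _ _) (by simp),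
            intervalIntegral.integral_sub (hScont.intervalIntegrable _ _)
            ((hg.continuous 0).intervalIntegrable _ _), hSint, intervalIntegral.integral_const,
            smul_eq_mul]
          ring
        have h2 : ‖∫ y in (0:ℝ)..L, (S y - g 0 y - (S 0 - g 0 0))‖ ≤ η * L * |L - 0| :=
          intervalIntegral.norm_integral_le_of_norm_le_const fun y hy => by
            rw [uIoc_of_le hpi.le] at hy
            exact hD y ⟨hy.1.le, hy.2⟩
        rw [h1, sub_zero, norm_neg, Real.norm_eq_abs, abs_mul, abs_of_pos hpi] at h2
        nlinarith
      have h1 := hD x ⟨hx.1, hx.2.le⟩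
      have h2 := abs_add_le (S x - g 0 x - (S 0 - g 0 0)) (S 0 - g 0 0)
      rw [sub_add_cancel] at h2
      exact (h2.trans (add_le_add h1 h0)).trans (by linarith)

end

section

/-! ### Interpolation inequalities in one variable -/

theorem intervalIntegrable_of_bdd {E : Type*} [NormedAddCommGroup E] {L : ℝ} (hL : 0 ≤ L)
    {f : ℝ → E} (hm : AEStronglyMeasurable f (volume.restrict (Ioc 0 L)))
    (hb : ∃ C, ∀ x ∈ Icc 0 L, ‖f x‖ ≤ C) : IntervalIntegrable f volume 0 L := by
  obtain ⟨C, hC⟩ := hb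
  rw [intervalIntegrable_iff_integrableOn_Ioc_of_le hL]
  refine ⟨hm, HasFiniteIntegral.of_bounded (C := C) ?_⟩
  rw [ae_restrict_iff' measurableSet_Ioc]
  exact Eventually.of_forall fun x hx => hC x ⟨hx.1.le, hx.2⟩

section
variable {E : Type*} [NormedAddCommGroup E] [InnerProductSpace ℝ E]

theorem bdd_inner {s : Set ℝ} {f g : ℝ → E} (hf : ∃ C, ∀ x ∈ s, ‖f x‖ ≤ C)
    (hg : ∃ C, ∀ x ∈ s, ‖g x‖ ≤ C) : ∃ C, ∀ x ∈ s, ‖inner ℝ (f x) (g x)‖ ≤ C := by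
  obtain ⟨C, hC⟩ := hf
  obtain ⟨D, hD⟩ := hg
  refine ⟨C * D, fun x hx => (norm_inner_le_norm _ _).trans ?_⟩
  exact mul_le_mul (hC x hx) (hD x hx) (norm_nonneg _) ((norm_nonneg _).trans (hC x hx))

theorem bdd_norm_sq {E : Type*} [NormedAddCommGroup E] {s : Set ℝ} {f : ℝ → E} (hf : ∃ C, ∀ x ∈ s, ‖f x‖ ≤ C) :
    ∃ C, ∀ x ∈ s, ‖(‖f x‖ ^ 2)‖ ≤ C := by
  obtain ⟨C, hC⟩ := hf
  refine ⟨C ^ 2, fun x hx => ?_⟩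
  rw [norm_pow, norm_norm]
  have := hC x hx
  gcongr

theorem inner_le_weighted {δ : ℝ} (hδ : 0 < δ) (x y : E) :
    2 * |inner ℝ x y| ≤ δ * ‖y‖ ^ 2 + δ⁻¹ * ‖x‖ ^ 2 := by
  have h1 := abs_real_inner_le_norm x y
  have h2 : 0 ≤ δ⁻¹ * (δ * ‖y‖ - ‖x‖) ^ 2 := by positivity
  have h3 : δ⁻¹ * (δ * ‖y‖ - ‖x‖) ^ 2 = δ * ‖y‖ ^ 2 + δ⁻¹ * ‖x‖ ^ 2 - 2 * (‖x‖ * ‖y‖) := by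
    field_simp
    ring
  linarith

/-- The square of the `L²` norm on `[0,L]`. -/
def sqInt {E : Type*} [NormedAddCommGroup E] (L : ℝ) (f : ℝ → E) : ℝ := ∫ x in (0:ℝ)..L, ‖f x‖ ^ 2

theorem sqInt_nonneg {E : Type*} [NormedAddCommGroup E] {L : ℝ} (hL : 0 ≤ L) (f : ℝ → E) : 0 ≤ sqInt L f :=
  intervalIntegral.integral_nonneg hL fun _ _ => by positivity

/-- Integrate `(|g|²)' = 2⟪g, g'⟫` from `y` to `x`, apply Young's inequality with weight `δ`, and
average over `y`. The free parameter `δ` allows the derivative term to be absorbed later. -/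
theorem IsChain.sup_le {L : ℝ} (hL : 0 < L) {g : ℕ → ℝ → E} (h : IsChain L 1 g) {δ : ℝ} (hδ : 0 < δ)
    {x : ℝ} (hx : x ∈ Icc 0 L) :
    ‖g 0 x‖ ^ 2 ≤ δ * sqInt L (g 1) + (L⁻¹ + δ⁻¹) * sqInt L (g 0) := by
  have m0 := h.meas 0 zero_le_one
  have m1 := h.meas 1 le_rfl
  have b0 := h.bdd 0 zero_le_one
  have b1 := h.bdd 1 le_rfl
  have i0 : IntervalIntegrable (fun x => ‖g 0 x‖ ^ 2) volume 0 L :=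
    intervalIntegrable_of_bdd hL.le (m0.norm.pow 2).aestronglyMeasurable (bdd_norm_sq b0)
  have i1 : IntervalIntegrable (fun x => ‖g 1 x‖ ^ 2) volume 0 L :=
    intervalIntegrable_of_bdd hL.le (m1.norm.pow 2).aestronglyMeasurable (bdd_norm_sq b1)
  have i01 : IntervalIntegrable (fun x => (inner ℝ (g 0 x) (g 1 x) : ℝ)) volume 0 L :=
    intervalIntegrable_of_bdd hL.le (m0.inner m1).aestronglyMeasurable (bdd_inner b0 b1)
  have iW : IntervalIntegrable (fun x => δ * ‖g 1 x‖ ^ 2 + δ⁻¹ * ‖g 0 x‖ ^ 2) volume 0 L :=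
    (i1.const_mul δ).add (i0.const_mul δ⁻¹)
  set W := ∫ x in (0:ℝ)..L, (δ * ‖g 1 x‖ ^ 2 + δ⁻¹ * ‖g 0 x‖ ^ 2) with hW
  have hWe : W = δ * sqInt L (g 1) + δ⁻¹ * sqInt L (g 0) := by
    rw [hW, intervalIntegral.integral_add (i1.const_mul δ) (i0.const_mul δ⁻¹),
      intervalIntegral.integral_const_mul, intervalIntegral.integral_const_mul]
    rfl
  have key : ∀ y ∈ Icc 0 L, ‖g 0 x‖ ^ 2 ≤ ‖g 0 y‖ ^ 2 + W := by
    intro y hy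
    have hsub : uIcc y x ⊆ Icc 0 L := by
      exact uIcc_subset_Icc hy hx
    have hsub' : uIcc y x ⊆ uIcc 0 L := by rwa [uIcc_of_le hL.le]
    have e : ∫ s in y..x, 2 * inner ℝ (g 0 s) (g 1 s) = ‖g 0 x‖ ^ 2 - ‖g 0 y‖ ^ 2 := by
      refine intervalIntegral.integral_eq_sub_of_hasDeriv_right (f := fun s => ‖g 0 s‖ ^ 2) ?_ ?_ ?_
      · exact ((h.cont 0 one_pos).mono hsub).norm.pow 2
      · intro s hs
        have h1 : 0 ≤ min y x := le_min hy.1 hx.1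
        have h2 : max y x ≤ L := max_le hy.2 hx.2
        exact ((h.deriv 0 one_pos s ⟨h1.trans hs.1.le, hs.2.trans_le h2⟩).norm_sq).mono
          Ioi_subset_Ici_self
      · exact (i01.mono_set hsub').const_mul 2
    have h1 : |∫ s in y..x, 2 * inner ℝ (g 0 s) (g 1 s)| ≤ W := by
      have hp : ∀ s, 0 ≤ δ * ‖g 1 s‖ ^ 2 + δ⁻¹ * ‖g 0 s‖ ^ 2 := fun s => by positivity
      have h2 := intervalIntegral.norm_integral_le_abs_of_norm_le
        (f := fun s => 2 * (inner ℝ (g 0 s) (g 1 s) : ℝ)) (a := y) (b := x) (μ := volume)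
        (g := fun s => δ * ‖g 1 s‖ ^ 2 + δ⁻¹ * ‖g 0 s‖ ^ 2)
        (Eventually.of_forall fun s => by
          rw [norm_mul, Real.norm_eq_abs, Real.norm_eq_abs, abs_of_pos (by norm_num : (0:ℝ) < 2)]
          exact inner_le_weighted hδ _ _) (iW.mono_set hsub')
      have h3 := intervalIntegral.abs_integral_mono_interval (μ := volume)
        (f := fun s => δ * ‖g 1 s‖ ^ 2 + δ⁻¹ * ‖g 0 s‖ ^ 2) (a := y) (b := x) (c := 0) (d := L)
        (by rw [uIoc_of_le hL.le]
            exact Ioc_subset_Ioc (le_min hy.1 hx.1) (max_le hy.2 hx.2))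
        (Eventually.of_forall hp) iW
      rw [abs_of_nonneg (a := ∫ s in (0:ℝ)..L, _)
        (intervalIntegral.integral_nonneg hL.le fun s _ => hp s)] at h3
      exact h2.trans h3
    rw [e] at h1
    have := (abs_le.1 h1).2
    linarith
  have havg : ∫ _ in (0:ℝ)..L, ‖g 0 x‖ ^ 2 ≤ ∫ y in (0:ℝ)..L, (‖g 0 y‖ ^ 2 + W) :=
    intervalIntegral.integral_mono_on hL.le (by simp) (i0.add (by simp)) key
  rw [intervalIntegral.integral_const, intervalIntegral.integral_add i0 (by simp),
    intervalIntegral.integral_const, smul_eq_mul, smul_eq_mul, sub_zero] at havg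
  have h2 : ‖g 0 x‖ ^ 2 ≤ L⁻¹ * sqInt L (g 0) + W := by
    have h3 : L * ‖g 0 x‖ ^ 2 ≤ sqInt L (g 0) + L * W := havg
    have h4 := mul_le_mul_of_nonneg_left h3 (inv_nonneg.2 hL.le)
    rw [← mul_assoc, inv_mul_cancel₀ hL.ne', one_mul, mul_add, ← mul_assoc,
      inv_mul_cancel₀ hL.ne', one_mul] at h4
    exact h4
  linarith

/-- Integration by parts gives `∫ |g'|² = [⟪g, g'⟫] - ∫ ⟪g, g''⟫`. There are no boundary conditions,
so the boundary term is estimated by `IsChain.sup_le` for `g` and for `g'`, and the resulting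
multiples of `∫ |g'|²` are absorbed on the left. -/
theorem IsChain.interpolate_two {L : ℝ} (hL : 0 < L) {ε : ℝ} (hε : 0 < ε) :
    ∃ C, 0 ≤ C ∧ ∀ g : ℕ → ℝ → E, IsChain L 2 g →
      sqInt L (g 1) ≤ ε * sqInt L (g 2) + C * sqInt L (g 0) := by
  set K := L⁻¹ + 1 with hK
  have hK0 : 0 < K := by positivity
  -- With `η` and `δ` as chosen, the two end points together contribute `½ ∫ |g'|² + η ∫ |g''|²`
  -- plus a multiple of `∫ |g|²`. The interior integral adds another `η ∫ |g''|²`. Absorbing the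
  -- half leaves the factor `4 η ≤ ε`.
  set η := min (ε / 4) (1 / (4 * K)) with hη
  have hη0 : 0 < η := by positivity
  have hη1 : 4 * η ≤ ε := by linarith [min_le_left (ε / 4) (1 / (4 * K))]
  have hη2 : η * K ≤ 1 / 4 := by
    have := min_le_right (ε / 4) (1 / (4 * K))
    calc η * K ≤ 1 / (4 * K) * K := by gcongr
      _ = 1 / 4 := by field_simp
  set δ := η / 4 with hδ
  have hδ0 : 0 < δ := by positivity
  set C := η⁻¹ * (L⁻¹ + δ⁻¹) + η⁻¹ with hC
  have hC0 : 0 ≤ C := by positivity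
  refine ⟨2 * C, by positivity, fun g h => ?_⟩
  have hs : IsChain L 1 fun j => g (j + 1) :=
    ⟨fun j hj => h.meas _ (by omega), fun j hj => h.bdd _ (by omega),
      fun j hj => h.cont _ (by omega), fun j hj => h.deriv _ (by omega)⟩
  have m := fun j hj => h.meas j hj
  have b := fun j hj => h.bdd j hj
  have i0 : IntervalIntegrable (fun x => ‖g 0 x‖ ^ 2) volume 0 L :=
    intervalIntegrable_of_bdd hL.le ((m 0 (by omega)).norm.pow 2).aestronglyMeasurable
      (bdd_norm_sq (b 0 (by omega)))
  have i1 : IntervalIntegrable (fun x => ‖g 1 x‖ ^ 2) volume 0 L :=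
    intervalIntegrable_of_bdd hL.le ((m 1 (by omega)).norm.pow 2).aestronglyMeasurable
      (bdd_norm_sq (b 1 (by omega)))
  have i2 : IntervalIntegrable (fun x => ‖g 2 x‖ ^ 2) volume 0 L :=
    intervalIntegrable_of_bdd hL.le ((m 2 (by omega)).norm.pow 2).aestronglyMeasurable
      (bdd_norm_sq (b 2 (by omega)))
  have i02 : IntervalIntegrable (fun x => (inner ℝ (g 0 x) (g 2 x) : ℝ)) volume 0 L :=
    intervalIntegrable_of_bdd hL.le ((m 0 (by omega)).inner (m 2 le_rfl)).aestronglyMeasurable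
      (bdd_inner (b 0 (by omega)) (b 2 le_rfl))
  have e : ∫ s in (0:ℝ)..L, (inner ℝ (g 0 s) (g 2 s) + ‖g 1 s‖ ^ 2) =
      inner ℝ (g 0 L) (g 1 L) - inner ℝ (g 0 0) (g 1 0) := by
    refine intervalIntegral.integral_eq_sub_of_hasDeriv_right
      (f := fun s => inner ℝ (g 0 s) (g 1 s)) ?_ ?_ (i02.add i1)
    · rw [uIcc_of_le hL.le]
      exact (h.cont 0 (by omega)).inner (h.cont 1 (by omega))
    · intro s hs
      rw [min_eq_left hL.le, max_eq_right hL.le] at hs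
      have hs' : s ∈ Ico 0 L := ⟨hs.1.le, hs.2⟩
      have := ((h.deriv 0 (by omega) s hs').inner ℝ (h.deriv 1 (by omega) s hs')).mono
        Ioi_subset_Ici_self
      rwa [real_inner_self_eq_norm_sq] at this
  rw [intervalIntegral.integral_add i02 i1] at e
  have n0 := sqInt_nonneg hL.le (g 0)
  have n1 := sqInt_nonneg hL.le (g 1)
  have n2 := sqInt_nonneg hL.le (g 2)
  have hend : ∀ x ∈ Icc 0 L, 2 * |inner ℝ (g 0 x) (g 1 x)| ≤
      η * (sqInt L (g 2) + K * sqInt L (g 1)) +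
        η⁻¹ * (δ * sqInt L (g 1) + (L⁻¹ + δ⁻¹) * sqInt L (g 0)) := by
    intro x hx
    refine (inner_le_weighted hη0 _ _).trans (add_le_add ?_ ?_)
    · have := hs.sup_le hL one_pos hx
      rw [one_mul, inv_one] at this
      gcongr
    · have := (h.mono one_le_two).sup_le hL hδ0 hx
      gcongr
  have hint : |∫ s in (0:ℝ)..L, inner ℝ (g 0 s) (g 2 s)| ≤
      η * sqInt L (g 2) + η⁻¹ * sqInt L (g 0) := by
    refine (intervalIntegral.abs_integral_le_integral_abs hL.le).trans ?_
    have : ∫ s in (0:ℝ)..L, |(inner ℝ (g 0 s) (g 2 s) : ℝ)| ≤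
        ∫ s in (0:ℝ)..L, (η * ‖g 2 s‖ ^ 2 + η⁻¹ * ‖g 0 s‖ ^ 2) := by
      refine intervalIntegral.integral_mono_on hL.le i02.abs
        ((i2.const_mul η).add (i0.const_mul η⁻¹)) fun x _ => ?_
      have := inner_le_weighted hη0 (g 0 x) (g 2 x)
      linarith [abs_nonneg (inner ℝ (g 0 x) (g 2 x) : ℝ)]
    rwa [intervalIntegral.integral_add (i2.const_mul η) (i0.const_mul η⁻¹),
      intervalIntegral.integral_const_mul, intervalIntegral.integral_const_mul] at this
  have hA := hend L (right_mem_Icc.2 hL.le)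
  have hB := hend 0 (left_mem_Icc.2 hL.le)
  have hηδ : η⁻¹ * δ = 1 / 4 := by rw [hδ]; field_simp
  have e1 : ∫ s in (0:ℝ)..L, ‖g 1 s‖ ^ 2 = sqInt L (g 1) := rfl
  rw [e1] at e
  have q1 := le_abs_self (inner ℝ (g 0 L) (g 1 L) : ℝ)
  have q2 := neg_abs_le (inner ℝ (g 0 0) (g 1 0) : ℝ)
  have q3 := neg_abs_le (∫ s in (0:ℝ)..L, inner ℝ (g 0 s) (g 2 s))
  have r1 : η * (sqInt L (g 2) + K * sqInt L (g 1)) ≤ η * sqInt L (g 2) + 1 / 4 * sqInt L (g 1) := by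
    have := mul_le_mul_of_nonneg_right hη2 n1
    linarith
  have r2 : η⁻¹ * (δ * sqInt L (g 1) + (L⁻¹ + δ⁻¹) * sqInt L (g 0)) + η⁻¹ * sqInt L (g 0) =
      1 / 4 * sqInt L (g 1) + C * sqInt L (g 0) := by
    rw [hC, ← hηδ]
    ring
  have r3 := mul_le_mul_of_nonneg_right hη1 n2
  linarith

/-- The `L²` norms of intermediate derivatives are bounded by those of the function and of its
derivative of highest order. -/
theorem IsChain.interpolate {L : ℝ} (hL : 0 < L) (k : ℕ) :
    ∃ C, 0 ≤ C ∧ ∀ g : ℕ → ℝ → E, IsChain L k g →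
      ∀ i ≤ k, sqInt L (g i) ≤ C * (sqInt L (g 0) + sqInt L (g k)) := by
  induction k with
  | zero =>
    refine ⟨1, zero_le_one, fun g _ i hi => ?_⟩
    rw [show i = 0 by omega]
    linarith [sqInt_nonneg hL.le (g 0)]
  | succ k ih =>
    rcases Nat.eq_zero_or_pos k with rfl | hk
    · refine ⟨1, zero_le_one, fun g _ i hi => ?_⟩
      have h0 := sqInt_nonneg hL.le (g 0)
      have h1 := sqInt_nonneg hL.le (g 1)
      rcases Nat.le_one_iff_eq_zero_or_eq_one.1 hi with rfl | rfl <;> simp only [zero_add] <;> linarith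
    obtain ⟨C, hC0, hC⟩ := ih
    -- The induction hypothesis for the shifted chain bounds `g''` by `g'` and the top derivative
    -- with constant `C`. This choice of `ε` leaves at most half of the norm of `g'`, which is
    -- absorbed.
    obtain ⟨D, hD0, hD⟩ := IsChain.interpolate_two (E := E) hL (show 0 < 1 / (2 * (C + 1)) by positivity)
    refine ⟨1 + C * (2 * D + 2), by positivity, fun g h i hi => ?_⟩
    have hs : IsChain L k fun j => g (j + 1) :=
      ⟨fun j hj => h.meas _ (by omega), fun j hj => h.bdd _ (by omega),
        fun j hj => h.cont _ (by omega), fun j hj => h.deriv _ (by omega)⟩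
    have n0 := sqInt_nonneg hL.le (g 0)
    have n1 := sqInt_nonneg hL.le (g 1)
    have nk := sqInt_nonneg hL.le (g (k + 1))
    have a1 := hD g (h.mono (by omega))
    have a2 : sqInt L (g 2) ≤ C * (sqInt L (g 1) + sqInt L (g (k + 1))) := by
      simpa using hC _ hs 1 hk
    have a3 : 1 / (2 * (C + 1)) * sqInt L (g 2) ≤ 1 / 2 * (sqInt L (g 1) + sqInt L (g (k + 1))) := by
      calc _ ≤ 1 / (2 * (C + 1)) * (C * (sqInt L (g 1) + sqInt L (g (k + 1)))) := by gcongr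
        _ ≤ 1 / (2 * (C + 1)) * ((C + 1) * (sqInt L (g 1) + sqInt L (g (k + 1)))) := by
          gcongr
          linarith
        _ = _ := by field_simp
    have a4 : sqInt L (g 1) ≤ sqInt L (g (k + 1)) + 2 * D * sqInt L (g 0) := by linarith
    rcases i with _ | i
    · have : 0 ≤ C * (2 * D + 2) * (sqInt L (g 0) + sqInt L (g (k + 1))) := by positivity
      linarith
    · have a5 : sqInt L (g (i + 1)) ≤ C * (sqInt L (g 1) + sqInt L (g (k + 1))) :=
        hC _ hs i (by omega)
      have a6 : C * (sqInt L (g 1) + sqInt L (g (k + 1))) ≤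
          C * ((2 * D + 2) * (sqInt L (g 0) + sqInt L (g (k + 1)))) := by
        refine mul_le_mul_of_nonneg_left ?_ hC0
        have : 0 ≤ 2 * D * sqInt L (g (k + 1)) := by positivity
        linarith
      linarith

end

end

section

/-! ### Integration over the cylinder -/

theorem cyl_eq_prod : cyl = (volume.restrict (Ioc (0:ℝ) 1)).prod
    (volume.restrict (Ioc (0:ℝ) (2 * Real.pi))) := by
  rw [Measure.prod_restrict, ← Measure.volume_eq_prod]
  unfold cyl
  refine Measure.restrict_congr_set ?_
  rw [Measure.volume_eq_prod]
  exact (Measure.set_prod_ae_eq Ioc_ae_eq_Icc Ioc_ae_eq_Icc).symm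

section
variable {V : Type*} [NormedAddCommGroup V] [NormedSpace ℝ V]

theorem integral_cyl_tθ {F : ℝ × ℝ → V} (hF : Integrable F cyl) :
    ∫ p, F p ∂cyl = ∫ t in (0:ℝ)..1, ∫ θ in (0:ℝ)..(2 * Real.pi), F (t, θ) := by
  rw [cyl_eq_prod] at *
  rw [integral_prod _ hF, intervalIntegral.integral_of_le zero_le_one]
  refine integral_congr_ae (Eventually.of_forall fun t => ?_)
  exact (intervalIntegral.integral_of_le (by positivity)).symm

theorem integral_cyl_θt {F : ℝ × ℝ → V} (hF : Integrable F cyl) :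
    ∫ p, F p ∂cyl = ∫ θ in (0:ℝ)..(2 * Real.pi), ∫ t in (0:ℝ)..1, F (t, θ) := by
  rw [cyl_eq_prod] at *
  rw [integral_prod_symm _ hF, intervalIntegral.integral_of_le (by positivity)]
  refine integral_congr_ae (Eventually.of_forall fun t => ?_)
  exact (intervalIntegral.integral_of_le zero_le_one).symm

theorem intervalIntegrable_slice_t {F : ℝ × ℝ → V} (hF : Integrable F cyl) :
    IntervalIntegrable (fun t => ∫ θ in (0:ℝ)..(2 * Real.pi), F (t, θ)) volume 0 1 := by
  rw [cyl_eq_prod] at hF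
  rw [intervalIntegrable_iff_integrableOn_Ioc_of_le zero_le_one]
  refine hF.integral_prod_left.congr (Eventually.of_forall fun t => ?_)
  exact (intervalIntegral.integral_of_le (by positivity)).symm

theorem intervalIntegrable_slice_θ {F : ℝ × ℝ → V} (hF : Integrable F cyl) :
    IntervalIntegrable (fun θ => ∫ t in (0:ℝ)..1, F (t, θ)) volume 0 (2 * Real.pi) := by
  rw [cyl_eq_prod] at hF
  rw [intervalIntegrable_iff_integrableOn_Ioc_of_le (by positivity)]
  refine hF.integral_prod_right.congr (Eventually.of_forall fun t => ?_)
  exact (intervalIntegral.integral_of_le zero_le_one).symm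

end

/-- The closed rectangle that represents the cylinder. -/
abbrev rect : Set (ℝ × ℝ) := Icc 0 1 ×ˢ Icc 0 (2 * Real.pi)

theorem ae_mem_rect : ∀ᵐ p ∂cyl, p ∈ rect := by
  rw [ae_cyl]
  exact Eventually.of_forall fun p hp => ⟨⟨hp.1.1.le, hp.1.2.le⟩, ⟨hp.2.1.le, hp.2.2.le⟩⟩

theorem memLp_of_bdd {V : Type*} [NormedAddCommGroup V] {F : ℝ × ℝ → V} (hm : StronglyMeasurable F)
    (hb : ∃ C, ∀ p ∈ rect, ‖F p‖ ≤ C) (q : ENNReal) : MemLp F q cyl := by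
  obtain ⟨C, hC⟩ := hb
  refine MemLp.of_bound hm.aestronglyMeasurable C ?_
  filter_upwards [ae_mem_rect] with p hp using hC p hp

theorem integrable_of_bdd {V : Type*} [NormedAddCommGroup V] {F : ℝ × ℝ → V}
    (hm : StronglyMeasurable F) (hb : ∃ C, ∀ p ∈ rect, ‖F p‖ ≤ C) : Integrable F cyl :=
  memLp_one_iff_integrable.1 (memLp_of_bdd hm hb 1)

/-! ### Test functions -/

theorem hasDerivAt_dt {φ : ℝ × ℝ → ℝ} (h : ContDiff ℝ ∞ φ) (t θ : ℝ) :
    HasDerivAt (fun t => φ (t, θ)) (dt φ (t, θ)) t := by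
  have h1 : HasFDerivAt φ (fderiv ℝ φ (t, θ)) (t, θ) :=
    (h.differentiable (by simp) (t, θ)).hasFDerivAt
  exact h1.comp_hasDerivAt t ((hasDerivAt_id t).prodMk (hasDerivAt_const t θ))

theorem hasDerivAt_dθ {φ : ℝ × ℝ → ℝ} (h : ContDiff ℝ ∞ φ) (t θ : ℝ) :
    HasDerivAt (fun θ => φ (t, θ)) (dθ φ (t, θ)) θ := by
  have h1 : HasFDerivAt φ (fderiv ℝ φ (t, θ)) (t, θ) :=
    (h.differentiable (by simp) (t, θ)).hasFDerivAt
  exact h1.comp_hasDerivAt θ ((hasDerivAt_const θ t).prodMk (hasDerivAt_id θ))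

theorem IsTest.dt {φ : ℝ × ℝ → ℝ} (h : IsTest φ) : IsTest (dt φ) where
  smooth := contDiff_dt h.smooth
  periodic t θ := by
    have h1 := hasDerivAt_dt h.smooth t (θ + 2 * Real.pi)
    simp only [h.periodic] at h1
    exact h1.unique (hasDerivAt_dt h.smooth t θ)
  support := by
    obtain ⟨K, hK, hK1, hK2⟩ := h.support
    refine ⟨K, hK, hK1, ?_⟩
    rintro ⟨t, θ⟩ ht
    have h1 : (fun t => φ (t, θ)) =ᶠ[𝓝 t] fun _ => 0 := by
      filter_upwards [hK.isClosed.isOpen_compl.mem_nhds ht] with s hs using hK2 (s, θ) hs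
    exact (hasDerivAt_dt h.smooth t θ).unique ((hasDerivAt_const t 0).congr_of_eventuallyEq h1)

theorem IsTest.dθ {φ : ℝ × ℝ → ℝ} (h : IsTest φ) : IsTest (dθ φ) where
  smooth := contDiff_dθ h.smooth
  periodic t θ := by
    have h1 := (hasDerivAt_dθ h.smooth t (θ + 2 * Real.pi)).comp_add_const θ (2 * Real.pi)
    simp only [h.periodic] at h1
    exact h1.unique (hasDerivAt_dθ h.smooth t θ)
  support := by
    obtain ⟨K, hK, hK1, hK2⟩ := h.support
    refine ⟨K, hK, hK1, ?_⟩
    rintro ⟨t, θ⟩ ht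
    have h1 : (fun θ => φ (t, θ)) = fun _ => 0 := funext fun θ => hK2 (t, θ) ht
    have h2 := hasDerivAt_dθ h.smooth t θ
    rw [h1] at h2
    exact h2.unique (hasDerivAt_const θ 0)

theorem IsTest.iterate_dθ {φ : ℝ × ℝ → ℝ} (h : IsTest φ) (j : ℕ) : IsTest (CurvePath.dθ^[j] φ) := by
  induction j with
  | zero => exact h
  | succ j ih => rw [Function.iterate_succ_apply']; exact ih.dθ

theorem IsTest.eq_zero {φ : ℝ × ℝ → ℝ} (h : IsTest φ) {t : ℝ} (ht : t ∉ Ioo (0:ℝ) 1) (θ : ℝ) :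
    φ (t, θ) = 0 := by
  obtain ⟨K, _, hK1, hK2⟩ := h.support
  exact hK2 (t, θ) fun h => ht (hK1 h)

/-! ### Families of mixed derivatives -/

/-- `G i j`, `i ≤ k`, `j ≤ l`, are bounded measurable functions on the cylinder with
`G i j = ∂ₜⁱ ∂_θʲ (G 0 0)`, where derivatives are taken from the right, and where the functions of
non-maximal order are continuous in the respective variable, and periodic. -/
structure IsJet {d : ℕ} (k l : ℕ) (G : ℕ → ℕ → ℝ × ℝ → Vec d) : Prop where
  meas : ∀ i ≤ k, ∀ j ≤ l, StronglyMeasurable (G i j)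
  bdd : ∀ i ≤ k, ∀ j ≤ l, ∃ C, ∀ p ∈ rect, ‖G i j p‖ ≤ C
  contT : ∀ i < k, ∀ j ≤ l, ∀ θ ∈ Icc 0 (2 * Real.pi),
    ContinuousOn (fun t => G i j (t, θ)) (Icc 0 1)
  derivT : ∀ i < k, ∀ j ≤ l, ∀ θ ∈ Icc 0 (2 * Real.pi), ∀ t ∈ Ico (0:ℝ) 1,
    HasDerivWithinAt (fun t => G i j (t, θ)) (G (i + 1) j (t, θ)) (Ici t) t
  contθ : ∀ i ≤ k, ∀ j < l, ∀ t ∈ Icc (0:ℝ) 1,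
    ContinuousOn (fun θ => G i j (t, θ)) (Icc 0 (2 * Real.pi))
  derivθ : ∀ i ≤ k, ∀ j < l, ∀ t ∈ Icc (0:ℝ) 1, ∀ θ ∈ Ico 0 (2 * Real.pi),
    HasDerivWithinAt (fun θ => G i j (t, θ)) (G i (j + 1) (t, θ)) (Ici θ) θ
  per : ∀ i ≤ k, ∀ j < l, ∀ t ∈ Icc (0:ℝ) 1, G i j (t, 0) = G i j (t, 2 * Real.pi)

variable {d k l : ℕ} {G : ℕ → ℕ → ℝ × ℝ → Vec d}

theorem IsJet.memLp (hG : IsJet k l G) {i j : ℕ} (hi : i ≤ k) (hj : j ≤ l) :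
    MemLp (G i j) 2 cyl :=
  memLp_of_bdd (hG.meas i hi j hj) (hG.bdd i hi j hj) 2

theorem IsJet.chainT (hG : IsJet k l G) {j : ℕ} (hj : j ≤ l) {θ : ℝ}
    (hθ : θ ∈ Icc 0 (2 * Real.pi)) : IsChain 1 k fun i t => G i j (t, θ) where
  meas i hi := (hG.meas i hi j hj).comp_measurable measurable_prodMk_right
  bdd i hi := by
    obtain ⟨C, hC⟩ := hG.bdd i hi j hj
    exact ⟨C, fun t ht => hC (t, θ) ⟨ht, hθ⟩⟩
  cont i hi := hG.contT i hi j hj θ hθ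
  deriv i hi := hG.derivT i hi j hj θ hθ

theorem IsJet.chainθ (hG : IsJet k l G) {i : ℕ} (hi : i ≤ k) {t : ℝ}
    (ht : t ∈ Icc (0:ℝ) 1) : IsChain (2 * Real.pi) l fun j θ => G i j (t, θ) where
  meas j hj := (hG.meas i hi j hj).comp_measurable measurable_prodMk_left
  bdd j hj := by
    obtain ⟨C, hC⟩ := hG.bdd i hi j hj
    exact ⟨C, fun θ hθ => hC (t, θ) ⟨ht, hθ⟩⟩
  cont j hj := hG.contθ i hi j hj t ht
  deriv j hj := hG.derivθ i hi j hj t ht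

theorem bdd_smul_test {φ : ℝ × ℝ → ℝ} (hφ : Continuous φ) {F : ℝ × ℝ → Vec d}
    (hF : ∃ C, ∀ p ∈ rect, ‖F p‖ ≤ C) : ∃ C, ∀ p ∈ rect, ‖φ p • F p‖ ≤ C := by
  obtain ⟨C, hC⟩ := hF
  obtain ⟨D, hD⟩ := ((isCompact_Icc (a := (0:ℝ)) (b := 1)).prod
    (isCompact_Icc (a := (0:ℝ)) (b := 2 * Real.pi))).exists_bound_of_continuousOn hφ.continuousOn
  refine ⟨D * C, fun p hp => ?_⟩
  rw [norm_smul]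
  exact mul_le_mul (hD p hp) (hC p hp) (norm_nonneg _) ((norm_nonneg _).trans (hD p hp))

theorem IsJet.integrable_smul (hG : IsJet k l G) {i j : ℕ} (hi : i ≤ k) (hj : j ≤ l)
    {φ : ℝ × ℝ → ℝ} (hφ : Continuous φ) : Integrable (fun p => φ p • G i j p) cyl :=
  integrable_of_bdd (hφ.stronglyMeasurable.smul (hG.meas i hi j hj))
    (bdd_smul_test hφ (hG.bdd i hi j hj))

/-- Integration by parts on each line of constant `θ`. Continuity together with a derivative from
the right suffices for the fundamental theorem, and the test function vanishes at both ends. -/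
theorem IsJet.integral_dt_smul (hG : IsJet k l G) {i j : ℕ} (hi : i < k) (hj : j ≤ l)
    {φ : ℝ × ℝ → ℝ} (hφ : IsTest φ) :
    ∫ p, dt φ p • G i j p ∂cyl = -∫ p, φ p • G (i + 1) j p ∂cyl := by
  have i1 := hG.integrable_smul hi.le hj hφ.dt.smooth.continuous
  have i2 := hG.integrable_smul (Nat.succ_le_of_lt hi) hj hφ.smooth.continuous
  rw [eq_neg_iff_add_eq_zero, ← integral_add i1 i2, integral_cyl_θt (by exact i1.add i2)]
  rw [intervalIntegral.integral_zero_ae]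
  refine Eventually.of_forall fun θ hθ => ?_
  rw [uIoc_of_le (by positivity)] at hθ
  have hθ' : θ ∈ Icc 0 (2 * Real.pi) := ⟨hθ.1.le, hθ.2⟩
  have h1 : ContinuousOn (fun t => φ (t, θ)) (Icc 0 1) := fun t _ =>
    (hasDerivAt_dt hφ.smooth t θ).continuousAt.continuousWithinAt
  have := intervalIntegral.integral_eq_sub_of_hasDeriv_right (a := 0) (b := 1)
    (f := fun t => φ (t, θ) • G i j (t, θ))
    (f' := fun t => dt φ (t, θ) • G i j (t, θ) + φ (t, θ) • G (i + 1) j (t, θ)) ?_ ?_ ?_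
  · rw [this, hφ.eq_zero (by simp), hφ.eq_zero (by simp)]
    simp
  · rw [uIcc_of_le zero_le_one]
    exact h1.smul (hG.contT i hi j hj θ hθ')
  · intro t ht
    rw [min_eq_left zero_le_one, max_eq_right zero_le_one] at ht
    refine ((((hasDerivAt_dt hφ.smooth t θ).hasDerivWithinAt).smul
      (hG.derivT i hi j hj θ hθ' t ⟨ht.1.le, ht.2⟩)).mono Ioi_subset_Ici_self).congr_deriv ?_
    exact add_comm _ _
  · refine intervalIntegrable_of_bdd zero_le_one ?_ ?_
    · exact StronglyMeasurable.aestronglyMeasurable <|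
        ((hφ.dt.smooth.continuous.stronglyMeasurable.smul (hG.meas i hi.le j hj)).add
        (hφ.smooth.continuous.stronglyMeasurable.smul (hG.meas (i + 1) hi j hj))).comp_measurable
          (measurable_prodMk_right (y := θ))
    · obtain ⟨C, hC⟩ := bdd_smul_test hφ.dt.smooth.continuous (hG.bdd i hi.le j hj)
      obtain ⟨D, hD⟩ := bdd_smul_test hφ.smooth.continuous (hG.bdd (i + 1) hi j hj)
      exact ⟨C + D, fun t ht => (norm_add_le _ _).trans
        (add_le_add (hC (t, θ) ⟨ht, hθ'⟩) (hD (t, θ) ⟨ht, hθ'⟩))⟩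

/-- Here the boundary terms do not vanish separately; they cancel by periodicity of the test
function and of the jet. -/
theorem IsJet.integral_dθ_smul (hG : IsJet k l G) {i j : ℕ} (hi : i ≤ k) (hj : j < l)
    {φ : ℝ × ℝ → ℝ} (hφ : IsTest φ) :
    ∫ p, dθ φ p • G i j p ∂cyl = -∫ p, φ p • G i (j + 1) p ∂cyl := by
  have i1 := hG.integrable_smul hi hj.le hφ.dθ.smooth.continuous
  have i2 := hG.integrable_smul hi (Nat.succ_le_of_lt hj) hφ.smooth.continuous
  rw [eq_neg_iff_add_eq_zero, ← integral_add i1 i2, integral_cyl_tθ (by exact i1.add i2)]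
  rw [intervalIntegral.integral_zero_ae]
  refine Eventually.of_forall fun t ht => ?_
  rw [uIoc_of_le zero_le_one] at ht
  have ht' : t ∈ Icc (0:ℝ) 1 := ⟨ht.1.le, ht.2⟩
  have h1 : ContinuousOn (fun θ => φ (t, θ)) (Icc 0 (2 * Real.pi)) := fun θ _ =>
    (hasDerivAt_dθ hφ.smooth t θ).continuousAt.continuousWithinAt
  have hpi : 0 ≤ 2 * Real.pi := by positivity
  have := intervalIntegral.integral_eq_sub_of_hasDeriv_right (a := 0) (b := 2 * Real.pi)
    (f := fun θ => φ (t, θ) • G i j (t, θ))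
    (f' := fun θ => dθ φ (t, θ) • G i j (t, θ) + φ (t, θ) • G i (j + 1) (t, θ)) ?_ ?_ ?_
  · have hp := hφ.periodic t 0
    rw [zero_add] at hp
    rw [this, hp, hG.per i hi j hj t ht']
    simp
  · rw [uIcc_of_le hpi]
    exact h1.smul (hG.contθ i hi j hj t ht')
  · intro θ hθ
    rw [min_eq_left hpi, max_eq_right hpi] at hθ
    refine ((((hasDerivAt_dθ hφ.smooth t θ).hasDerivWithinAt).smul
      (hG.derivθ i hi j hj t ht' θ ⟨hθ.1.le, hθ.2⟩)).mono Ioi_subset_Ici_self).congr_deriv ?_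
    exact add_comm _ _
  · refine intervalIntegrable_of_bdd hpi ?_ ?_
    · exact StronglyMeasurable.aestronglyMeasurable <|
        ((hφ.dθ.smooth.continuous.stronglyMeasurable.smul (hG.meas i hi j hj.le)).add
        (hφ.smooth.continuous.stronglyMeasurable.smul (hG.meas i hi (j + 1) hj))).comp_measurable
          (measurable_prodMk_left (x := t))
    · obtain ⟨C, hC⟩ := bdd_smul_test hφ.dθ.smooth.continuous (hG.bdd i hi j hj.le)
      obtain ⟨D, hD⟩ := bdd_smul_test hφ.smooth.continuous (hG.bdd i hi (j + 1) hj)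
      exact ⟨C + D, fun θ hθ => (norm_add_le _ _).trans
        (add_le_add (hC (t, θ) ⟨ht', hθ⟩) (hD (t, θ) ⟨ht', hθ⟩))⟩

/-- The derivatives are moved off the test function one at a time: all `t`-derivatives at `θ`-order
zero, then the `θ`-derivatives at `t`-order `i`. -/
theorem IsJet.isWeakDeriv (hG : IsJet k l G) {i j : ℕ} (hi : i ≤ k) (hj : j ≤ l) {f g : L2 d}
    (hf : f =ᵐ[cyl] G 0 0) (hg : g =ᵐ[cyl] G i j) : IsWeakDeriv i j f g := by
  have hT : ∀ m ≤ k, ∀ ψ, IsTest ψ →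
      ∫ p, dt^[m] ψ p • G 0 0 p ∂cyl = (-1 : ℝ) ^ m • ∫ p, ψ p • G m 0 p ∂cyl := by
    intro m
    induction m with
    | zero => intro _ ψ _; simp
    | succ m ih =>
      intro hm ψ hψ
      rw [Function.iterate_succ_apply, ih (by omega) _ hψ.dt,
        hG.integral_dt_smul (by omega) (Nat.zero_le _) hψ, pow_succ, mul_neg_one, neg_smul, smul_neg]
  have hθ : ∀ m ≤ l, ∀ ψ, IsTest ψ →
      ∫ p, dθ^[m] ψ p • G i 0 p ∂cyl = (-1 : ℝ) ^ m • ∫ p, ψ p • G i m p ∂cyl := by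
    intro m
    induction m with
    | zero => intro _ ψ _; simp
    | succ m ih =>
      intro hm ψ hψ
      rw [Function.iterate_succ_apply, ih (by omega) _ hψ.dθ,
        hG.integral_dθ_smul hi (by omega) hψ, pow_succ, mul_neg_one, neg_smul, smul_neg]
  intro φ hφ
  have e1 : ∫ p, partialDeriv i j φ p • f p ∂cyl = ∫ p, partialDeriv i j φ p • G 0 0 p ∂cyl :=
    integral_congr_ae (by filter_upwards [hf] with p hp; rw [hp])
  have e2 : ∫ p, φ p • g p ∂cyl = ∫ p, φ p • G i j p ∂cyl :=
    integral_congr_ae (by filter_upwards [hg] with p hp; rw [hp])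
  rw [e1, e2]
  unfold partialDeriv
  rw [hT i hi _ (hφ.iterate_dθ j), hθ j hj φ hφ, smul_smul, ← pow_add]

theorem IsJet.exists_sobolev (hG : IsJet k l G) :
    ∃ u : MixedSobolev k l d, MixedSobolev.fn u =ᵐ[cyl] G 0 0 := by
  have m0 := hG.memLp (Nat.zero_le k) (Nat.zero_le l)
  have m1 := hG.memLp (le_refl k) (Nat.zero_le l)
  have m2 := hG.memLp (Nat.zero_le k) (le_refl l)
  have m3 := hG.memLp (le_refl k) (le_refl l)
  refine ⟨⟨WithLp.toLp 2 ![m0.toLp, m1.toLp, m2.toLp, m3.toLp], ?_, ?_, ?_⟩, m0.coeFn_toLp⟩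
  · exact hG.isWeakDeriv le_rfl (Nat.zero_le l) m0.coeFn_toLp m1.coeFn_toLp
  · exact hG.isWeakDeriv (Nat.zero_le k) le_rfl m0.coeFn_toLp m2.coeFn_toLp
  · exact hG.isWeakDeriv le_rfl le_rfl m0.coeFn_toLp m3.coeFn_toLp

theorem IsJet.ae_eq_of_isWeakDeriv (hG : IsJet k l G) {i j : ℕ} (hi : i ≤ k) (hj : j ≤ l) {f g : L2 d}
    (hf : f =ᵐ[cyl] G 0 0) (hg : IsWeakDeriv i j f g) : g =ᵐ[cyl] G i j := by
  have m := hG.memLp hi hj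
  rw [hg.unique (hG.isWeakDeriv hi hj hf m.coeFn_toLp)]
  exact m.coeFn_toLp

/-- The square of the `L²` norm on the cylinder. -/
def sqCyl (F : ℝ × ℝ → Vec d) : ℝ := ∫ p, ‖F p‖ ^ 2 ∂cyl

theorem sqCyl_nonneg (F : ℝ × ℝ → Vec d) : 0 ≤ sqCyl F := integral_nonneg fun _ => by positivity

theorem norm_sq_eq_sqCyl (f : L2 d) : ‖f‖ ^ 2 = sqCyl f := by
  rw [← real_inner_self_eq_norm_sq, L2.inner_def]
  exact integral_congr_ae (Eventually.of_forall fun p => real_inner_self_eq_norm_sq _)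

theorem sqCyl_congr {F F' : ℝ × ℝ → Vec d} (h : F =ᵐ[cyl] F') : sqCyl F = sqCyl F' :=
  integral_congr_ae (by filter_upwards [h] with p hp; rw [hp])

theorem MixedSobolev.norm_sq_eq (u : MixedSobolev k l d) :
    ‖u‖ ^ 2 = ‖u.1 0‖ ^ 2 + ‖u.1 1‖ ^ 2 + ‖u.1 2‖ ^ 2 + ‖u.1 3‖ ^ 2 := by
  rw [Submodule.coe_norm, PiLp.norm_sq_eq_of_L2, Fin.sum_univ_four]

theorem IsJet.norm_sq_eq (hG : IsJet k l G) {u : MixedSobolev k l d}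
    (hu : MixedSobolev.fn u =ᵐ[cyl] G 0 0) :
    ‖u‖ ^ 2 = sqCyl (G 0 0) + sqCyl (G k 0) + sqCyl (G 0 l) + sqCyl (G k l) := by
  obtain ⟨h1, h2, h3⟩ := u.2
  rw [MixedSobolev.norm_sq_eq, norm_sq_eq_sqCyl, norm_sq_eq_sqCyl, norm_sq_eq_sqCyl, norm_sq_eq_sqCyl,
    sqCyl_congr (show (u.1 0 : ℝ × ℝ → Vec d) =ᵐ[cyl] _ from hu),
    sqCyl_congr (hG.ae_eq_of_isWeakDeriv le_rfl (Nat.zero_le l) hu h1),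
    sqCyl_congr (hG.ae_eq_of_isWeakDeriv (Nat.zero_le k) le_rfl hu h2),
    sqCyl_congr (hG.ae_eq_of_isWeakDeriv le_rfl le_rfl hu h3)]

theorem integrable_norm_sq {F : ℝ × ℝ → Vec d} (hm : StronglyMeasurable F)
    (hb : ∃ C, ∀ p ∈ rect, ‖F p‖ ≤ C) : Integrable (fun p => ‖F p‖ ^ 2) cyl :=
  (memLp_of_bdd hm hb 2).integrable_norm_pow (by norm_num)

theorem IsJet.integrable_norm_sq (hG : IsJet k l G) {i j : ℕ} (hi : i ≤ k) (hj : j ≤ l) :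
    Integrable (fun p => ‖G i j p‖ ^ 2) cyl :=
  CurvePath.integrable_norm_sq (hG.meas i hi j hj) (hG.bdd i hi j hj)

theorem sqCyl_eq_t {F : ℝ × ℝ → Vec d} (h : Integrable (fun p => ‖F p‖ ^ 2) cyl) :
    sqCyl F = ∫ t in (0:ℝ)..1, sqInt (2 * Real.pi) fun θ => F (t, θ) :=
  integral_cyl_tθ h

theorem sqCyl_eq_θ {F : ℝ × ℝ → Vec d} (h : Integrable (fun p => ‖F p‖ ^ 2) cyl) :
    sqCyl F = ∫ θ in (0:ℝ)..(2 * Real.pi), sqInt 1 fun t => F (t, θ) :=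
  integral_cyl_θt h

theorem intervalIntegrable_sqInt_t {F : ℝ × ℝ → Vec d} (h : Integrable (fun p => ‖F p‖ ^ 2) cyl) :
    IntervalIntegrable (fun t => sqInt (2 * Real.pi) fun θ => F (t, θ)) volume 0 1 :=
  intervalIntegrable_slice_t h

theorem intervalIntegrable_sqInt_θ {F : ℝ × ℝ → Vec d} (h : Integrable (fun p => ‖F p‖ ^ 2) cyl) :
    IntervalIntegrable (fun θ => sqInt 1 fun t => F (t, θ)) volume 0 (2 * Real.pi) :=
  intervalIntegrable_slice_θ h

/-- The `L²` norms of all intermediate mixed derivatives are bounded by the norm of `H^{k,l}`. -/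
theorem exists_interpolate (d k l : ℕ) : ∃ C, 0 ≤ C ∧ ∀ G : ℕ → ℕ → ℝ × ℝ → Vec d, IsJet k l G →
    ∀ u : MixedSobolev k l d, MixedSobolev.fn u =ᵐ[cyl] G 0 0 →
      ∀ i ≤ k, ∀ j ≤ l, sqCyl (G i j) ≤ C * ‖u‖ ^ 2 := by
  have hpi : 0 < 2 * Real.pi := by positivity
  obtain ⟨A, hA0, hA⟩ := IsChain.interpolate (E := Vec d) one_pos k
  obtain ⟨B, hB0, hB⟩ := IsChain.interpolate (E := Vec d) hpi l
  refine ⟨A * B, by positivity, fun G hG u hu i hi j hj => ?_⟩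
  -- Interpolation in `t` on the lines of constant `θ` reduces to the orders `0` and `k`;
  -- interpolation in `θ` then reduces to the four corners that make up the norm.
  have hT : ∀ j ≤ l, sqCyl (G i j) ≤ A * (sqCyl (G 0 j) + sqCyl (G k j)) := by
    intro j hj
    have h0 := hG.integrable_norm_sq (Nat.zero_le k) hj
    have h1 := hG.integrable_norm_sq hi hj
    have h2 := hG.integrable_norm_sq le_rfl hj
    rw [sqCyl_eq_θ h0, sqCyl_eq_θ h1, sqCyl_eq_θ h2, ← intervalIntegral.integral_add
      (intervalIntegrable_sqInt_θ h0) (intervalIntegrable_sqInt_θ h2),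
      ← intervalIntegral.integral_const_mul]
    exact intervalIntegral.integral_mono_on hpi.le (intervalIntegrable_sqInt_θ h1)
      (((intervalIntegrable_sqInt_θ h0).add (intervalIntegrable_sqInt_θ h2)).const_mul A)
      fun θ hθ => hA _ (hG.chainT hj hθ) i hi
  have hθ : ∀ i ≤ k, sqCyl (G i j) ≤ B * (sqCyl (G i 0) + sqCyl (G i l)) := by
    intro i hi
    have h0 := hG.integrable_norm_sq hi (Nat.zero_le l)
    have h1 := hG.integrable_norm_sq hi hj
    have h2 := hG.integrable_norm_sq hi le_rfl
    rw [sqCyl_eq_t h0, sqCyl_eq_t h1, sqCyl_eq_t h2, ← intervalIntegral.integral_add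
      (intervalIntegrable_sqInt_t h0) (intervalIntegrable_sqInt_t h2),
      ← intervalIntegral.integral_const_mul]
    exact intervalIntegral.integral_mono_on zero_le_one (intervalIntegrable_sqInt_t h1)
      (((intervalIntegrable_sqInt_t h0).add (intervalIntegrable_sqInt_t h2)).const_mul B)
      fun t ht => hB _ (hG.chainθ hi ht) j hj
  rw [hG.norm_sq_eq hu]
  calc sqCyl (G i j) ≤ A * (sqCyl (G 0 j) + sqCyl (G k j)) := hT j hj
    _ ≤ A * (B * (sqCyl (G 0 0) + sqCyl (G 0 l)) + B * (sqCyl (G k 0) + sqCyl (G k l))) := by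
      gcongr
      · exact hθ 0 (Nat.zero_le k)
      · exact hθ k le_rfl
    _ = _ := by ring

/-- The traces of `G 0 j` on the curves `t = const` are bounded in `L²`. -/
theorem IsJet.sqInt_slice_le (hG : IsJet k l G) (hk : 1 ≤ k) {j : ℕ} (hj : j ≤ l) {t : ℝ}
    (ht : t ∈ Icc (0:ℝ) 1) :
    sqInt (2 * Real.pi) (fun θ => G 0 j (t, θ)) ≤ 2 * (sqCyl (G 0 j) + sqCyl (G 1 j)) := by
  have hpi : 0 < 2 * Real.pi := by positivity
  have h0 := hG.integrable_norm_sq (Nat.zero_le k) hj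
  have h1 := hG.integrable_norm_sq hk hj
  have i0 := intervalIntegrable_sqInt_θ h0
  have i1 := intervalIntegrable_sqInt_θ h1
  have e : 2 * (sqCyl (G 0 j) + sqCyl (G 1 j)) = ∫ θ in (0:ℝ)..(2 * Real.pi),
      2 * (sqInt 1 (fun t => G 0 j (t, θ)) + sqInt 1 (fun t => G 1 j (t, θ))) := by
    rw [sqCyl_eq_θ h0, sqCyl_eq_θ h1, intervalIntegral.integral_const_mul,
      intervalIntegral.integral_add i0 i1]
  rw [e]
  refine intervalIntegral.integral_mono_on hpi.le ?_ ((i0.add i1).const_mul 2) fun θ hθ => ?_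
  · obtain ⟨C, hC⟩ := hG.bdd 0 (Nat.zero_le k) j hj
    exact intervalIntegrable_of_bdd hpi.le
      (((hG.meas 0 (Nat.zero_le k) j hj).comp_measurable measurable_prodMk_left).norm.pow
        2).aestronglyMeasurable (bdd_norm_sq ⟨C, fun θ hθ => hC (t, θ) ⟨ht, hθ⟩⟩)
  · have := ((hG.chainT hj hθ).mono hk).sup_le one_pos one_pos ht
    have n := sqInt_nonneg zero_le_one fun t => G 1 j (t, θ)
    norm_num at this
    linarith

/-- The one-dimensional supremum bound in `θ` with `δ = 1`; the constant uses `(2π)⁻¹ ≤ 1`. -/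
theorem IsJet.norm_sq_le (hG : IsJet k l G) {i j : ℕ} (hi : i ≤ k) (hj : j + 1 ≤ l) {t θ : ℝ}
    (ht : t ∈ Icc (0:ℝ) 1) (hθ : θ ∈ Icc 0 (2 * Real.pi)) :
    ‖G i j (t, θ)‖ ^ 2 ≤ 2 * (sqInt (2 * Real.pi) (fun θ => G i j (t, θ)) +
      sqInt (2 * Real.pi) (fun θ => G i (j + 1) (t, θ))) := by
  have hpi : 0 < 2 * Real.pi := by positivity
  have hc := hG.chainθ hi ht
  have hc' : IsChain (2 * Real.pi) 1 fun r θ => G i (j + r) (t, θ) :=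
    ⟨fun r hr => hc.meas _ (by omega), fun r hr => hc.bdd _ (by omega),
      fun r hr => hc.cont _ (by omega), fun r hr => hc.deriv _ (by omega)⟩
  have := hc'.sup_le hpi one_pos hθ
  have n0 := sqInt_nonneg hpi.le fun θ => G i j (t, θ)
  have n1 := sqInt_nonneg hpi.le fun θ => G i (j + 1) (t, θ)
  have hL : (2 * Real.pi)⁻¹ ≤ 1 := inv_le_one_of_one_le₀ (by linarith [Real.pi_gt_three])
  simp only [add_zero] at this
  rw [inv_one, one_mul] at this
  have := mul_le_mul_of_nonneg_right hL n0
  linarith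

/-- The derivative of order `(0,1)` is bounded by the norm of `H^{k,l}`. -/
theorem exists_sup_bound (d : ℕ) {k l : ℕ} (hk : 1 ≤ k) (hl : 2 ≤ l) : ∃ C, 0 ≤ C ∧
    ∀ G : ℕ → ℕ → ℝ × ℝ → Vec d, IsJet k l G →
    ∀ u : MixedSobolev k l d, MixedSobolev.fn u =ᵐ[cyl] G 0 0 →
      ∀ p ∈ rect, ‖G 0 1 p‖ ≤ C * ‖u‖ := by
  obtain ⟨C, hC0, hC⟩ := exists_interpolate d k l
  refine ⟨4 * (C + 1), by positivity, fun G hG u hu p hp => ?_⟩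
  -- The supremum in `θ` is bounded by the traces of orders `(0,1)` and `(0,2)` at time `t`, and
  -- these by the `L²` norms of orders `(0,1)`, `(1,1)`, `(0,2)`, `(1,2)` on the cylinder.
  have h1 := hG.norm_sq_le (Nat.zero_le k) (show 1 + 1 ≤ l from hl) hp.1 hp.2
  have h2 := hG.sqInt_slice_le hk (show 1 ≤ l by omega) hp.1
  have h3 := hG.sqInt_slice_le hk hl hp.1
  have a1 := hC G hG u hu 0 (Nat.zero_le k) 1 (by omega)
  have a2 := hC G hG u hu 1 hk 1 (by omega)
  have a3 := hC G hG u hu 0 (Nat.zero_le k) 2 hl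
  have a4 := hC G hG u hu 1 hk 2 hl
  refine le_of_sq_le_sq ?_ (by positivity)
  have h4 : ‖G 0 1 p‖ ^ 2 ≤ 16 * (C * ‖u‖ ^ 2) := by
    norm_num at h1 h2 h3
    linarith
  have h5 : 0 ≤ (C ^ 2 + C + 1) * ‖u‖ ^ 2 := by positivity
  nlinarith

/-- The pointwise product of derivatives of order `(0,2)` and `(1,1)` is bounded in `L²`. -/
theorem exists_product_bound (d : ℕ) {k l : ℕ} (hk : 1 ≤ k) (hl : 2 ≤ l) : ∃ C, 0 ≤ C ∧
    ∀ F G : ℕ → ℕ → ℝ × ℝ → Vec d, IsJet k l F → IsJet k l G →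
    ∀ u v : MixedSobolev k l d, MixedSobolev.fn u =ᵐ[cyl] F 0 0 → MixedSobolev.fn v =ᵐ[cyl] G 0 0 →
      ∫ p, (‖F 0 2 p‖ * ‖G 1 1 p‖) ^ 2 ∂cyl ≤ C * (‖u‖ * ‖v‖) ^ 2 := by
  have hpi : 0 < 2 * Real.pi := by positivity
  obtain ⟨C, hC0, hC⟩ := exists_interpolate d k l
  refine ⟨16 * C ^ 2, by positivity, fun F G hF hG u v hu hv => ?_⟩
  have i1 := hG.integrable_norm_sq hk (show 1 ≤ l by omega)
  have i2 := hG.integrable_norm_sq hk hl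
  have s1 := intervalIntegrable_sqInt_t i1
  have s2 := intervalIntegrable_sqInt_t i2
  set M := 2 * (sqCyl (F 0 2) + sqCyl (F 1 2)) with hM
  have hM0 : 0 ≤ M := by
    have := sqCyl_nonneg (F 0 2)
    have := sqCyl_nonneg (F 1 2)
    positivity
  have mF := hF.meas 0 (Nat.zero_le k) 2 hl
  have mG := hG.meas 1 hk 1 (by omega)
  obtain ⟨CF, hCF⟩ := hF.bdd 0 (Nat.zero_le k) 2 hl
  obtain ⟨CG, hCG⟩ := hG.bdd 1 hk 1 (by omega)
  have hbd : ∀ p ∈ rect, ‖(‖F 0 2 p‖ * ‖G 1 1 p‖) ^ 2‖ ≤ (CF * CG) ^ 2 := by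
    intro p hp
    rw [norm_pow, norm_mul, norm_norm, norm_norm]
    have h1 := hCF p hp
    have h2 := hCG p hp
    have h3 := (norm_nonneg _).trans h1
    gcongr
  have hmeas : StronglyMeasurable fun p => (‖F 0 2 p‖ * ‖G 1 1 p‖) ^ 2 := (mF.norm.mul mG.norm).pow 2
  have hint : Integrable (fun p => (‖F 0 2 p‖ * ‖G 1 1 p‖) ^ 2) cyl :=
    integrable_of_bdd hmeas ⟨_, hbd⟩
  rw [integral_cyl_tθ hint]
  -- At each time, `G 1 1` is bounded uniformly in `θ` by a quantity integrable in `t`, and `F 0 2`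
  -- is bounded in `L²(dθ)` by `M`, uniformly in `t`.
  have hle : ∫ t in (0:ℝ)..1, ∫ θ in (0:ℝ)..(2 * Real.pi), (‖F 0 2 (t, θ)‖ * ‖G 1 1 (t, θ)‖) ^ 2 ≤
      ∫ t in (0:ℝ)..1, 2 * M * (sqInt (2 * Real.pi) (fun θ => G 1 1 (t, θ)) +
        sqInt (2 * Real.pi) (fun θ => G 1 2 (t, θ))) := by
    refine intervalIntegral.integral_mono_on zero_le_one (intervalIntegrable_slice_t hint)
      ((s1.add s2).const_mul _) fun t ht => ?_
    set β := 2 * (sqInt (2 * Real.pi) (fun θ => G 1 1 (t, θ)) +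
        sqInt (2 * Real.pi) (fun θ => G 1 2 (t, θ))) with hβ
    have hβ0 : 0 ≤ β := by
      have := sqInt_nonneg hpi.le fun θ => G 1 1 (t, θ)
      have := sqInt_nonneg hpi.le fun θ => G 1 2 (t, θ)
      positivity
    have j1 : IntervalIntegrable (fun θ => ‖F 0 2 (t, θ)‖ ^ 2) volume 0 (2 * Real.pi) :=
      intervalIntegrable_of_bdd hpi.le ((mF.comp_measurable measurable_prodMk_left).norm.pow
        2).aestronglyMeasurable (bdd_norm_sq ⟨CF, fun θ hθ => hCF (t, θ) ⟨ht, hθ⟩⟩)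
    have j2 : IntervalIntegrable (fun θ => (‖F 0 2 (t, θ)‖ * ‖G 1 1 (t, θ)‖) ^ 2) volume 0
        (2 * Real.pi) :=
      intervalIntegrable_of_bdd hpi.le (hmeas.comp_measurable
        measurable_prodMk_left).aestronglyMeasurable ⟨_, fun θ hθ => hbd (t, θ) ⟨ht, hθ⟩⟩
    calc ∫ θ in (0:ℝ)..(2 * Real.pi), (‖F 0 2 (t, θ)‖ * ‖G 1 1 (t, θ)‖) ^ 2
        ≤ ∫ θ in (0:ℝ)..(2 * Real.pi), β * ‖F 0 2 (t, θ)‖ ^ 2 := by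
          refine intervalIntegral.integral_mono_on hpi.le j2 (j1.const_mul β) fun θ hθ => ?_
          have := hG.norm_sq_le hk (show 1 + 1 ≤ l from hl) ht hθ
          rw [mul_pow, mul_comm]
          gcongr
      _ = β * sqInt (2 * Real.pi) (fun θ => F 0 2 (t, θ)) := by
          rw [intervalIntegral.integral_const_mul]; rfl
      _ ≤ β * M := by
          gcongr
          exact hF.sqInt_slice_le hk hl ht
      _ = _ := by rw [hβ]; ring
  rw [intervalIntegral.integral_const_mul, intervalIntegral.integral_add s1 s2, ← sqCyl_eq_t i1,
    ← sqCyl_eq_t i2] at hle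
  have a1 := hC F hF u hu 0 (Nat.zero_le k) 2 hl
  have a2 := hC F hF u hu 1 hk 2 hl
  have a3 := hC G hG v hv 1 hk 1 (by omega)
  have a4 := hC G hG v hv 1 hk 2 hl
  have hM1 : M ≤ 4 * (C * ‖u‖ ^ 2) := by linarith
  calc _ ≤ _ := hle
    _ ≤ 2 * (4 * (C * ‖u‖ ^ 2)) * (C * ‖v‖ ^ 2 + C * ‖v‖ ^ 2) := by
      have := sqCyl_nonneg (G 1 1)
      have := sqCyl_nonneg (G 1 2)
      gcongr
    _ = _ := by ring

end

section

/-! ### Weak derivatives in one variable -/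

/-- Smooth functions with compact support in `(0,1)`. -/
structure IsTestI (φ : ℝ → ℝ) : Prop where
  smooth : ContDiff ℝ ∞ φ
  support : ∃ a b, 0 < a ∧ a ≤ b ∧ b < 1 ∧ ∀ x ∉ Icc a b, φ x = 0

theorem isTestI_of_tsupport {φ : ℝ → ℝ} (h : ContDiff ℝ ∞ φ) (hc : HasCompactSupport φ)
    (hs : tsupport φ ⊆ Ioo 0 1) : IsTestI φ := by
  refine ⟨h, ?_⟩
  rcases (tsupport φ).eq_empty_or_nonempty with he | hne
  · refine ⟨1 / 2, 1 / 2, by norm_num, le_rfl, by norm_num, fun x _ => ?_⟩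
    exact image_eq_zero_of_notMem_tsupport (by rw [he]; exact notMem_empty x)
  · obtain ⟨a, ha⟩ := hc.isCompact.exists_isLeast hne
    obtain ⟨b, hb⟩ := hc.isCompact.exists_isGreatest hne
    refine ⟨a, b, (hs ha.1).1, ha.2 hb.1, (hs hb.1).2, fun x hx => ?_⟩
    exact image_eq_zero_of_notMem_tsupport fun hm => hx ⟨ha.2 hm, hb.2 hm⟩

theorem IsTestI.deriv {φ : ℝ → ℝ} (h : IsTestI φ) : IsTestI (deriv φ) := by
  refine ⟨(contDiff_infty_iff_deriv.1 h.smooth).2, ?_⟩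
  obtain ⟨a, b, ha, hab, hb, h0⟩ := h.support
  refine ⟨a, b, ha, hab, hb, fun x hx => ?_⟩
  have : φ =ᶠ[𝓝 x] fun _ => 0 := by
    filter_upwards [isClosed_Icc.isOpen_compl.mem_nhds hx] with y hy using h0 y hy
  rw [this.deriv_eq]
  simp

theorem IsTestI.sub {φ ψ : ℝ → ℝ} (h : IsTestI φ) (h' : IsTestI ψ) :
    IsTestI fun x => φ x - ψ x := by
  refine ⟨h.smooth.sub h'.smooth, ?_⟩
  obtain ⟨a, b, ha, hab, hb, h0⟩ := h.support
  obtain ⟨a', b', ha', hab', hb', h0'⟩ := h'.support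
  refine ⟨min a a', max b b', lt_min ha ha', (min_le_left _ _).trans (hab.trans (le_max_left _ _)),
    max_lt hb hb', fun x hx => ?_⟩
  rw [h0 x fun hm => hx ⟨(min_le_left _ _).trans hm.1, hm.2.trans (le_max_left _ _)⟩,
    h0' x fun hm => hx ⟨(min_le_right _ _).trans hm.1, hm.2.trans (le_max_right _ _)⟩, sub_zero]

theorem IsTestI.const_mul {φ : ℝ → ℝ} (h : IsTestI φ) (c : ℝ) : IsTestI fun x => c * φ x := by
  refine ⟨contDiff_const.mul h.smooth, ?_⟩
  obtain ⟨a, b, ha, hab, hb, h0⟩ := h.support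
  exact ⟨a, b, ha, hab, hb, fun x hx => by rw [h0 x hx, mul_zero]⟩

theorem IsTestI.apply_zero {φ : ℝ → ℝ} (h : IsTestI φ) : φ 0 = 0 := by
  obtain ⟨a, b, ha, hab, hb, h0⟩ := h.support
  exact h0 0 fun hm => absurd hm.1 (not_le.2 ha)

theorem IsTestI.apply_one {φ : ℝ → ℝ} (h : IsTestI φ) : φ 1 = 0 := by
  obtain ⟨a, b, ha, hab, hb, h0⟩ := h.support
  exact h0 1 fun hm => absurd hm.2 (not_le.2 hb)

/-- Mean zero is exactly what makes the primitive vanish again to the right of the support. -/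
theorem IsTestI.primitive {h : ℝ → ℝ} (hh : IsTestI h) (h0 : ∫ x in (0:ℝ)..1, h x = 0) :
    IsTestI fun x => ∫ s in (0:ℝ)..x, h s := by
  have hc := hh.smooth.continuous
  have hd : ∀ x, HasDerivAt (fun x => ∫ s in (0:ℝ)..x, h s) (h x) x := fun x =>
    intervalIntegral.integral_hasDerivAt_right (hc.intervalIntegrable _ _)
      hc.stronglyMeasurable.stronglyMeasurableAtFilter hc.continuousAt
  refine ⟨contDiff_infty_iff_deriv.2 ⟨fun x => (hd x).differentiableAt, ?_⟩, ?_⟩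
  · rw [show _root_.deriv (fun x => ∫ s in (0:ℝ)..x, h s) = h from funext fun x => (hd x).deriv]
    exact hh.smooth
  · obtain ⟨a, b, ha, hab, hb, hz⟩ := hh.support
    refine ⟨a, b, ha, hab, hb, fun x hx => ?_⟩
    rcases lt_or_ge x a with hxa | hxa
    · rw [intervalIntegral.integral_zero_ae]
      refine Eventually.of_forall fun s hs => hz s fun hm => ?_
      have : s ≤ max 0 x := hs.2
      have : max 0 x < a := max_lt ha hxa
      linarith [hm.1]
    · have hxb : b < x := by
        by_contra hcon
        exact hx ⟨hxa, not_lt.1 hcon⟩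
      have h1 := intervalIntegral.integral_add_adjacent_intervals
        (hc.intervalIntegrable (μ := volume) 0 1) (hc.intervalIntegrable 1 x)
      rw [← h1, h0, zero_add, intervalIntegral.integral_zero_ae]
      refine Eventually.of_forall fun s hs => hz s fun hm => ?_
      have : min 1 x < s := hs.1
      have : b < min 1 x := lt_min hb hxb
      linarith [hm.2]

theorem exists_testI_integral_eq_one : ∃ χ, IsTestI χ ∧ ∫ x in (0:ℝ)..1, χ x = 1 := by
  let f : ContDiffBump (1 / 2 : ℝ) := ⟨1 / 8, 1 / 4, by norm_num, by norm_num⟩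
  have hz : ∀ x ∉ Icc (1 / 4 : ℝ) (3 / 4), f.normed volume x = 0 := by
    intro x hx
    by_contra hne
    have h1 : x ∈ Function.support (f.normed volume) := hne
    rw [f.support_normed_eq, Metric.mem_ball, Real.dist_eq, abs_lt] at h1
    have : f.rOut = 1 / 4 := rfl
    rw [this] at h1
    exact hx ⟨by linarith [h1.1], by linarith [h1.2]⟩
  refine ⟨f.normed volume, ⟨f.contDiff_normed, 1 / 4, 3 / 4, by norm_num, by norm_num, by norm_num,
    hz⟩, ?_⟩
  rw [intervalIntegral.integral_of_le zero_le_one, setIntegral_eq_integral_of_forall_compl_eq_zero,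
    f.integral_normed]
  intro x hx
  refine hz x fun hm => hx ⟨by linarith [hm.1], by linarith [hm.2]⟩

theorem ae_eq_of_testI {W W' : ℝ → ℝ} (hW : IntervalIntegrable W volume 0 1)
    (hW' : IntervalIntegrable W' volume 0 1)
    (h : ∀ φ, IsTestI φ → ∫ x in (0:ℝ)..1, φ x * W x = ∫ x in (0:ℝ)..1, φ x * W' x) :
    W =ᵐ[volume.restrict (Ioc 0 1)] W' := by
  have hi := hW.sub hW'
  rw [intervalIntegrable_iff_integrableOn_Ioc_of_le zero_le_one] at hi
  have hi' : IntegrableOn (fun x => W x - W' x) (Ioo 0 1) := hi.mono_set Ioo_subset_Ioc_self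
  have := isOpen_Ioo.ae_eq_zero_of_integral_contDiff_smul_eq_zero hi'.locallyIntegrableOn (by
    intro φ hφ hc hs
    have ht := isTestI_of_tsupport hφ hc hs
    rw [← setIntegral_eq_integral_of_forall_compl_eq_zero (s := Ioc 0 1),
      ← intervalIntegral.integral_of_le zero_le_one]
    · simp only [smul_eq_mul, mul_sub]
      rw [intervalIntegral.integral_sub (hW.continuousOn_mul hφ.continuous.continuousOn)
        (hW'.continuousOn_mul hφ.continuous.continuousOn), h φ ht, sub_self]
    · intro x hx
      rw [image_eq_zero_of_notMem_tsupport fun hm => hx (Ioo_subset_Ioc_self (hs hm)), zero_smul])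
  rw [← restrict_Ioo_eq_restrict_Ioc, EventuallyEq, ae_restrict_iff' measurableSet_Ioo]
  filter_upwards [this] with x hx hm
  exact sub_eq_zero.1 (hx hm)

/-- The primitive of a merely integrable `W` is absolutely continuous, which is enough for
integration by parts. The constant `c` is free because `∫ φ' = 0`. -/
theorem IsTestI.integral_deriv_mul {φ W : ℝ → ℝ} (hφ : IsTestI φ)
    (hW : IntervalIntegrable W volume 0 1) (c : ℝ) :
    ∫ x in (0:ℝ)..1, φ x * W x = -∫ x in (0:ℝ)..1, _root_.deriv φ x * (c + ∫ s in (0:ℝ)..x, W s) := by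
  have hZ : AbsolutelyContinuousOnInterval (fun x => ∫ s in (0:ℝ)..x, W s) 0 1 :=
    hW.absolutelyContinuousOnInterval_intervalIntegral (by simp)
  have hφa : AbsolutelyContinuousOnInterval φ 0 1 :=
    ContDiffOn.absolutelyContinuousOnInterval (hφ.smooth.contDiffOn.of_le (by simp))
  have hZc : ContinuousOn (fun x => ∫ s in (0:ℝ)..x, W s) (uIcc 0 1) := hZ.continuousOn
  have h := hφa.integral_mul_deriv_eq_deriv_mul hZ
  rw [hφ.apply_zero, hφ.apply_one, zero_mul, zero_mul, sub_zero, zero_sub] at h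
  have e : ∫ x in (0:ℝ)..1, φ x * W x =
      ∫ x in (0:ℝ)..1, φ x * _root_.deriv (fun x => ∫ s in (0:ℝ)..x, W s) x := by
    refine intervalIntegral.integral_congr_ae ?_
    filter_upwards [hW.ae_hasDerivAt_integral] with x hx hm
    rw [(hx (uIoc_subset_uIcc hm) 0 (by simp)).deriv]
  rw [e, h]
  congr 1
  simp only [mul_add]
  have hd := hφ.deriv.smooth.continuous
  rw [intervalIntegral.integral_add ((hd.fun_mul continuous_const).intervalIntegrable _ _)
    ((hd.continuousOn.fun_mul hZc).intervalIntegrable), intervalIntegral.integral_mul_const]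
  have h1 : ∫ x in (0:ℝ)..1, _root_.deriv φ x = φ 1 - φ 0 :=
    intervalIntegral.integral_deriv_eq_sub
      (fun x _ => (hφ.smooth.differentiable (by simp)) x) (hd.intervalIntegrable _ _)
  rw [h1, hφ.apply_zero, hφ.apply_one]
  simp

theorem IsTestI.iteratedDeriv {φ : ℝ → ℝ} (h : IsTestI φ) (n : ℕ) :
    IsTestI (iteratedDeriv n φ) := by
  induction n with
  | zero => simpa using h
  | succ n ih => rw [iteratedDeriv_succ]; exact ih.deriv

/-- A function with weak `k`-th derivative `W'` is a `k`-fold primitive of it. -/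
theorem exists_primitives (k : ℕ) {W W' : ℝ → ℝ} (hW : IntervalIntegrable W volume 0 1)
    (hW' : IntervalIntegrable W' volume 0 1)
    (h : ∀ φ, IsTestI φ → ∫ x in (0:ℝ)..1, iteratedDeriv k φ x * W x =
      (-1) ^ k * ∫ x in (0:ℝ)..1, φ x * W' x) :
    ∃ g : ℕ → ℝ → ℝ, g k = W' ∧ (∀ j < k, ∀ x, g j x = g j 0 + ∫ s in (0:ℝ)..x, g (j + 1) s) ∧
      g 0 =ᵐ[volume.restrict (Ioc 0 1)] W := by
  induction k generalizing W' with
  | zero =>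
    refine ⟨fun _ => W', rfl, fun j hj => absurd hj (Nat.not_lt_zero j), ?_⟩
    refine ae_eq_of_testI hW' hW fun φ hφ => ?_
    have := h φ hφ
    simp only [iteratedDeriv_zero, pow_zero, one_mul] at this
    exact this.symm
  | succ k ih =>
    obtain ⟨χ, hχ, hχ1⟩ := exists_testI_integral_eq_one
    set Z : ℝ → ℝ := fun x => ∫ s in (0:ℝ)..x, W' s with hZ
    have hZc : ContinuousOn Z (uIcc 0 1) :=
      (hW'.absolutelyContinuousOnInterval_intervalIntegral (c := 0) (by simp)).continuousOn
    have hmW : ∀ φ : ℝ → ℝ, Continuous φ → IntervalIntegrable (fun x => φ x * W x) volume 0 1 :=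
      fun φ hφ => hW.continuousOn_mul hφ.continuousOn
    have hmZ : ∀ φ : ℝ → ℝ, Continuous φ → IntervalIntegrable (fun x => φ x * Z x) volume 0 1 :=
      fun φ hφ => (hφ.continuousOn.mul hZc).intervalIntegrable
    -- The constant of integration for which `c + Z` is the weak derivative of `W` of order `k`; its
    -- value is forced by testing with `χ`.
    set c := (-1) ^ k * (∫ x in (0:ℝ)..1, iteratedDeriv k χ x * W x) -
      ∫ x in (0:ℝ)..1, χ x * Z x with hc
    have hstep : ∀ η, IsTestI η → ∫ x in (0:ℝ)..1, iteratedDeriv k η x * W x =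
        (-1) ^ k * ∫ x in (0:ℝ)..1, η x * (c + Z x) := by
      intro η hη
      set I := ∫ x in (0:ℝ)..1, η x with hI
      -- Subtracting a multiple of `χ` gives mean zero, so this is the derivative of a test
      -- function, to which the hypothesis of order `k + 1` applies.
      have hθ : IsTestI fun x => η x - I * χ x := hη.sub (hχ.const_mul I)
      have hηc := hη.smooth.continuous
      have hχc := hχ.smooth.continuous
      have hθ0 : ∫ x in (0:ℝ)..1, (η x - I * χ x) = 0 := by
        rw [intervalIntegral.integral_sub (hηc.intervalIntegrable _ _)
          ((continuous_const.fun_mul hχc).intervalIntegrable _ _), intervalIntegral.integral_const_mul,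
          hχ1]
        ring
      have hp := hθ.primitive hθ0
      have hpd : deriv (fun x => ∫ s in (0:ℝ)..x, (η s - I * χ s)) = fun x => η x - I * χ x :=
        funext fun x => (intervalIntegral.integral_hasDerivAt_right
          (hθ.smooth.continuous.intervalIntegrable _ _)
          hθ.smooth.continuous.stronglyMeasurable.stronglyMeasurableAtFilter
          hθ.smooth.continuous.continuousAt).deriv
      have h1 := h _ hp
      rw [iteratedDeriv_succ', hpd, hp.integral_deriv_mul hW' 0, hpd] at h1
      have h2 : ∀ x, iteratedDeriv k (fun x => η x - I * χ x) x =
          iteratedDeriv k η x - I * iteratedDeriv k χ x := by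
        intro x
        have e1 := hη.smooth.contDiffAt (x := x) |>.of_le (m := k) (by exact_mod_cast le_top)
        have e2 := hχ.smooth.contDiffAt (x := x) |>.of_le (m := k) (by exact_mod_cast le_top)
        rw [iteratedDeriv_fun_sub e1 (contDiffAt_const.mul e2), iteratedDeriv_const_mul_field]
      simp only [h2, zero_add, sub_mul, mul_assoc] at h1
      have c1 := (hη.iteratedDeriv k).smooth.continuous
      have c2 := (hχ.iteratedDeriv k).smooth.continuous
      rw [intervalIntegral.integral_sub (hmW _ c1) ((hmW _ c2).const_mul I),
        intervalIntegral.integral_const_mul,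
        intervalIntegral.integral_sub (hmZ _ hηc) ((hmZ _ hχc).const_mul I),
        intervalIntegral.integral_const_mul] at h1
      simp only [mul_add]
      rw [intervalIntegral.integral_add ((hηc.fun_mul continuous_const).intervalIntegrable _ _)
        (hmZ _ hηc), intervalIntegral.integral_mul_const, hc]
      have hs : ((-1 : ℝ) ^ k) * (-1) ^ k = 1 := by rw [← mul_pow]; simp
      rw [pow_succ] at h1
      linear_combination h1 - I * (∫ x in (0:ℝ)..1, iteratedDeriv k χ x * W x) * hs
    have hW1 : IntervalIntegrable (fun x => c + Z x) volume 0 1 :=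
      (continuousOn_const.add hZc).intervalIntegrable
    obtain ⟨g, hgk, hg, hg0⟩ := ih hW1 hstep
    refine ⟨Function.update g (k + 1) W', Function.update_self _ _ _, ?_, ?_⟩
    · intro j hj x
      rw [Function.update_of_ne (by omega)]
      rcases eq_or_ne j k with rfl | hjk
      · rw [Function.update_self, hgk]
        simp [hZ]
      · rw [Function.update_of_ne (by omega)]
        exact hg j (by omega) x
    · rwa [Function.update_of_ne (by omega)]

/-- A chain of primitives of an almost continuous function is approximated by smooth ones. -/
theorem exists_derivSeq_near (k : ℕ) {g q : ℕ → ℝ → ℝ} (hq : IsDerivSeq q)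
    (hgi : ∀ j ≤ k, IntervalIntegrable (g j) volume 0 1)
    (hg : ∀ j < k, ∀ x, g j x = g j 0 + ∫ s in (0:ℝ)..x, g (j + 1) s) {ε : ℝ}
    (hε : ∀ᵐ x ∂volume.restrict (Ioc (0:ℝ) 1), |q 0 x - g k x| ≤ ε) :
    ∃ h, IsDerivSeq h ∧ h k = q 0 ∧ ∀ᵐ x ∂volume.restrict (Ioc (0:ℝ) 1), |h 0 x - g 0 x| ≤ ε := by
  induction k generalizing g with
  | zero => exact ⟨q, hq, rfl, hε⟩
  | succ k ih =>
    obtain ⟨h, hh, hhk, hhe⟩ := ih (g := fun j => g (j + 1)) (fun j hj => hgi (j + 1) (by omega))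
      (fun j hj => hg (j + 1) (by omega)) hε
    -- With a common initial value and an interval of length one, integration does not enlarge the
    -- error.
    refine ⟨seqCons (fun x => g 0 0 + ∫ s in (0:ℝ)..x, h 0 s) h, ?_, hhk, ?_⟩
    · intro j x
      cases j with
      | zero =>
        exact (intervalIntegral.integral_hasDerivAt_right ((hh.continuous 0).intervalIntegrable _ _)
          (hh.continuous 0).stronglyMeasurable.stronglyMeasurableAtFilter
          (hh.continuous 0).continuousAt).const_add _
      | succ j => exact hh j x
    · have hε0 : 0 ≤ ε := by
        have : (ae (volume.restrict (Ioc (0:ℝ) 1))).NeBot := by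
          rw [ae_neBot]
          intro h0
          rw [Measure.restrict_eq_zero] at h0
          simp at h0
        obtain ⟨x, hx⟩ := hhe.exists
        exact (abs_nonneg _).trans hx
      rw [ae_restrict_iff' measurableSet_Ioc]
      refine Eventually.of_forall fun x hx => ?_
      have hgx := hg 0 (by omega) x
      simp only [seqCons]
      rw [hgx]
      have hsub : uIcc 0 x ⊆ uIcc (0:ℝ) 1 := uIcc_subset_uIcc (by simp) (by
        rw [uIcc_of_le zero_le_one]; exact ⟨hx.1.le, hx.2⟩)
      rw [add_sub_add_left_eq_sub, ← intervalIntegral.integral_sub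
        ((hh.continuous 0).intervalIntegrable _ _) ((hgi 1 (by omega)).mono_set hsub)]
      have h1 := intervalIntegral.norm_integral_le_of_norm_le_const_ae (a := 0) (b := x) (C := ε)
        (f := fun s => h 0 s - g 1 s) (by
          rw [ae_restrict_iff' measurableSet_Ioc] at hhe
          filter_upwards [hhe] with s hs hm
          rw [uIoc_of_le hx.1.le] at hm
          exact hs ⟨hm.1, hm.2.trans hx.2⟩)
      rw [sub_zero, abs_of_pos hx.1] at h1
      exact h1.trans (mul_le_of_le_one_right hε0 hx.2)

theorem isDerivSeq_polynomial (q : Polynomial ℝ) :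
    IsDerivSeq fun j x => (Polynomial.derivative^[j] q).eval x := by
  intro j x
  simp only [Function.iterate_succ_apply']
  exact Polynomial.hasDerivAt _ x

theorem isDerivSeq_iteratedDeriv {φ : ℝ → ℝ} (h : ContDiff ℝ ∞ φ) :
    IsDerivSeq fun j => iteratedDeriv j φ := by
  intro j x
  simp only [iteratedDeriv_succ]
  exact ((h.differentiable_iteratedDeriv j (by exact_mod_cast ENat.natCast_lt_top j)) x).hasDerivAt

/-- A function in `H^k(0,1)` that is orthogonal to all smooth functions vanishes. -/
theorem ae_eq_zero_of_orthogonal {k : ℕ} (hk : 1 ≤ k) {W W' : ℝ → ℝ}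
    (hW : IntervalIntegrable W volume 0 1) (hW' : IntervalIntegrable W' volume 0 1)
    (h : ∀ φ, IsTestI φ → ∫ x in (0:ℝ)..1, iteratedDeriv k φ x * W x =
      (-1) ^ k * ∫ x in (0:ℝ)..1, φ x * W' x)
    (h0 : ∀ q, IsDerivSeq q → ∫ x in (0:ℝ)..1, (q 0 x * W x + q k x * W' x) = 0) :
    W =ᵐ[volume.restrict (Ioc 0 1)] 0 := by
  have mul : ∀ {φ V : ℝ → ℝ}, Continuous φ → IntervalIntegrable V volume 0 1 →
      IntervalIntegrable (fun x => φ x * V x) volume 0 1 :=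
    fun hφ hV => hV.continuousOn_mul hφ.continuousOn
  -- Orthogonality to test functions is the Euler–Lagrange equation: `W'` has a weak derivative of
  -- order `k`, which is `W` up to sign. So `W'` gains the same regularity as `W`.
  have h2 : ∀ φ, IsTestI φ → ∫ x in (0:ℝ)..1, iteratedDeriv k φ x * W' x =
      (-1) ^ k * ∫ x in (0:ℝ)..1, φ x * ((-1) ^ (k + 1) * W x) := by
    intro φ hφ
    have h1 := h0 _ (isDerivSeq_iteratedDeriv hφ.smooth)
    simp only [iteratedDeriv_zero] at h1
    rw [intervalIntegral.integral_add (mul hφ.smooth.continuous hW)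
      (mul (hφ.iteratedDeriv k).smooth.continuous hW')] at h1
    have e : ∀ x, φ x * ((-1) ^ (k + 1) * W x) = (-1) ^ (k + 1) * (φ x * W x) := fun x => by ring
    simp only [e]
    rw [intervalIntegral.integral_const_mul, ← mul_assoc, ← pow_add,
      Odd.neg_one_pow ⟨k, by ring⟩]
    linarith
  obtain ⟨g, hgk, hg, hg0⟩ := exists_primitives k hW hW' h
  obtain ⟨g', hgk', hg', hg0'⟩ := exists_primitives k hW' (hW.const_mul ((-1) ^ (k + 1))) h2
  have hgint : ∀ r, ∀ j, j + r = k → IntervalIntegrable (g j) volume 0 1 := by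
    intro r
    induction r with
    | zero => intro j hj; rw [show j = k by omega, hgk]; exact hW'
    | succ r ih =>
      intro j hj
      have h1 := (ih (j + 1) (by omega)).absolutelyContinuousOnInterval_intervalIntegral (c := 0)
        (by simp)
      have h3 := (continuousOn_const (c := g j 0)).add h1.continuousOn
      refine (h3.congr fun x _ => hg j (by omega) x).intervalIntegrable
  have hgint' : ∀ r, ∀ j, j + r = k → IntervalIntegrable (g' j) volume 0 1 := by
    intro r
    induction r with
    | zero => intro j hj; rw [show j = k by omega, hgk']; exact hW.const_mul _
    | succ r ih =>
      intro j hj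
      have h1 := (ih (j + 1) (by omega)).absolutelyContinuousOnInterval_intervalIntegral (c := 0)
        (by simp)
      have h3 := (continuousOn_const (c := g' j 0)).add h1.continuousOn
      refine (h3.congr fun x _ => hg' j (by omega) x).intervalIntegrable
  have cont : ∀ f : ℕ → ℝ → ℝ, (∀ x, f 0 x = f 0 0 + ∫ s in (0:ℝ)..x, f 1 s) →
      IntervalIntegrable (f 1) volume 0 1 → ContinuousOn (f 0) (Icc 0 1) := by
    intro f hf hfi
    have h1 := hfi.absolutelyContinuousOnInterval_intervalIntegral (c := 0) (by simp)
    have h3 := (continuousOn_const (c := f 0 0)).add h1.continuousOn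
    rw [uIcc_of_le zero_le_one] at h3
    exact h3.congr fun x _ => hf x
  -- As `k ≥ 1`, both `W` and `W'` agree almost everywhere with primitives of integrable functions,
  -- hence have continuous representatives.
  have hU0 : ContinuousOn (g 0) (Icc 0 1) := cont g (hg 0 hk) (hgint (k - 1) 1 (by omega))
  have hU1 : ContinuousOn (g' 0) (Icc 0 1) := cont g' (hg' 0 hk) (hgint' (k - 1) 1 (by omega))
  have sq : ∀ {f V : ℝ → ℝ}, ContinuousOn f (Icc 0 1) → f =ᵐ[volume.restrict (Ioc 0 1)] V →
      IntervalIntegrable (fun x => V x * V x) volume 0 1 := by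
    intro f V hf hfV
    rw [← uIcc_of_le zero_le_one] at hf
    have h1 := (hf.mul hf).intervalIntegrable (μ := volume)
    rw [intervalIntegrable_iff_integrableOn_Ioc_of_le zero_le_one] at h1 ⊢
    exact Integrable.congr h1 (by filter_upwards [hfV] with x hx; simp [hx])
  have s0 := sq hU0 hg0
  have s1 := sq hU1 hg0'
  set M := ∫ x in (0:ℝ)..1, (|W x| + |W' x|) with hM
  -- A polynomial close to `W'` is integrated `k` times to a smooth function close to `W`.
  -- Subtracting the orthogonality relation for this function leaves only the approximation errors.
  have hle : ∀ ε > 0, ∫ x in (0:ℝ)..1, (W x * W x + W' x * W' x) ≤ ε * M := by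
    intro ε hε
    obtain ⟨q, hq⟩ := exists_polynomial_near_of_continuousOn 0 1 (g' 0) hU1 ε hε
    have hqW : ∀ᵐ x ∂volume.restrict (Ioc (0:ℝ) 1), |q.eval x - W' x| ≤ ε := by
      rw [EventuallyEq, ae_restrict_iff' measurableSet_Ioc] at hg0'
      rw [ae_restrict_iff' measurableSet_Ioc]
      filter_upwards [hg0'] with x hx hm
      rw [← hx hm]
      exact (hq x ⟨hm.1.le, hm.2⟩).le
    obtain ⟨η, hη, hηk, hη0⟩ := exists_derivSeq_near k (isDerivSeq_polynomial q)
      (fun j hj => hgint (k - j) j (by omega)) hg (ε := ε) (by rw [hgk]; exact hqW)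
    have h3 := h0 η hη
    have i0 := mul (hη.continuous 0) hW
    have i1 := mul (hη.continuous k) hW'
    have h4 : ∫ x in (0:ℝ)..1, (W x * W x + W' x * W' x) =
        ∫ x in (0:ℝ)..1, ((W x * W x + W' x * W' x) - (η 0 x * W x + η k x * W' x)) := by
      rw [intervalIntegral.integral_sub (s0.add s1) (i0.add i1), h3, sub_zero]
    rw [h4, hM, ← intervalIntegral.integral_const_mul]
    refine intervalIntegral.integral_mono_ae_restrict zero_le_one ((s0.add s1).sub (i0.add i1))
      ((hW.abs.add hW'.abs).const_mul ε) ?_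
    rw [← restrict_Ioc_eq_restrict_Icc]
    filter_upwards [hqW, hη0, hg0] with x hx1 hx2 hx3
    rw [hx3] at hx2
    have e1 : η k x = q.eval x := by rw [hηk]; rfl
    rw [e1]
    have b1 : (W x - η 0 x) * W x ≤ ε * |W x| := by
      refine (le_abs_self _).trans ?_
      rw [abs_mul, abs_sub_comm]
      gcongr
    have b2 : (W' x - q.eval x) * W' x ≤ ε * |W' x| := by
      refine (le_abs_self _).trans ?_
      rw [abs_mul, abs_sub_comm]
      gcongr
    linarith
  have hz : ∫ x in (0:ℝ)..1, (W x * W x + W' x * W' x) ≤ 0 := by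
    have hM0 : 0 ≤ M := intervalIntegral.integral_nonneg zero_le_one fun x _ => by positivity
    by_contra hcon
    rw [not_le] at hcon
    set J := ∫ x in (0:ℝ)..1, (W x * W x + W' x * W' x)
    have := hle (J / (2 * (M + 1))) (by positivity)
    have h5 : J / (2 * (M + 1)) * M ≤ J / 2 := by
      rw [div_mul_eq_mul_div, div_le_div_iff₀ (by positivity) (by positivity)]
      nlinarith
    linarith
  have hz' : ∫ x in (0:ℝ)..1, (W x * W x + W' x * W' x) = 0 :=
    le_antisymm hz (intervalIntegral.integral_nonneg zero_le_one fun x _ =>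
      add_nonneg (mul_self_nonneg _) (mul_self_nonneg _))
  rw [intervalIntegral.integral_eq_zero_iff_of_le_of_nonneg_ae zero_le_one
    (Eventually.of_forall fun x => add_nonneg (mul_self_nonneg _) (mul_self_nonneg _))
    (s0.add s1)] at hz'
  filter_upwards [hz'] with x hx
  simp only [Pi.zero_apply] at hx ⊢
  nlinarith [mul_self_nonneg (W x), mul_self_nonneg (W' x)]

/-! ### Completeness of the trigonometric system -/

/-- Integration against `w` is a continuous functional on the continuous functions of the circle. It
vanishes on the exponentials, whose span is dense. This argument needs only integrability of `w`,
not square integrability. -/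
theorem ae_eq_zero_of_trig {w : ℝ → ℝ} (hw : IntegrableOn w (Ioc 0 (2 * Real.pi)))
    (hcos : ∀ m : ℕ, ∫ x in (0:ℝ)..(2 * Real.pi), Real.cos (m * x) * w x = 0)
    (hsin : ∀ m : ℕ, ∫ x in (0:ℝ)..(2 * Real.pi), Real.sin (m * x) * w x = 0) :
    w =ᵐ[volume.restrict (Ioc 0 (2 * Real.pi))] 0 := by
  have hpi : 0 < 2 * Real.pi := by positivity
  have : Fact (0 < 2 * Real.pi) := ⟨hpi⟩
  set μ := volume.restrict (Ioc (0:ℝ) (2 * Real.pi)) with hμ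
  have hwc : Integrable (fun x => (w x : ℂ)) μ := Integrable.ofReal hw
  have hcoe : Continuous fun x : ℝ => (x : AddCircle (2 * Real.pi)) := AddCircle.continuous_mk' _
  have hint : ∀ F : C(AddCircle (2 * Real.pi), ℂ), Integrable (fun x : ℝ => F x * (w x : ℂ)) μ := by
    intro F
    exact hwc.bdd_mul (c := ‖F‖) (F.continuous.comp hcoe).aestronglyMeasurable
      (Eventually.of_forall fun x => F.norm_coe_le_norm _)
  let Λ : C(AddCircle (2 * Real.pi), ℂ) →ₗ[ℂ] ℂ :=
    { toFun := fun F => ∫ x : ℝ, F x * (w x : ℂ) ∂μ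
      map_add' := fun F G => by
        rw [← integral_add (hint F) (hint G)]
        exact integral_congr_ae (Eventually.of_forall fun x => by simp [add_mul])
      map_smul' := fun c F => by
        rw [RingHom.id_apply, smul_eq_mul, ← integral_const_mul]
        exact integral_congr_ae (Eventually.of_forall fun x => by simp [mul_assoc]) }
  let Λc : C(AddCircle (2 * Real.pi), ℂ) →L[ℂ] ℂ :=
    Λ.mkContinuous (∫ x, ‖(w x : ℂ)‖ ∂μ) fun F => by
      refine (norm_integral_le_integral_norm _).trans ?_
      rw [← integral_mul_const]
      refine integral_mono_ae (hint F).norm (hwc.norm.mul_const _) (Eventually.of_forall fun x => ?_)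
      simp only
      rw [norm_mul, mul_comm]
      gcongr
      exact F.norm_coe_le_norm _
  have hcosi : ∀ m : ℝ, Integrable (fun x => Real.cos (m * x) * w x) μ := fun m =>
    hw.bdd_mul (c := 1) (by fun_prop) (Eventually.of_forall fun x => Real.abs_cos_le_one _)
  have hsini : ∀ m : ℝ, Integrable (fun x => Real.sin (m * x) * w x) μ := fun m =>
    hw.bdd_mul (c := 1) (by fun_prop) (Eventually.of_forall fun x => Real.abs_sin_le_one _)
  have hcos' : ∀ n : ℤ, ∫ x, Real.cos (n * x) * w x ∂μ = 0 := by
    intro n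
    rcases Int.eq_nat_or_neg n with ⟨m, rfl | rfl⟩
    · have := hcos m
      rw [intervalIntegral.integral_of_le hpi.le] at this
      simpa using this
    · have := hcos m
      rw [intervalIntegral.integral_of_le hpi.le] at this
      simpa using this
  have hsin' : ∀ n : ℤ, ∫ x, Real.sin (n * x) * w x ∂μ = 0 := by
    intro n
    rcases Int.eq_nat_or_neg n with ⟨m, rfl | rfl⟩
    · have := hsin m
      rw [intervalIntegral.integral_of_le hpi.le] at this
      simpa using this
    · have := hsin m
      rw [intervalIntegral.integral_of_le hpi.le] at this
      simpa [integral_neg] using this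
  have hΛf : ∀ n : ℤ, Λc (fourier n) = 0 := by
    intro n
    show ∫ x : ℝ, (fourier n (x : AddCircle (2 * Real.pi)) : ℂ) * (w x : ℂ) ∂μ = 0
    have e : ∀ x : ℝ, (fourier n (x : AddCircle (2 * Real.pi)) : ℂ) * (w x : ℂ) =
        ((Real.cos (n * x) * w x : ℝ) : ℂ) + ((Real.sin (n * x) * w x : ℝ) : ℂ) * Complex.I := by
      intro x
      rw [fourier_coe_apply]
      have : (2 * Real.pi * Complex.I * n * x / (2 * Real.pi : ℝ) : ℂ) =
          ((n * x : ℝ) : ℂ) * Complex.I := by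
        push_cast
        field_simp
      rw [this, Complex.exp_mul_I]
      push_cast
      ring
    simp only [e]
    rw [integral_add (Integrable.ofReal (hcosi n)) ((Integrable.ofReal (hsini n)).mul_const _),
      integral_mul_const, integral_complex_ofReal, integral_complex_ofReal, hcos', hsin']
    simp
  have hΛ : ∀ F, Λc F = 0 := by
    have hker : (Submodule.span ℂ (range (fourier (T := 2 * Real.pi)))).topologicalClosure ≤
        LinearMap.ker Λc.toLinearMap := by
      refine Submodule.topologicalClosure_minimal _ ?_ Λc.isClosed_ker
      rw [Submodule.span_le]
      rintro _ ⟨n, rfl⟩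
      exact hΛf n
    intro F
    rw [span_fourier_closure_eq_top] at hker
    exact hker (Submodule.mem_top : F ∈ ⊤)
  -- A test function supported in the open interval takes equal values at both ends, so it descends
  -- to a continuous function on the circle.
  have hae := isOpen_Ioo.ae_eq_zero_of_integral_contDiff_smul_eq_zero (U := Ioo 0 (2 * Real.pi))
    (f := w) (μ := volume) (hw.mono_set Ioo_subset_Ioc_self).locallyIntegrableOn (by
      intro η hη hc hs
      have h0 : η 0 = 0 := image_eq_zero_of_notMem_tsupport fun hm => by simpa using hs hm
      have h1 : η (2 * Real.pi) = 0 :=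
        image_eq_zero_of_notMem_tsupport fun hm => by simpa using hs hm
      let F : C(AddCircle (2 * Real.pi), ℂ) :=
        ⟨AddCircle.liftIco (2 * Real.pi) 0 fun x => (η x : ℂ),
          AddCircle.liftIco_zero_continuous (by rw [h0, h1])
            (Complex.continuous_ofReal.comp hη.continuous).continuousOn⟩
      have hF := hΛ F
      have e : Λc F = ∫ x, ((η x * w x : ℝ) : ℂ) ∂μ := by
        show ∫ x : ℝ, F x * (w x : ℂ) ∂μ = _
        rw [hμ, ← restrict_Ioo_eq_restrict_Ioc]
        refine setIntegral_congr_fun measurableSet_Ioo fun x hx => ?_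
        have : F x = η x := AddCircle.liftIco_zero_coe_apply (f := fun x => (η x : ℂ)) ⟨hx.1.le, hx.2⟩
        simp only [this]
        push_cast
        rfl
      rw [e, integral_complex_ofReal, Complex.ofReal_eq_zero] at hF
      simp only [smul_eq_mul]
      rw [← setIntegral_eq_integral_of_forall_compl_eq_zero (s := Ioc 0 (2 * Real.pi))]
      · exact hF
      · intro x hx
        rw [image_eq_zero_of_notMem_tsupport fun hm => hx (Ioo_subset_Ioc_self (hs hm)), zero_mul])
  rw [hμ, ← restrict_Ioo_eq_restrict_Ioc, EventuallyEq, ae_restrict_iff' measurableSet_Ioo]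
  exact hae

end

section

variable {d k l : ℕ}

/-! ### Weak derivatives and limits -/

/-- The element `ψ ⊗ v` of `L²`. -/
def tensorL2 {ψ : ℝ × ℝ → ℝ} (h : Continuous ψ) (v : Vec d) : L2 d :=
  (memLp_of_bdd (F := fun p => ψ p • v) (h.smul continuous_const).stronglyMeasurable
    (bdd_smul_test h ⟨‖v‖, fun _ _ => le_rfl⟩) 2).toLp

theorem inner_tensorL2 {ψ : ℝ × ℝ → ℝ} (h : Continuous ψ) (v : Vec d) (f : L2 d) :
    inner ℝ (tensorL2 h v) f = inner ℝ v (∫ p, ψ p • f p ∂cyl) := by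
  rw [← integral_inner (integrable_smul h f), L2.inner_def]
  refine integral_congr_ae ?_
  filter_upwards [MemLp.coeFn_toLp (memLp_of_bdd (F := fun p => ψ p • v)
    (h.smul continuous_const).stronglyMeasurable
    (bdd_smul_test h ⟨‖v‖, fun _ _ => le_rfl⟩) 2)] with p hp
  rw [tensorL2, hp, real_inner_smul_left, real_inner_smul_right]

/-- Each coordinate is the inner product with a fixed element of `L²`. -/
theorem continuous_integral_smul {ψ : ℝ × ℝ → ℝ} (h : Continuous ψ) :
    Continuous fun f : L2 d => ∫ p, ψ p • f p ∂cyl := by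
  have : Continuous fun f : L2 d => WithLp.ofLp (∫ p, ψ p • f p ∂cyl) := by
    refine continuous_pi fun i => ?_
    have e : (fun f : L2 d => (∫ p, ψ p • f p ∂cyl) i) =
        fun f => inner ℝ (tensorL2 h (EuclideanSpace.single i 1)) f := by
      ext f
      rw [inner_tensorL2, EuclideanSpace.inner_single_left]
      simp
    exact e ▸ continuous_const.inner continuous_id
  exact (PiLp.continuous_toLp 2 _).comp this

/-- Every test function imposes a closed condition. This gives completeness of `H^{k,l}` and lets
weak derivatives pass to limits in the density arguments. -/
theorem isClosed_isWeakDeriv (i j : ℕ) :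
    IsClosed {x : L2 d × L2 d | IsWeakDeriv i j x.1 x.2} := by
  have : {x : L2 d × L2 d | IsWeakDeriv i j x.1 x.2} = ⋂ φ, ⋂ (_ : IsTest φ), {x : L2 d × L2 d |
      ∫ p, partialDeriv i j φ p • x.1 p ∂cyl = (-1 : ℝ) ^ (i + j) • ∫ p, φ p • x.2 p ∂cyl} := by
    ext x
    simp [IsWeakDeriv]
  rw [this]
  refine isClosed_iInter fun φ => isClosed_iInter fun (hφ : IsTest φ) =>
    isClosed_eq ?_ ?_
  · exact (continuous_integral_smul (contDiff_partialDeriv i j hφ.smooth).continuous).comp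
      continuous_fst
  · exact ((continuous_integral_smul hφ.smooth.continuous).comp
      (continuous_snd (X := L2 d) (Y := L2 d))).const_smul ((-1 : ℝ) ^ (i + j))

instance : CompleteSpace (MixedSobolev k l d) := by
  refine IsClosed.completeSpace_coe (hs := ?_)
  have hc : ∀ r : Fin 4, Continuous fun u : (PiLp 2 fun _ : Fin 4 => L2 d) =>
      ((u 0, u r) : L2 d × L2 d) :=
    fun r => (PiLp.continuous_apply 2 _ 0).prodMk (PiLp.continuous_apply 2 _ r)
  exact ((isClosed_isWeakDeriv k 0).preimage (hc 1)).inter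
    (((isClosed_isWeakDeriv 0 l).preimage (hc 2)).inter ((isClosed_isWeakDeriv k l).preimage (hc 3)))

theorem MixedSobolev.inner_eq (u v : MixedSobolev k l d) :
    inner ℝ u v = inner ℝ (u.1 0) (v.1 0) + inner ℝ (u.1 1) (v.1 1) + inner ℝ (u.1 2) (v.1 2)
      + inner ℝ (u.1 3) (v.1 3) := by
  rw [Submodule.coe_inner, PiLp.inner_apply, Fin.sum_univ_four]

/-! ### Jets -/

theorem isJet_product {s σ : ℕ → ℝ → ℝ} (hs : IsChain 1 k s) (hσ : IsChain (2 * Real.pi) l σ)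
    (hper : ∀ j < l, σ j 0 = σ j (2 * Real.pi)) (v : Vec d) :
    IsJet k l fun i j p => (s i p.1 * σ j p.2) • v where
  meas i hi j hj := ((((hs.meas i hi).comp_measurable measurable_fst).mul
    ((hσ.meas j hj).comp_measurable measurable_snd))).smul stronglyMeasurable_const
  bdd i hi j hj := by
    obtain ⟨C, hC⟩ := hs.bdd i hi
    obtain ⟨D, hD⟩ := hσ.bdd j hj
    refine ⟨C * D * ‖v‖, fun p hp => ?_⟩
    rw [norm_smul, norm_mul]
    have h1 := hC _ hp.1
    have h2 := hD _ hp.2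
    have := (norm_nonneg _).trans h1
    gcongr
  contT i hi j hj θ hθ := ((hs.cont i hi).mul (continuousOn_const (c := σ j θ))).smul
    continuousOn_const
  derivT i hi j hj θ hθ t ht := ((hs.deriv i hi t ht).mul_const (σ j θ)).smul_const v
  contθ i hi j hj t ht := ((continuousOn_const (c := s i t)).mul (hσ.cont j hj)).smul
    continuousOn_const
  derivθ i hi j hj t ht θ hθ := ((hσ.deriv j hj θ hθ).const_mul (s i t)).smul_const v
  per i hi j hj t ht := by simp only [hper j hj]

theorem IsJet.add {G H : ℕ → ℕ → ℝ × ℝ → Vec d} (hG : IsJet k l G) (hH : IsJet k l H) :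
    IsJet k l fun i j p => G i j p + H i j p where
  meas i hi j hj := (hG.meas i hi j hj).add (hH.meas i hi j hj)
  bdd i hi j hj := by
    obtain ⟨C, hC⟩ := hG.bdd i hi j hj
    obtain ⟨D, hD⟩ := hH.bdd i hi j hj
    exact ⟨C + D, fun p hp => (norm_add_le _ _).trans (add_le_add (hC p hp) (hD p hp))⟩
  contT i hi j hj θ hθ := (hG.contT i hi j hj θ hθ).add (hH.contT i hi j hj θ hθ)
  derivT i hi j hj θ hθ t ht := (hG.derivT i hi j hj θ hθ t ht).add (hH.derivT i hi j hj θ hθ t ht)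
  contθ i hi j hj t ht := (hG.contθ i hi j hj t ht).add (hH.contθ i hi j hj t ht)
  derivθ i hi j hj t ht θ hθ := (hG.derivθ i hi j hj t ht θ hθ).add (hH.derivθ i hi j hj t ht θ hθ)
  per i hi j hj t ht := by simp only [hG.per i hi j hj t ht, hH.per i hi j hj t ht]

theorem IsJet.const_smul {G : ℕ → ℕ → ℝ × ℝ → Vec d} (hG : IsJet k l G) (r : ℝ) :
    IsJet k l fun i j p => r • G i j p where
  meas i hi j hj := (hG.meas i hi j hj).const_smul r
  bdd i hi j hj := by
    obtain ⟨C, hC⟩ := hG.bdd i hi j hj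
    refine ⟨‖r‖ * C, fun p hp => ?_⟩
    rw [norm_smul]
    exact mul_le_mul_of_nonneg_left (hC p hp) (norm_nonneg _)
  contT i hi j hj θ hθ := (hG.contT i hi j hj θ hθ).const_smul r
  derivT i hi j hj θ hθ t ht := (hG.derivT i hi j hj θ hθ t ht).const_smul r
  contθ i hi j hj t ht := (hG.contθ i hi j hj t ht).const_smul r
  derivθ i hi j hj t ht θ hθ := (hG.derivθ i hi j hj t ht θ hθ).const_smul r
  per i hi j hj t ht := by simp only [hG.per i hi j hj t ht]

theorem IsJet.sub {G H : ℕ → ℕ → ℝ × ℝ → Vec d} (hG : IsJet k l G) (hH : IsJet k l H) :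
    IsJet k l fun i j p => G i j p - H i j p := by
  have := hG.add (hH.const_smul (-1))
  simpa only [neg_smul, one_smul, ← sub_eq_add_neg] using this

theorem isJet_zero : IsJet k l fun _ _ _ => (0 : Vec d) where
  meas _ _ _ _ := stronglyMeasurable_const
  bdd _ _ _ _ := ⟨0, fun _ _ => by simp⟩
  contT _ _ _ _ _ _ := continuousOn_const
  derivT _ _ _ _ _ _ _ _ := hasDerivWithinAt_const _ _ _
  contθ _ _ _ _ _ _ := continuousOn_const
  derivθ _ _ _ _ _ _ _ _ := hasDerivWithinAt_const _ _ _
  per _ _ _ _ _ _ := rfl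

/-- The elements of `H^{k,l}` that have a jet whose `(0,1)` component is continuous and
periodic. -/
def regularSpace (k l d : ℕ) : Submodule ℝ (MixedSobolev k l d) where
  carrier := {u | ∃ G : ℕ → ℕ → ℝ × ℝ → Vec d, IsJet k l G ∧ MixedSobolev.fn u =ᵐ[cyl] G 0 0 ∧
    Continuous (G 0 1) ∧ ∀ t θ, G 0 1 (t, θ + 2 * Real.pi) = G 0 1 (t, θ)}
  add_mem' := by
    rintro u v ⟨G, hG, hu, hc, hp⟩ ⟨H, hH, hv, hc', hp'⟩
    refine ⟨_, hG.add hH, ?_, hc.add hc', fun t θ => by simp only [hp, hp']⟩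
    rw [map_add]
    filter_upwards [hu, hv, Lp.coeFn_add (MixedSobolev.fn u) (MixedSobolev.fn v)] with p h1 h2 h3
    rw [h3, Pi.add_apply, h1, h2]
  zero_mem' := by
    refine ⟨_, isJet_zero, ?_, continuous_const, fun t θ => rfl⟩
    rw [map_zero]
    exact Lp.coeFn_zero _ _ _
  smul_mem' := by
    rintro r u ⟨G, hG, hu, hc, hp⟩
    refine ⟨_, hG.const_smul r, ?_, hc.const_smul r, fun t θ => by simp only [hp]⟩
    rw [map_smul]
    filter_upwards [hu, Lp.coeFn_smul r (MixedSobolev.fn u)] with p h1 h2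
    rw [h2, Pi.smul_apply, h1]

/-! ### Trigonometric functions -/

/-- The `j`-th derivative of `cos (m x + a)`. -/
def trig (m : ℕ) (a : ℝ) (j : ℕ) (x : ℝ) : ℝ := m ^ j * Real.cos (m * x + (a + j * (Real.pi / 2)))

theorem isDerivSeq_trig (m : ℕ) (a : ℝ) : IsDerivSeq (trig m a) := by
  intro j x
  have h : HasDerivAt (fun x : ℝ => m * x + (a + j * (Real.pi / 2))) m x := by
    simpa using ((hasDerivAt_id x).const_mul (m:ℝ)).add_const (a + j * (Real.pi / 2))
  refine (h.cos.const_mul ((m:ℝ) ^ j)).congr_deriv ?_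
  rw [trig, show (m:ℝ) * x + (a + (j + 1 : ℕ) * (Real.pi / 2)) =
    (m * x + (a + j * (Real.pi / 2))) + Real.pi / 2 by push_cast; ring, Real.cos_add_pi_div_two]
  ring

theorem trig_periodic (m : ℕ) (a : ℝ) (j : ℕ) (x : ℝ) :
    trig m a j (x + 2 * Real.pi) = trig m a j x := by
  rw [trig, trig, show (m:ℝ) * (x + 2 * Real.pi) + (a + j * (Real.pi / 2)) =
    (m * x + (a + j * (Real.pi / 2))) + m * (2 * Real.pi) by ring, Real.cos_add_nat_mul_two_pi]

/-- Carrying an arbitrary phase treats sine and cosine together: differentiation only shifts the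
phase and multiplies by `m`. -/
theorem trig_eq (m : ℕ) (a : ℝ) (j : ℕ) (x : ℝ) :
    trig m a j x = m ^ j * trig m (a + j * (Real.pi / 2)) 0 x := by
  simp [trig]

theorem trig_add_pi (m : ℕ) (a : ℝ) (l : ℕ) (x : ℝ) :
    trig m (a + l * (Real.pi / 2) + l * (Real.pi / 2)) 0 x = (-1) ^ l * trig m a 0 x := by
  have : (m:ℝ) * x + (a + l * (Real.pi / 2) + l * (Real.pi / 2) + (0 : ℕ) * (Real.pi / 2)) =
      (m * x + a) + l * Real.pi := by push_cast; ring
  simp only [trig, this, Real.cos_add_nat_mul_pi]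
  simp

theorem continuous_trig (m : ℕ) (a : ℝ) (j : ℕ) : Continuous (trig m a j) :=
  (isDerivSeq_trig m a).continuous j

theorem contDiff_trig (m : ℕ) (a : ℝ) (j : ℕ) : ContDiff ℝ ∞ (trig m a j) :=
  contDiff_const.mul (Real.contDiff_cos.comp ((contDiff_const.mul contDiff_id).add contDiff_const))

/-! ### Test functions of product form -/

theorem IsTestI.isTest {φ : ℝ → ℝ} (hφ : IsTestI φ) (m : ℕ) (a : ℝ) (j : ℕ) :
    IsTest fun p => φ p.1 * trig m a j p.2 where
  smooth := (hφ.smooth.comp contDiff_fst).mul ((contDiff_trig m a j).comp contDiff_snd)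
  periodic t θ := by simp only [trig_periodic]
  support := by
    obtain ⟨x, y, h0, _, h1, h⟩ := hφ.support
    refine ⟨Icc x y, isCompact_Icc, fun t ht => ⟨h0.trans_le ht.1, ht.2.trans_lt h1⟩, fun p hp => ?_⟩
    rw [h _ hp, zero_mul]

theorem partialDeriv_mul_trig {φ : ℝ → ℝ} (hφ : IsTestI φ) (m : ℕ) (a : ℝ) (i j : ℕ) :
    partialDeriv i j (fun p => φ p.1 * trig m a 0 p.2) =
      fun p => iteratedDeriv i φ p.1 * trig m a j p.2 := by
  have hθ : ∀ j, dθ^[j] (fun p : ℝ × ℝ => φ p.1 * trig m a 0 p.2) =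
      fun p => φ p.1 * trig m a j p.2 := by
    intro j
    induction j with
    | zero => rfl
    | succ j ih =>
      rw [Function.iterate_succ_apply', ih]
      ext ⟨t, θ⟩
      exact (hasDerivAt_dθ (hφ.isTest m a j).smooth t θ).unique
        ((isDerivSeq_trig m a j θ).const_mul (φ t))
  unfold partialDeriv
  rw [hθ]
  induction i with
  | zero => simp
  | succ i ih =>
    rw [Function.iterate_succ_apply', ih]
    ext ⟨t, θ⟩
    refine (hasDerivAt_dt ((hφ.iteratedDeriv i).isTest m a j).smooth t θ).unique ?_
    exact (isDerivSeq_iteratedDeriv hφ.smooth i t).mul_const (trig m a j θ)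

end

/-! ### Fourier coefficients of slices and density of trigonometric products -/

section

variable {d k l : ℕ}

/-- The Fourier coefficients `∫ cos (m θ + a) ⟪v, f (t, θ)⟫ dθ` of the slices of `f`. -/
def fourierCoeff (f : L2 d) (v : Vec d) (m : ℕ) (a : ℝ) (t : ℝ) : ℝ :=
  ∫ θ in (0:ℝ)..(2 * Real.pi), trig m a 0 θ * inner ℝ v (f (t, θ))

theorem integrable_mul_inner {ψ : ℝ × ℝ → ℝ} (h : Continuous ψ) (f : L2 d) (v : Vec d) :
    Integrable (fun p => ψ p * inner ℝ v (f p)) cyl := by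
  have := (integrable_smul h f).const_inner (𝕜 := ℝ) v
  simpa only [real_inner_smul_right] using this

theorem continuous_mul_trig {φ : ℝ → ℝ} (hφ : Continuous φ) (m : ℕ) (a : ℝ) (j : ℕ) :
    Continuous fun p : ℝ × ℝ => φ p.1 * trig m a j p.2 :=
  (hφ.comp continuous_fst).mul ((continuous_trig m a j).comp continuous_snd)

theorem intervalIntegrable_mul_fourierCoeff {φ : ℝ → ℝ} (hφ : Continuous φ) (f : L2 d) (v : Vec d)
    (m : ℕ) (a : ℝ) : IntervalIntegrable (fun t => φ t * fourierCoeff f v m a t) volume 0 1 := by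
  have := intervalIntegrable_slice_t (integrable_mul_inner (continuous_mul_trig hφ m a 0) f v)
  simpa only [fourierCoeff, mul_assoc, intervalIntegral.integral_const_mul] using this

theorem intervalIntegrable_fourierCoeff (f : L2 d) (v : Vec d) (m : ℕ) (a : ℝ) :
    IntervalIntegrable (fourierCoeff f v m a) volume 0 1 := by
  simpa using intervalIntegrable_mul_fourierCoeff (continuous_const (y := (1:ℝ))) f v m a

theorem inner_integral_mul_trig {φ : ℝ → ℝ} (hφ : Continuous φ) (f : L2 d) (v : Vec d)
    (m : ℕ) (a : ℝ) (j : ℕ) :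
    inner ℝ v (∫ p, (φ p.1 * trig m a j p.2) • f p ∂cyl) =
      m ^ j * ∫ t in (0:ℝ)..1, φ t * fourierCoeff f v m (a + j * (Real.pi / 2)) t := by
  have hc := continuous_mul_trig hφ m a j
  rw [← integral_inner (integrable_smul hc f)]
  simp only [real_inner_smul_right]
  rw [integral_cyl_tθ (integrable_mul_inner hc f v), ← intervalIntegral.integral_const_mul]
  congr 1
  ext t
  simp only [trig_eq m a j, fourierCoeff, ← intervalIntegral.integral_const_mul]
  congr 1
  ext θ
  ring

/-- Testing with `φ(t) cos(mθ + a)` turns the `θ`-derivatives into a factor and a phase shift, so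
that only a weak derivative in `t` of the Fourier coefficients remains. -/
theorem IsWeakDeriv.integral_fourierCoeff {i j : ℕ} {f g : L2 d} (h : IsWeakDeriv i j f g) (v : Vec d)
    (m : ℕ) (a : ℝ) {φ : ℝ → ℝ} (hφ : IsTestI φ) :
    m ^ j * ∫ t in (0:ℝ)..1, iteratedDeriv i φ t * fourierCoeff f v m (a + j * (Real.pi / 2)) t =
      (-1) ^ (i + j) * ∫ t in (0:ℝ)..1, φ t * fourierCoeff g v m a t := by
  have := congrArg (fun x => inner ℝ v x) (h _ (hφ.isTest m a 0))
  simp only [partialDeriv_mul_trig hφ, real_inner_smul_right] at this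
  rw [inner_integral_mul_trig (hφ.iteratedDeriv i).smooth.continuous,
    inner_integral_mul_trig hφ.smooth.continuous] at this
  simpa using this

/-- The element `(h ⊗ trig m a) • v` of `H^{k,l}`. -/
theorem isJet_trig {h : ℕ → ℝ → ℝ} (hh : IsDerivSeq h) (m : ℕ) (a : ℝ) (v : Vec d) :
    IsJet k l fun i j p => (h i p.1 * trig m a j p.2) • v :=
  isJet_product (hh.isChain 1 k) ((isDerivSeq_trig m a).isChain _ l)
    (fun j _ => by simpa using (trig_periodic m a j 0).symm) v

theorem inner_trig {h : ℕ → ℝ → ℝ} (hh : IsDerivSeq h) (m : ℕ) (a : ℝ) (v : Vec d) {i j : ℕ}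
    {g : L2 d} (hg : g =ᵐ[cyl] fun p => (h i p.1 * trig m a j p.2) • v) (f : L2 d) :
    inner ℝ g f = m ^ j * ∫ t in (0:ℝ)..1, h i t * fourierCoeff f v m (a + j * (Real.pi / 2)) t := by
  rw [← inner_integral_mul_trig (hh.continuous i),
    ← inner_tensorL2 (continuous_mul_trig (hh.continuous i) m a j)]
  congr 1
  exact Lp.ext (hg.trans (MemLp.coeFn_toLp _).symm)

/-- Reduction to one variable. For a fixed frequency the inner product of `H^{k,l}` with `q ⊗ trig m
a` is `1 + m^{2l}` times that of `H^k(0,1)` between `q` and the Fourier coefficient, so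
`ae_eq_zero_of_orthogonal` applies. -/
theorem fourierCoeff_eq_zero_of_orthogonal (hk : 1 ≤ k) {u : MixedSobolev k l d} (v : Vec d)
    (m : ℕ) (a : ℝ)
    (h : ∀ q, IsDerivSeq q → ∀ w : MixedSobolev k l d,
      MixedSobolev.fn w =ᵐ[cyl] (fun p => (q 0 p.1 * trig m a 0 p.2) • v) → inner ℝ w u = 0) :
    fourierCoeff (MixedSobolev.fn u) v m a =ᵐ[volume.restrict (Ioc 0 1)] 0 := by
  change fourierCoeff (u.1 0) v m a =ᵐ[_] 0
  obtain ⟨h1, h2, h3⟩ := u.2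
  have W (r : Fin 4) (b : ℝ) := intervalIntegrable_fourierCoeff (u.1 r) v m b
  have R1 : ∀ b φ, IsTestI φ → ∫ t in (0:ℝ)..1, iteratedDeriv k φ t * fourierCoeff (u.1 0) v m b t =
      (-1) ^ k * ∫ t in (0:ℝ)..1, φ t * fourierCoeff (u.1 1) v m b t := by
    intro b φ hφ
    simpa using h1.integral_fourierCoeff v m b hφ
  have per : ∀ f : L2 d, fourierCoeff f v m (a + l * (Real.pi / 2) + l * (Real.pi / 2)) =
      fun t => (-1) ^ l * fourierCoeff f v m a t := by
    intro f
    ext t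
    simp only [fourierCoeff, ← intervalIntegral.integral_const_mul, trig_add_pi, mul_assoc]
  -- The test is made with the phase already shifted by `l π/2`. The second such shift completes `l
  -- π`, whose sign cancels the sign of the weak derivative.
  have R2 : fourierCoeff (u.1 2) v m (a + l * (Real.pi / 2)) =ᵐ[volume.restrict (Ioc 0 1)]
      fun t => m ^ l * fourierCoeff (u.1 0) v m a t := by
    refine ae_eq_of_testI (W 2 _) ((W 0 a).const_mul _) fun φ hφ => ?_
    have := h2.integral_fourierCoeff v m (a + l * (Real.pi / 2)) hφ
    simp only [per, iteratedDeriv_zero, zero_add, mul_left_comm _ ((-1:ℝ) ^ l),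
      intervalIntegral.integral_const_mul] at this
    simp only [mul_left_comm _ ((m:ℝ) ^ l), intervalIntegral.integral_const_mul]
    exact (mul_left_cancel₀ (pow_ne_zero l (by norm_num : (-1:ℝ) ≠ 0)) this).symm
  have R3 : fourierCoeff (u.1 3) v m (a + l * (Real.pi / 2)) =ᵐ[volume.restrict (Ioc 0 1)]
      fun t => m ^ l * fourierCoeff (u.1 1) v m a t := by
    refine ae_eq_of_testI (W 3 _) ((W 1 a).const_mul _) fun φ hφ => ?_
    have := h3.integral_fourierCoeff v m (a + l * (Real.pi / 2)) hφ
    simp only [per, mul_left_comm _ ((-1:ℝ) ^ l), intervalIntegral.integral_const_mul] at this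
    rw [R1 a φ hφ, pow_add] at this
    simp only [mul_left_comm _ ((m:ℝ) ^ l), intervalIntegral.integral_const_mul]
    refine mul_left_cancel₀ (pow_ne_zero l (by norm_num : (-1:ℝ) ≠ 0)) ?_
    refine mul_left_cancel₀ (pow_ne_zero k (by norm_num : (-1:ℝ) ≠ 0)) ?_
    linear_combination -this
  refine ae_eq_zero_of_orthogonal hk (W 0 a) (W 1 a) (fun φ hφ => R1 a φ hφ) fun q hq => ?_
  have hG := isJet_trig (k := k) (l := l) hq m a v
  obtain ⟨w, hw⟩ := hG.exists_sobolev
  obtain ⟨w1, w2, w3⟩ := w.2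
  have key := h q hq w hw
  rw [MixedSobolev.inner_eq, inner_trig hq m a v (g := w.1 0) hw,
    inner_trig hq m a v (hG.ae_eq_of_isWeakDeriv le_rfl (Nat.zero_le l) hw w1),
    inner_trig hq m a v (hG.ae_eq_of_isWeakDeriv (Nat.zero_le k) le_rfl hw w2),
    inner_trig hq m a v (hG.ae_eq_of_isWeakDeriv le_rfl le_rfl hw w3)] at key
  have c (i : ℕ) (r : Fin 4) : IntervalIntegrable (fun t => q i t * fourierCoeff (u.1 r) v m a t)
      volume 0 1 := intervalIntegrable_mul_fourierCoeff (hq.continuous i) _ _ _ _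
  have e (i : ℕ) (r s : Fin 4) (hr : fourierCoeff (u.1 r) v m (a + l * (Real.pi / 2))
      =ᵐ[volume.restrict (Ioc 0 1)] fun t => m ^ l * fourierCoeff (u.1 s) v m a t) :
      ∫ t in (0:ℝ)..1, q i t * fourierCoeff (u.1 r) v m (a + l * (Real.pi / 2)) t =
        m ^ l * ∫ t in (0:ℝ)..1, q i t * fourierCoeff (u.1 s) v m a t := by
    rw [← intervalIntegral.integral_const_mul, intervalIntegral.integral_of_le zero_le_one,
      intervalIntegral.integral_of_le zero_le_one]
    refine integral_congr_ae ?_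
    filter_upwards [hr] with t ht
    rw [ht]
    ring
  rw [e 0 2 0 R2, e k 3 1 R3] at key
  simp only [Nat.cast_zero, zero_mul, add_zero, pow_zero, one_mul] at key
  rw [intervalIntegral.integral_add (c 0 0) (c k 1)]
  have hm : 0 < 1 + (m:ℝ) ^ l * m ^ l := by positivity
  refine (mul_eq_zero.1 ?_).resolve_left hm.ne'
  linear_combination key

theorem ae_cyl_eq_zero_of_slices {F : ℝ × ℝ → ℝ} (hF : Measurable F) (hI : Integrable F cyl)
    (h : ∀ (m : ℕ) (a : ℝ), (fun t => ∫ θ in (0:ℝ)..(2 * Real.pi), trig m a 0 θ * F (t, θ))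
      =ᵐ[volume.restrict (Ioc 0 1)] 0) : F =ᵐ[cyl] 0 := by
  rw [cyl_eq_prod] at hI ⊢
  have hmeas : MeasurableSet {p : ℝ × ℝ | F p = 0} := measurableSet_eq_fun hF measurable_const
  refine (Measure.ae_prod_iff_ae_ae hmeas).2 ?_
  -- The phases `0` and `-π/2` give cosine and sine. These are countably many conditions, so a
  -- single null set of times suffices before the slice is treated.
  filter_upwards [ae_all_iff.2 fun m => h m 0, ae_all_iff.2 fun m => h m (-(Real.pi / 2)),
    hI.prod_right_ae] with t hc hs hIt
  refine ae_eq_zero_of_trig hIt (fun m => ?_) fun m => ?_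
  · simpa [trig] using hc m
  · have := hs m
    simp only [trig, pow_zero, one_mul, Nat.cast_zero, zero_mul, add_zero, Pi.zero_apply,
      ← sub_eq_add_neg, Real.cos_sub_pi_div_two] at this
    exact this

theorem Lp_eq_zero_of_fourierCoeff {f : L2 d}
    (h : ∀ v m a, fourierCoeff f v m a =ᵐ[volume.restrict (Ioc 0 1)] 0) : f = 0 := by
  have hcomp : ∀ i : Fin d, ∀ᵐ p ∂cyl, f p i = 0 := by
    intro i
    set v : Vec d := EuclideanSpace.single i 1
    have hv : ∀ p, inner ℝ v (f p) = f p i := fun p => by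
      simp [v, EuclideanSpace.inner_single_left]
    have hI : Integrable (fun p => inner ℝ v (f p)) cyl := by
      simpa using integrable_mul_inner (continuous_const (y := (1:ℝ))) f v
    filter_upwards [ae_cyl_eq_zero_of_slices
      ((continuous_const.inner continuous_id).comp_stronglyMeasurable
        (Lp.stronglyMeasurable f)).measurable hI (h v)] with p hp
    rw [← hv]
    exact hp
  refine Lp.ext ?_
  filter_upwards [ae_all_iff.2 hcomp, Lp.coeFn_zero (Vec d) 2 cyl] with p hp h0
  rw [h0]
  ext i
  exact hp i

/-- The products `(q ⊗ trig m a) • v`. -/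
def trigProducts (k l d : ℕ) : Set (MixedSobolev k l d) :=
  {w | ∃ q : ℕ → ℝ → ℝ, IsDerivSeq q ∧ ∃ m a v,
    MixedSobolev.fn w =ᵐ[cyl] fun p => (q 0 p.1 * trig m a 0 p.2) • v}

/-- The span of the products of smooth functions of `t` and trigonometric functions of `θ` is
dense in `H^{k,l}`. -/
theorem topologicalClosure_trigProducts (hk : 1 ≤ k) :
    (Submodule.span ℝ (trigProducts k l d)).topologicalClosure = ⊤ := by
  rw [Submodule.topologicalClosure_eq_top_iff, Submodule.eq_bot_iff]
  intro u hu
  apply MixedSobolev.fn_injective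
  rw [map_zero]
  refine Lp_eq_zero_of_fourierCoeff fun v m a =>
    fourierCoeff_eq_zero_of_orthogonal hk v m a fun q hq w hw => ?_
  exact (Submodule.mem_orthogonal _ u).1 hu w (Submodule.subset_span ⟨q, hq, m, a, v, hw⟩)

theorem trigProducts_subset_regularSpace :
    trigProducts k l d ⊆ regularSpace k l d := by
  rintro w ⟨q, hq, m, a, v, hw⟩
  refine ⟨_, isJet_trig hq m a v, hw, ?_, fun t θ => ?_⟩
  · exact (continuous_mul_trig (hq.continuous 0) m a 1).smul continuous_const
  · simp only [trig_periodic]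

theorem dense_regularSpace (hk : 1 ≤ k) : Dense (regularSpace k l d : Set (MixedSobolev k l d)) := by
  rw [Submodule.dense_iff_topologicalClosure_eq_top, eq_top_iff,
    ← topologicalClosure_trigProducts hk]
  exact Submodule.topologicalClosure_mono (Submodule.span_le.2 trigProducts_subset_regularSpace)

end

section

variable {d k l : ℕ}

/-! ### Convergence of the spline projections -/

theorem IsDerivSeq.exists_bound {g : ℕ → ℝ → ℝ} (hg : IsDerivSeq g) (n : ℕ) (L : ℝ) :
    ∃ C, 0 ≤ C ∧ ∀ j ≤ n, ∀ x ∈ Icc 0 L, |g j x| ≤ C := by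
  have (j : ℕ) : ∃ C, 0 ≤ C ∧ ∀ x ∈ Icc 0 L, |g j x| ≤ C := by
    obtain ⟨C, hC⟩ := isCompact_Icc.exists_bound_of_continuousOn (hg.continuous j).continuousOn
    exact ⟨max C 0, le_max_right _ _, fun x hx => (hC x hx).trans (le_max_left _ _)⟩
  choose C h0 hC using this
  refine ⟨∑ j ∈ Finset.range (n + 1), C j, Finset.sum_nonneg fun j _ => h0 j, fun j hj x hx => ?_⟩
  exact (hC j x hx).trans (Finset.single_le_sum (f := C) (fun j _ => h0 j)
    (Finset.mem_range.2 (by omega)))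

theorem product_mem_splineSpace {nt nθ Nt Nθ : ℕ} {s σ : ℝ → ℝ} (hs : IsSplineT nt Nt s)
    (hσ : IsSplineθ nθ Nθ σ) (v : Vec d) {z : MixedSobolev k l d}
    (hz : MixedSobolev.fn z =ᵐ[cyl] fun p => (s p.1 * σ p.2) • v) :
    z ∈ splineSpace k l nt nθ Nt Nθ d := by
  obtain ⟨α, hα⟩ := hs
  obtain ⟨β, hβ⟩ := hσ
  rw [mem_splineSpace]
  refine ⟨fun i j => (α i * β j) • v, ?_⟩
  have hmem : ∀ᵐ p ∂cyl, p ∈ Ioo (0:ℝ) 1 ×ˢ Ioo 0 (2 * Real.pi) :=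
    ae_cyl.2 (Eventually.of_forall fun p hp => hp)
  filter_upwards [hz, hmem] with p hp hpm
  rw [hp, hα _ ⟨hpm.1.1.le, hpm.1.2⟩, hβ _ ⟨hpm.2.1.le, hpm.2.2⟩, Finset.sum_range,
    Finset.sum_range, Finset.sum_mul_sum, Finset.sum_smul, spline]
  refine Finset.sum_congr rfl fun i _ => ?_
  rw [Finset.sum_smul]
  refine Finset.sum_congr rfl fun j _ => ?_
  rw [smul_smul]
  congr 1
  ring

theorem sqCyl_le {F : ℝ × ℝ → Vec d} {C : ℝ} (h : ∀ᵐ p ∂cyl, ‖F p‖ ≤ C) :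
    sqCyl F ≤ C ^ 2 * cyl.real univ := by
  have := norm_integral_le_of_norm_le_const (μ := cyl) (f := fun p => ‖F p‖ ^ 2) (C := C ^ 2) (by
    filter_upwards [h] with p hp
    rw [norm_pow, norm_norm]
    gcongr)
  exact (le_abs_self _).trans this

theorem norm_sub_starProjection_le {V : Type*} [NormedAddCommGroup V] [InnerProductSpace ℝ V]
    (S : Submodule ℝ V) [S.HasOrthogonalProjection] (y : V) {z : V} (hz : z ∈ S) :
    ‖y - S.starProjection y‖ ≤ ‖y - z‖ := by
  rw [Submodule.starProjection_minimal]
  exact ciInf_le (f := fun x : S => ‖y - x‖) ⟨0, by rintro _ ⟨x, rfl⟩; exact norm_nonneg _⟩ ⟨z, hz⟩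

/-- The product of the one-variable spline approximations is uniformly close in all the derivatives
that enter the norm. The conditions on `k` and `l` ensure that these derivatives are controlled. -/
theorem exists_spline_near_product {nt nθ : ℕ} (hk : k ≤ nt) (hl : l ≤ nθ) {w : MixedSobolev k l d}
    (hw : w ∈ trigProducts k l d) {δ : ℝ} (hδ : 0 < δ) :
    ∃ N₀, ∀ Nt ≥ N₀, ∀ Nθ ≥ N₀, ∃ z ∈ splineSpace k l nt nθ Nt Nθ d, ‖w - z‖ ≤ δ := by
  obtain ⟨q, hq, m, a, v, hw⟩ := hw
  have hpi : 0 < 2 * Real.pi := by positivity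
  obtain ⟨A, hA0, hA⟩ := hq.exists_bound nt 1
  obtain ⟨B, hB0, hB⟩ := (isDerivSeq_trig m a).exists_bound nθ (2 * Real.pi)
  -- If each of the four components of the norm is at most `η` pointwise, then the squared norm is
  -- at most `η² M`, hence at most `δ²`. Requiring `ε ≤ 1` makes the product of the two errors
  -- linear in `ε`.
  set M := 4 * cyl.real univ with hM
  have hM0 : 0 ≤ M := by positivity
  set η := δ / (M + 1)
  have hη : 0 < η := by positivity
  set D := (A + B + 1) * (‖v‖ + 1)
  have hD : 0 < D := by positivity
  set ε := min 1 (η / D)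
  have hε : 0 < ε := by positivity
  have hε1 : ε ≤ 1 := min_le_left _ _
  have hεD : ε * D ≤ η := (le_div_iff₀ hD).1 (min_le_right _ _)
  obtain ⟨N₁, h1⟩ := exists_splineT nt hq hε
  obtain ⟨N₂, h2⟩ := exists_splineθ nθ (isDerivSeq_trig m a)
    (fun j => by simpa using (trig_periodic m a j 0).symm) hε
  refine ⟨max N₁ N₂, fun Nt hNt Nθ hNθ => ?_⟩
  obtain ⟨-, s, hs, -, hsp, hsb⟩ := h1 Nt ((le_max_left _ _).trans hNt)
  obtain ⟨-, σ, hσ, -, hσp, -, hσper, hσb⟩ := h2 Nθ ((le_max_right _ _).trans hNθ)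
  have hS : IsJet k l fun i j p => (s i p.1 * σ j p.2) • v :=
    isJet_product (hs.mono hk) (hσ.mono hl) (fun j hj => hσper j (by omega)) v
  obtain ⟨z, hz⟩ := hS.exists_sobolev
  refine ⟨z, product_mem_splineSpace hsp hσp v hz, ?_⟩
  have hJ := (isJet_trig (k := k) (l := l) hq m a v).sub hS
  have hwz : MixedSobolev.fn (w - z) =ᵐ[cyl] fun p =>
      (q 0 p.1 * trig m a 0 p.2) • v - (s 0 p.1 * σ 0 p.2) • v := by
    rw [map_sub]
    filter_upwards [hw, hz, Lp.coeFn_sub (MixedSobolev.fn w) (MixedSobolev.fn z)] with p h1 h2 h3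
    rw [h3, Pi.sub_apply, h1, h2]
  have hmem : ∀ᵐ p ∂cyl, p ∈ Ioo (0:ℝ) 1 ×ˢ Ioo 0 (2 * Real.pi) :=
    ae_cyl.2 (Eventually.of_forall fun p hp => hp)
  have key : ∀ i ≤ k, ∀ j ≤ l, sqCyl (fun p =>
      (q i p.1 * trig m a j p.2) • v - (s i p.1 * σ j p.2) • v) ≤ η ^ 2 * cyl.real univ := by
    intro i hi j hj
    refine sqCyl_le ?_
    filter_upwards [hmem] with p hp
    have a1 := hA i (hi.trans hk) p.1 ⟨hp.1.1.le, hp.1.2.le⟩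
    have a2 := hB j (hj.trans hl) p.2 ⟨hp.2.1.le, hp.2.2.le⟩
    have a3 := hsb i (hi.trans hk) p.1 ⟨hp.1.1.le, hp.1.2⟩
    have a4 := hσb j (hj.trans hl) p.2 ⟨hp.2.1.le, hp.2.2⟩
    rw [← sub_smul, norm_smul, Real.norm_eq_abs]
    have e : q i p.1 * trig m a j p.2 - s i p.1 * σ j p.2 =
        -(s i p.1 - q i p.1) * trig m a j p.2 - q i p.1 * (σ j p.2 - trig m a j p.2)
          - (s i p.1 - q i p.1) * (σ j p.2 - trig m a j p.2) := by ring
    have b : |q i p.1 * trig m a j p.2 - s i p.1 * σ j p.2| ≤ ε * B + A * ε + ε * 1 := by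
      rw [e]
      refine (abs_sub _ _).trans (add_le_add ((abs_sub _ _).trans (add_le_add ?_ ?_)) ?_)
      · rw [abs_mul, abs_neg]
        gcongr
      · rw [abs_mul]
        gcongr
      · rw [abs_mul]
        gcongr
        exact a4.trans hε1
    calc _ ≤ (ε * B + A * ε + ε * 1) * (‖v‖ + 1) := by
          gcongr
          linarith
      _ = ε * D := by simp only [D]; ring
      _ ≤ η := hεD
  have hsq : ‖w - z‖ ^ 2 ≤ δ ^ 2 := by
    rw [hJ.norm_sq_eq hwz]
    have k1 := key 0 (Nat.zero_le k) 0 (Nat.zero_le l)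
    have k2 := key k le_rfl 0 (Nat.zero_le l)
    have k3 := key 0 (Nat.zero_le k) l le_rfl
    have k4 := key k le_rfl l le_rfl
    have hδη : δ = η * (M + 1) := by simp only [η]; field_simp
    rw [hδη]
    nlinarith [sq_nonneg η, mul_nonneg (sq_nonneg η) hM0, mul_nonneg (sq_nonneg η) (sq_nonneg M)]
  exact (sq_le_sq₀ (norm_nonneg _) hδ.le).1 hsq

/-- The elements of `H^{k,l}` to which their spline projections converge. -/
def splineLimits (k l nt nθ d : ℕ) : Submodule ℝ (MixedSobolev k l d) where
  carrier := {u | Tendsto (fun N : ℕ × ℕ => splineProj nt nθ N.1 N.2 u) (atTop ×ˢ atTop) (𝓝 u)}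
  add_mem' h h' := by
    simpa only [splineProj, map_add, mem_ofPred_eq] using Tendsto.add h h'
  zero_mem' := by
    simp only [splineProj, map_zero, mem_ofPred_eq]
    exact tendsto_const_nhds
  smul_mem' r u h := by
    simpa only [splineProj, map_smul, mem_ofPred_eq] using Tendsto.const_smul h r

theorem mem_splineLimits {nt nθ : ℕ} {u : MixedSobolev k l d} :
    u ∈ splineLimits k l nt nθ d ↔ ∀ ε > 0, ∀ᶠ N : ℕ × ℕ in atTop ×ˢ atTop,
      ‖u - splineProj nt nθ N.1 N.2 u‖ < ε := by
  change Tendsto _ _ _ ↔ _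
  simp only [Metric.tendsto_nhds, dist_eq_norm, norm_sub_rev]

/-- If `w` is close to `u`, the projection of `w` is a spline close to `u`, and by minimality the
projection of `u` is at least as close. -/
theorem isClosed_splineLimits (k l nt nθ d : ℕ) :
    IsClosed (splineLimits k l nt nθ d : Set (MixedSobolev k l d)) := by
  refine isClosed_of_closure_subset fun u hu => ?_
  refine mem_splineLimits.2 fun ε hε => ?_
  obtain ⟨w, hw, hd⟩ := Metric.mem_closure_iff.1 hu (ε / 2) (by positivity)
  filter_upwards [mem_splineLimits.1 hw (ε / 2) (by positivity)] with N hN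
  have h1 := norm_sub_starProjection_le (splineSpace k l nt nθ N.1 N.2 d) u
    (z := splineProj nt nθ N.1 N.2 w) (Submodule.starProjection_apply_mem _ _)
  rw [dist_eq_norm] at hd
  have h2 := norm_sub_le_norm_sub_add_norm_sub u w (splineProj nt nθ N.1 N.2 w)
  exact (h1.trans h2).trans_lt (by linarith)

/-- The spline projections converge strongly to the identity. -/
theorem tendsto_splineProj {nt nθ : ℕ} (hk : 1 ≤ k) (hknt : k ≤ nt) (hlnθ : l ≤ nθ)
    (u : MixedSobolev k l d) :
    Tendsto (fun N : ℕ × ℕ => splineProj nt nθ N.1 N.2 u) (atTop ×ˢ atTop) (𝓝 u) := by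
  have h : (Submodule.span ℝ (trigProducts k l d)) ≤ splineLimits k l nt nθ d := by
    refine Submodule.span_le.2 fun w hw => mem_splineLimits.2 fun ε hε => ?_
    obtain ⟨N₀, hN⟩ := exists_spline_near_product hknt hlnθ hw (half_pos hε)
    filter_upwards [(eventually_ge_atTop N₀).prod_mk (eventually_ge_atTop N₀)] with N h
    obtain ⟨z, hz, hd⟩ := hN N.1 h.1 N.2 h.2
    exact ((norm_sub_starProjection_le _ w hz).trans hd).trans_lt (half_lt_self hε)
  have h' := Submodule.topologicalClosure_minimal _ h (isClosed_splineLimits k l nt nθ d)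
  rw [topologicalClosure_trigProducts hk] at h'
  exact h' trivial

end

section

variable {d k l : ℕ}

/-! ### Embeddings of `H^{k,l}` -/

theorem IsWeakDeriv.weakDeriv_eq {i j : ℕ} {f g : L2 d} (h : IsWeakDeriv i j f g) :
    weakDeriv i j f = g := by
  have hex : ∃ g, IsWeakDeriv i j f g := ⟨g, h⟩
  rw [weakDeriv, dif_pos hex]
  exact hex.choose_spec.unique h

/-- The intermediate weak derivatives are bounded operators from `H^{k,l}` to `L²`. -/
theorem exists_weakDerivL (hk : 1 ≤ k) {i j : ℕ} (hi : i ≤ k) (hj : j ≤ l) :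
    ∃ T : MixedSobolev k l d →L[ℝ] L2 d, ∀ u, IsWeakDeriv i j (MixedSobolev.fn u) (T u) := by
  have hex : ∀ u : regularSpace k l d, ∃ g, IsWeakDeriv i j (MixedSobolev.fn u.1) g := by
    rintro ⟨u, G, hG, hu, -⟩
    exact ⟨(hG.memLp hi hj).toLp, hG.isWeakDeriv hi hj hu (MemLp.coeFn_toLp _)⟩
  -- On the dense subspace uniqueness of weak derivatives makes this choice linear, and
  -- interpolation makes it bounded.
  choose D hD using hex
  let f : regularSpace k l d →ₗ[ℝ] L2 d :=
    { toFun := D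
      map_add' := fun u v => (hD (u + v)).unique ((hD u).add (hD v))
      map_smul' := fun r u => (hD (r • u)).unique ((hD u).smul r) }
  obtain ⟨C, hC0, hC⟩ := exists_interpolate d k l
  have hnorm : ∃ C, ∀ u, ‖f u‖ ≤ C * ‖(regularSpace k l d).subtype u‖ := by
    refine ⟨√C, fun u => ?_⟩
    obtain ⟨G, hG, hu, -⟩ := u.2
    have h := hC G hG u.1 hu i hi j hj
    rw [← sqCyl_congr (hG.ae_eq_of_isWeakDeriv hi hj hu (hD u)), ← norm_sq_eq_sqCyl] at h
    refine (sq_le_sq₀ (norm_nonneg _) (by positivity)).1 (h.trans_eq ?_)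
    rw [mul_pow, Real.sq_sqrt hC0]
    rfl
  have hdense : DenseRange (regularSpace k l d).subtype := by
    have := dense_regularSpace (k := k) (l := l) (d := d) hk
    rw [DenseRange]
    simpa using this
  refine ⟨f.extendOfNorm (regularSpace k l d).subtype, fun u => ?_⟩
  have hcont : Continuous fun u : MixedSobolev k l d =>
      ((MixedSobolev.fn u, f.extendOfNorm (regularSpace k l d).subtype u) : L2 d × L2 d) :=
    ((PiLp.continuous_apply 2 _ 0).comp continuous_subtype_val).prodMk
      (ContinuousLinearMap.continuous _)
  -- The continuous extension still consists of weak derivatives, since that relation is closed.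
  refine hdense.induction_on (p := fun u =>
    IsWeakDeriv i j (MixedSobolev.fn u) (f.extendOfNorm (regularSpace k l d).subtype u)) u
    ((isClosed_isWeakDeriv i j).preimage hcont) fun u => ?_
  rw [LinearMap.extendOfNorm_eq hdense hnorm]
  exact hD u

theorem MixedSobolev.isWeakDeriv_weakDeriv (hk : 1 ≤ k) {i j : ℕ} (hi : i ≤ k) (hj : j ≤ l)
    (u : MixedSobolev k l d) : IsWeakDeriv i j (fn u) (weakDeriv i j (fn u)) := by
  obtain ⟨T, hT⟩ := exists_weakDerivL (d := d) hk hi hj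
  rw [(hT u).weakDeriv_eq]
  exact hT u

theorem MixedSobolev.continuous_weakDeriv (hk : 1 ≤ k) {i j : ℕ} (hi : i ≤ k) (hj : j ≤ l) :
    Continuous fun u : MixedSobolev k l d => weakDeriv i j (fn u) := by
  obtain ⟨T, hT⟩ := exists_weakDerivL (d := d) hk hi hj
  simp only [(hT _).weakDeriv_eq]
  exact T.continuous

theorem MixedSobolev.weakDeriv_sub (hk : 1 ≤ k) {i j : ℕ} (hi : i ≤ k) (hj : j ≤ l)
    (u v : MixedSobolev k l d) :
    weakDeriv i j (fn (u - v)) = weakDeriv i j (fn u) - weakDeriv i j (fn v) := by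
  obtain ⟨T, hT⟩ := exists_weakDerivL (d := d) hk hi hj
  rw [(hT (u - v)).weakDeriv_eq, (hT u).weakDeriv_eq, (hT v).weakDeriv_eq, map_sub]

/-- `H^{k,l}` embeds into `H^{1,2}`. -/
theorem MixedSobolev.fn_mem_range (hk : 1 ≤ k) (hl : 2 ≤ l) (u : MixedSobolev k l d) :
    fn u ∈ range (fn (k := 1) (l := 2) (d := d)) :=
  ⟨⟨WithLp.toLp 2 ![fn u, weakDeriv 1 0 (fn u), weakDeriv 0 2 (fn u), weakDeriv 1 2 (fn u)],
    isWeakDeriv_weakDeriv hk hk (Nat.zero_le l) u, isWeakDeriv_weakDeriv hk (Nat.zero_le k) hl u,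
    isWeakDeriv_weakDeriv hk hk hl u⟩, rfl⟩

theorem exists_seq_jets (hk : 1 ≤ k) (u : MixedSobolev k l d) :
    ∃ (w : ℕ → MixedSobolev k l d) (G : ℕ → ℕ → ℕ → ℝ × ℝ → Vec d), Tendsto w atTop (𝓝 u) ∧
      ∀ n, IsJet k l (G n) ∧ MixedSobolev.fn (w n) =ᵐ[cyl] G n 0 0 ∧ Continuous (G n 0 1) ∧
        ∀ t θ, G n 0 1 (t, θ + 2 * Real.pi) = G n 0 1 (t, θ) := by
  obtain ⟨w, hw, hlim⟩ := mem_closure_iff_seq_limit.1 (dense_regularSpace hk u)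
  choose G hG using hw
  exact ⟨w, G, hlim, hG⟩

/-- The derivative `∂_θ u` has a continuous representative, bounded by the norm of `u`. -/
theorem exists_continuous_rep (d : ℕ) (hk : 1 ≤ k) (hl : 2 ≤ l) : ∃ C, 0 ≤ C ∧
    ∀ u : MixedSobolev k l d, ∃ g : ℝ × ℝ → Vec d, ContinuousOn g (Icc 0 1 ×ˢ univ) ∧
      (∀ t ∈ Icc (0:ℝ) 1, ∀ θ, g (t, θ + 2 * Real.pi) = g (t, θ)) ∧
      weakDeriv 0 1 (MixedSobolev.fn u) =ᵐ[cyl] g ∧ ∀ p ∈ Icc (0:ℝ) 1 ×ˢ univ, ‖g p‖ ≤ C * ‖u‖ := by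
  obtain ⟨C, hC0, hC⟩ := exists_sup_bound d hk hl
  have hpi : 0 < 2 * Real.pi := by positivity
  refine ⟨C, hC0, fun u => ?_⟩
  obtain ⟨w, G, hlim, hG⟩ := exists_seq_jets hk u
  -- The supremum bound for differences of jets holds on the fundamental domain and extends to the
  -- whole strip by periodicity. It makes the sequence uniformly Cauchy.
  have hdist : ∀ m n, ∀ p ∈ Icc (0:ℝ) 1 ×ˢ (univ : Set ℝ),
      dist (G m 0 1 p) (G n 0 1 p) ≤ C * dist (w m) (w n) := by
    rintro m n ⟨t, θ⟩ hp
    have hper : Function.Periodic (fun θ => G m 0 1 (t, θ) - G n 0 1 (t, θ)) (2 * Real.pi) :=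
      fun θ => by simp only [(hG m).2.2.2, (hG n).2.2.2]
    obtain ⟨θ', hθ', e⟩ := hper.exists_mem_Ico₀ hpi θ
    have hw : MixedSobolev.fn (w m - w n) =ᵐ[cyl] fun p => G m 0 0 p - G n 0 0 p := by
      rw [map_sub]
      filter_upwards [(hG m).2.1, (hG n).2.1,
        Lp.coeFn_sub (MixedSobolev.fn (w m)) (MixedSobolev.fn (w n))] with p h1 h2 h3
      rw [h3, Pi.sub_apply, h1, h2]
    rw [dist_eq_norm, dist_eq_norm]
    rw [e]
    exact hC _ ((hG m).1.sub (hG n).1) _ hw (t, θ') ⟨hp.1, hθ'.1, hθ'.2.le⟩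
  have hbound : ∀ n, ∀ p ∈ Icc (0:ℝ) 1 ×ˢ (univ : Set ℝ), ‖G n 0 1 p‖ ≤ C * ‖w n‖ := by
    rintro n ⟨t, θ⟩ hp
    have hper : Function.Periodic (fun θ => G n 0 1 (t, θ)) (2 * Real.pi) := (hG n).2.2.2 t
    obtain ⟨θ', hθ', e⟩ := hper.exists_mem_Ico₀ hpi θ
    rw [e]
    exact hC _ (hG n).1 _ (hG n).2.1 (t, θ') ⟨hp.1, hθ'.1, hθ'.2.le⟩
  have hcauchy : UniformCauchySeqOn (fun n => G n 0 1) atTop (Icc (0:ℝ) 1 ×ˢ (univ : Set ℝ)) := by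
    rw [Metric.uniformCauchySeqOn_iff]
    intro ε hε
    obtain ⟨N, hN⟩ := Metric.cauchySeq_iff.1 hlim.cauchySeq (ε / (C + 1)) (by positivity)
    refine ⟨N, fun m hm n hn p hp => (hdist m n p hp).trans_lt ?_⟩
    have := hN m hm n hn
    rw [lt_div_iff₀ (by positivity)] at this
    nlinarith [dist_nonneg (x := w m) (y := w n)]
  have hex : ∀ p, ∃ y, p ∈ Icc (0:ℝ) 1 ×ˢ (univ : Set ℝ) →
      Tendsto (fun n => G n 0 1 p) atTop (𝓝 y) := by
    intro p
    by_cases hp : p ∈ Icc (0:ℝ) 1 ×ˢ (univ : Set ℝ)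
    · obtain ⟨y, hy⟩ := cauchySeq_tendsto_of_complete (hcauchy.cauchySeq hp)
      exact ⟨y, fun _ => hy⟩
    · exact ⟨0, fun h => absurd h hp⟩
  choose g hg using hex
  have hunif := hcauchy.tendstoUniformlyOn_of_tendsto hg
  refine ⟨g, hunif.continuousOn (Frequently.of_forall fun n => (hG n).2.2.1.continuousOn),
    fun t ht θ => ?_, ?_, fun p hp => ?_⟩
  · refine tendsto_nhds_unique (hg (t, θ + 2 * Real.pi) ⟨ht, trivial⟩) ?_
    simp only [(hG _).2.2.2]
    exact hg (t, θ) ⟨ht, trivial⟩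
  -- The uniform limit is identified with the weak derivative along a subsequence that converges
  -- almost everywhere.
  · have hT := ((MixedSobolev.continuous_weakDeriv (d := d) hk (Nat.zero_le k)
      (show 1 ≤ l by omega)).tendsto u).comp hlim
    obtain ⟨ns, hns, hae⟩ := (tendstoInMeasure_of_tendsto_Lp hT).exists_seq_tendsto_ae
    have hrep : ∀ᵐ p ∂cyl, ∀ n, weakDeriv 0 1 (MixedSobolev.fn (w n)) p = G n 0 1 p :=
      ae_all_iff.2 fun n => (hG n).1.ae_eq_of_isWeakDeriv (Nat.zero_le k) (by omega) (hG n).2.1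
        (MixedSobolev.isWeakDeriv_weakDeriv hk (Nat.zero_le k) (by omega) _)
    filter_upwards [hae, hrep, ae_mem_rect] with p h1 h2 h3
    simp only [Function.comp_apply, h2] at h1
    exact tendsto_nhds_unique h1 ((hg p ⟨h3.1, trivial⟩).comp hns.tendsto_atTop)
  · exact le_of_tendsto_of_tendsto (hg p hp).norm ((hlim.norm).const_mul C)
      (Eventually.of_forall fun n => hbound n p hp)

theorem eLpNorm_two_le {F : ℝ × ℝ → ℝ} (hF : MemLp F 2 cyl) {K : ℝ} (hK : 0 ≤ K)
    (h : ∫ p, F p ^ 2 ∂cyl ≤ K ^ 2) : eLpNorm F 2 cyl ≤ ENNReal.ofReal K := by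
  rw [hF.eLpNorm_eq_integral_rpow_norm (by norm_num) (by norm_num)]
  refine ENNReal.ofReal_le_ofReal ?_
  have e : ∀ x : ℝ, ‖x‖ ^ (2:ENNReal).toReal = x ^ 2 := fun x => by simp
  simp only [e]
  rw [ENNReal.toReal_ofNat, ← one_div, ← Real.sqrt_eq_rpow]
  exact Real.sqrt_le_iff.2 ⟨hK, h⟩

/-- The products of `u''` and `∂ₜ v'` are square integrable. -/
theorem exists_eLpNorm_product_bound (d : ℕ) (hk : 1 ≤ k) (hl : 2 ≤ l) : ∃ C, 0 ≤ C ∧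
    ∀ u v : MixedSobolev k l d, eLpNorm (fun p => ‖weakDeriv 0 2 (MixedSobolev.fn u) p‖ *
      ‖weakDeriv 1 1 (MixedSobolev.fn v) p‖) 2 cyl ≤ ENNReal.ofReal (C * (‖u‖ * ‖v‖)) := by
  obtain ⟨C, hC0, hC⟩ := exists_product_bound d hk hl
  refine ⟨√C, Real.sqrt_nonneg C, fun u v => ?_⟩
  obtain ⟨w, G, hlim, hG⟩ := exists_seq_jets hk u
  obtain ⟨w', G', hlim', hG'⟩ := exists_seq_jets hk v
  have hT := ((MixedSobolev.continuous_weakDeriv (d := d) hk (Nat.zero_le k) hl).tendsto u).comp hlim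
  obtain ⟨ns, hns, hae⟩ := (tendstoInMeasure_of_tendsto_Lp hT).exists_seq_tendsto_ae
  -- The second subsequence is extracted from the first, so both factors converge almost everywhere
  -- along `ns ∘ ms`.
  have hT' := ((MixedSobolev.continuous_weakDeriv (d := d) hk hk
    (show 1 ≤ l by omega)).tendsto v).comp (hlim'.comp hns.tendsto_atTop)
  obtain ⟨ms, hms, hae'⟩ := (tendstoInMeasure_of_tendsto_Lp hT').exists_seq_tendsto_ae
  have hsub := hns.tendsto_atTop.comp hms.tendsto_atTop
  have hbound : ∀ n, eLpNorm (fun p => ‖weakDeriv 0 2 (MixedSobolev.fn (w n)) p‖ *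
      ‖weakDeriv 1 1 (MixedSobolev.fn (w' n)) p‖) 2 cyl ≤ ENNReal.ofReal (√C * (‖w n‖ * ‖w' n‖)) := by
    intro n
    have e1 := (hG n).1.ae_eq_of_isWeakDeriv (Nat.zero_le k) hl (hG n).2.1
      (MixedSobolev.isWeakDeriv_weakDeriv hk (Nat.zero_le k) hl _)
    have e2 := (hG' n).1.ae_eq_of_isWeakDeriv hk (show 1 ≤ l by omega) (hG' n).2.1
      (MixedSobolev.isWeakDeriv_weakDeriv hk hk (by omega) _)
    have e : (fun p => ‖weakDeriv 0 2 (MixedSobolev.fn (w n)) p‖ *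
        ‖weakDeriv 1 1 (MixedSobolev.fn (w' n)) p‖) =ᵐ[cyl]
        fun p => ‖G n 0 2 p‖ * ‖G' n 1 1 p‖ := by
      filter_upwards [e1, e2] with p h1 h2
      rw [h1, h2]
    rw [eLpNorm_congr_ae e]
    refine eLpNorm_two_le (memLp_of_bdd ?_ ?_ 2) (by positivity) ?_
    · exact ((hG n).1.meas 0 (Nat.zero_le k) 2 hl).norm.mul ((hG' n).1.meas 1 hk 1 (by omega)).norm
    · obtain ⟨A, hA⟩ := (hG n).1.bdd 0 (Nat.zero_le k) 2 hl
      obtain ⟨B, hB⟩ := (hG' n).1.bdd 1 hk 1 (by omega)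
      refine ⟨A * B, fun p hp => ?_⟩
      rw [norm_mul, norm_norm, norm_norm]
      have h1 := hA p hp
      have h2 := hB p hp
      have := (norm_nonneg _).trans h1
      gcongr
    · rw [mul_pow, Real.sq_sqrt hC0]
      exact hC _ _ (hG n).1 (hG' n).1 _ _ (hG n).2.1 (hG' n).2.1
  -- Fatou's lemma passes the bound for jets to the limit without presupposing that the product is
  -- in `L²`.
  refine (Lp.eLpNorm_lim_le_liminf_eLpNorm (f := fun n p =>
    ‖weakDeriv 0 2 (MixedSobolev.fn (w (ns (ms n)))) p‖ *
      ‖weakDeriv 1 1 (MixedSobolev.fn (w' (ns (ms n)))) p‖) (fun n => ?_) _ ?_).trans ?_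
  · exact (Lp.aestronglyMeasurable _).norm.mul (Lp.aestronglyMeasurable _).norm
  · filter_upwards [hae, hae'] with p h1 h2
    exact (h1.comp hms.tendsto_atTop).norm.mul h2.norm
  · refine (liminf_le_liminf (Eventually.of_forall fun n => hbound (ns (ms n)))).trans_eq ?_
    refine Tendsto.liminf_eq ?_
    exact (ENNReal.continuous_ofReal.tendsto _).comp
      ((((hlim.comp hsub).norm).mul ((hlim'.comp hsub).norm)).const_mul (√C))

end

section

variable {d k l : ℕ}

/-! ### Convergence in mean square -/

section
variable {Ω V ι : Type*} [MeasurableSpace Ω] {μ : Measure Ω} [NormedAddCommGroup V]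
  {a : Filter ι}

/-- Convergence of functions with respect to the `L²` seminorm. -/
def TendstoL2 (μ : Measure Ω) (f : ι → Ω → V) (a : Filter ι) (g : Ω → V) : Prop :=
  Tendsto (fun n => eLpNorm (f n - g) 2 μ) a (𝓝 0)

/-- The weighted derivatives of the approximating functions need not be in `L²` far from the limit.
This is why convergence is phrased with the seminorm of functions rather than in `L²`. -/
theorem TendstoL2.eventually_memLp {f : ι → Ω → V} {g : Ω → V} (h : TendstoL2 μ f a g)
    (hf : ∀ n, AEStronglyMeasurable (f n) μ) (hg : MemLp g 2 μ) : ∀ᶠ n in a, MemLp (f n) 2 μ := by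
  filter_upwards [h.eventually (gt_mem_nhds ENNReal.zero_lt_top)] with n hn
  have : MemLp (f n - g) 2 μ := ⟨(hf n).sub hg.1, hn⟩
  simpa using this.add hg

theorem TendstoL2.sub {f f' : ι → Ω → V} {g g' : Ω → V} (h : TendstoL2 μ f a g)
    (h' : TendstoL2 μ f' a g') (hf : ∀ n, AEStronglyMeasurable (f n) μ)
    (hf' : ∀ n, AEStronglyMeasurable (f' n) μ) (hg : AEStronglyMeasurable g μ)
    (hg' : AEStronglyMeasurable g' μ) :
    TendstoL2 μ (fun n => f n - f' n) a (g - g') := by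
  have h0 : Tendsto (fun n => eLpNorm (f n - g) 2 μ + eLpNorm (f' n - g') 2 μ) a (𝓝 0) := by
    simpa using Tendsto.add h h'
  refine tendsto_of_tendsto_of_tendsto_of_le_of_le tendsto_const_nhds h0 (fun _ => zero_le) fun n => ?_
  simp only
  rw [show f n - f' n - (g - g') = (f n - g) - (f' n - g') by abel]
  exact eLpNorm_sub_le ((hf n).sub hg) ((hf' n).sub hg') (by norm_num)

theorem TendstoL2.tendsto_integral {f : ι → Ω → V} {g : Ω → V} (h : TendstoL2 μ f a g)
    (hf : ∀ n, AEStronglyMeasurable (f n) μ) (hg : MemLp g 2 μ) :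
    Tendsto (fun n => ∫ p, ‖f n p‖ ^ 2 ∂μ) a (𝓝 (∫ p, ‖g p‖ ^ 2 ∂μ)) := by
  have e : ∀ f : Ω → V, MemLp f 2 μ → ∫ p, ‖f p‖ ^ 2 ∂μ = (eLpNorm f 2 μ).toReal ^ 2 := by
    intro f hf
    have hx : ∀ x : ℝ, x ^ (2:ENNReal).toReal = x ^ 2 := fun x => by simp
    rw [hf.eLpNorm_eq_integral_rpow_norm (by norm_num) (by norm_num), ENNReal.toReal_ofReal
      (by positivity), ENNReal.toReal_ofNat, ← one_div, ← Real.sqrt_eq_rpow, Real.sq_sqrt]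
    · simp
    · exact integral_nonneg fun _ => by positivity
  have hn : Tendsto (fun n => eLpNorm (f n) 2 μ) a (𝓝 (eLpNorm g 2 μ)) := by
    have h1 : Tendsto (fun n => eLpNorm g 2 μ - eLpNorm (f n - g) 2 μ) a (𝓝 (eLpNorm g 2 μ)) := by
      simpa using ENNReal.Tendsto.sub (tendsto_const_nhds (x := eLpNorm g 2 μ)) h
        (Or.inl hg.2.ne)
    have h2 : Tendsto (fun n => eLpNorm (f n - g) 2 μ + eLpNorm g 2 μ) a (𝓝 (eLpNorm g 2 μ)) := by
      simpa using Tendsto.add h (tendsto_const_nhds (x := eLpNorm g 2 μ))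
    refine tendsto_of_tendsto_of_tendsto_of_le_of_le h1 h2 (fun n => ?_) fun n => ?_
    · refine tsub_le_iff_right.2 ?_
      have := eLpNorm_sub_le (hf n) ((hf n).sub hg.1) (p := 2) (by norm_num)
      simpa using this
    · have := eLpNorm_add_le ((hf n).sub hg.1) hg.1 (p := 2) (by norm_num)
      simpa using this
  rw [e g hg]
  refine (((ENNReal.tendsto_toReal hg.2.ne).comp hn).pow 2).congr' ?_
  filter_upwards [h.eventually_memLp hf hg] with n hn
  exact (e _ hn).symm

/-- Expand the difference of products bilinearly, measuring weights in `L^∞` and functions in `L²`.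
-/
theorem TendstoL2.smul [NormedSpace ℝ V] {w : ι → Ω → ℝ} {w₀ : Ω → ℝ} {f : ι → Ω → V} {g : Ω → V}
    (hw : Tendsto (fun n => eLpNorm (w n - w₀) ⊤ μ) a (𝓝 0)) (hw₀ : MemLp w₀ ⊤ μ)
    (hwm : ∀ n, AEStronglyMeasurable (w n) μ) (h : TendstoL2 μ f a g)
    (hf : ∀ n, AEStronglyMeasurable (f n) μ) (hg : MemLp g 2 μ) :
    TendstoL2 μ (fun n => w n • f n) a (w₀ • g) := by
  have h0 : Tendsto (fun n => eLpNorm (w n - w₀) ⊤ μ * eLpNorm (f n - g) 2 μ +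
      eLpNorm w₀ ⊤ μ * eLpNorm (f n - g) 2 μ + eLpNorm (w n - w₀) ⊤ μ * eLpNorm g 2 μ) a (𝓝 0) := by
    have h1 := ENNReal.Tendsto.mul hw (Or.inr ENNReal.zero_ne_top) h (Or.inr ENNReal.zero_ne_top)
    have h2 := ENNReal.Tendsto.const_mul h (Or.inr hw₀.2.ne)
    have h3 := ENNReal.Tendsto.mul_const hw (Or.inr hg.2.ne)
    simpa using (h1.add h2).add h3
  refine tendsto_of_tendsto_of_tendsto_of_le_of_le tendsto_const_nhds h0 (fun _ => zero_le) fun n => ?_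
  have e : w n • f n - w₀ • g = (w n - w₀) • (f n - g) + w₀ • (f n - g) + (w n - w₀) • g := by
    ext p
    simp only [Pi.sub_apply, Pi.add_apply, Pi.smul_apply', sub_smul, smul_sub]
    abel
  have m1 := (hf n).sub hg.1
  have m2 := (hwm n).sub hw₀.1
  simp only
  rw [e]
  refine (eLpNorm_add_le ((m2.smul m1).add (hw₀.1.smul m1)) (m2.smul hg.1) (by norm_num)).trans
    (add_le_add ((eLpNorm_add_le (m2.smul m1) (hw₀.1.smul m1) (by norm_num)).trans
      (add_le_add ?_ ?_)) ?_)
  · exact eLpNorm_smul_le_eLpNorm_top_mul_eLpNorm 2 m1 _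
  · exact eLpNorm_smul_le_eLpNorm_top_mul_eLpNorm 2 m1 _
  · exact eLpNorm_smul_le_eLpNorm_top_mul_eLpNorm 2 hg.1 _

theorem memLp_smul_top [NormedSpace ℝ V] {w : Ω → ℝ} {g : Ω → V} (hw : MemLp w ⊤ μ)
    (hg : MemLp g 2 μ) : MemLp (w • g) 2 μ :=
  ⟨hw.1.smul hg.1, (eLpNorm_smul_le_eLpNorm_top_mul_eLpNorm 2 hg.1 w).trans_lt
    (ENNReal.mul_lt_top hw.2 hg.2)⟩

theorem memLp_top_comp_norm {h : ℝ → ℝ} (hm : Measurable h) (hc : ContinuousOn h (Ioi 0)) {m M : ℝ}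
    (hm0 : 0 < m) {u : Ω → V} (hu : AEStronglyMeasurable u μ) (h1 : ∀ᵐ p ∂μ, m ≤ ‖u p‖)
    (h2 : ∀ᵐ p ∂μ, ‖u p‖ ≤ M) : MemLp (fun p => h ‖u p‖) ⊤ μ := by
  obtain ⟨C, hC⟩ := (isCompact_Icc (a := m) (b := M)).exists_bound_of_continuousOn
    (hc.mono fun x hx => hm0.trans_le hx.1)
  refine memLp_top_of_bound (hm.comp_aemeasurable hu.norm.aemeasurable).aestronglyMeasurable C ?_
  filter_upwards [h1, h2] with p h1 h2 using hC _ ⟨h1, h2⟩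

/-- The weight may be singular at zero. As soon as the perturbation is below `min (m/2) 1`, all
norms lie in the compact interval `[m/2, M + 1]`, where `h` is uniformly continuous. -/
theorem tendsto_eLpNorm_top_comp_norm {h : ℝ → ℝ} (hc : ContinuousOn h (Ioi 0)) {m M : ℝ}
    (hm0 : 0 < m) {u : ι → Ω → V} {u₀ : Ω → V} (h1 : ∀ᵐ p ∂μ, m ≤ ‖u₀ p‖)
    (h2 : ∀ᵐ p ∂μ, ‖u₀ p‖ ≤ M) {ρ : ι → ℝ} (hρ : Tendsto ρ a (𝓝 0))
    (hu : ∀ n, ∀ᵐ p ∂μ, ‖u n p - u₀ p‖ ≤ ρ n) :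
    Tendsto (fun n => eLpNorm ((fun p => h ‖u n p‖) - fun p => h ‖u₀ p‖) ⊤ μ) a (𝓝 0) := by
  have hK : UniformContinuousOn h (Icc (m / 2) (M + 1)) :=
    isCompact_Icc.uniformContinuousOn_of_continuous
      (hc.mono fun x hx => (half_pos hm0).trans_le hx.1)
  rw [ENNReal.tendsto_nhds_zero]
  intro ε hε
  obtain ⟨r, hr0, hr⟩ := ENNReal.lt_iff_exists_nnreal_btwn.1 hε
  have hr0' : (0:ℝ) < r := by exact_mod_cast hr0
  obtain ⟨δ, hδ, H⟩ := Metric.uniformContinuousOn_iff.1 hK r hr0'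
  have hpos : 0 < min δ (min (m / 2) 1) := by positivity
  filter_upwards [hρ.eventually (gt_mem_nhds hpos)] with n hn
  have : eLpNorm ((fun p => h ‖u n p‖) - fun p => h ‖u₀ p‖) ⊤ μ ≤ ENNReal.ofReal r := by
    rw [eLpNorm_exponent_top]
    refine eLpNormEssSup_le_of_ae_bound ?_
    filter_upwards [h1, h2, hu n] with p h1 h2 h3
    have h4 := (abs_norm_sub_norm_le (u n p) (u₀ p)).trans h3
    rw [lt_min_iff, lt_min_iff] at hn
    have h5 := abs_le.1 h4
    refine (H _ ⟨?_, ?_⟩ _ ⟨?_, ?_⟩ (h4.trans_lt hn.1)).le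
    · linarith
    · linarith
    · linarith
    · linarith
  refine this.trans (le_trans ?_ hr.le)
  simp

end

end

section

variable {d k l : ℕ}

/-! ### Continuity of the energy -/

/-- The weak derivative `u^{(i,j)}` of `u ∈ H^{k,l}`. -/
abbrev der (i j : ℕ) (u : MixedSobolev k l d) : ℝ × ℝ → Vec d := weakDeriv i j (MixedSobolev.fn u)

theorem der_sub (hk : 1 ≤ k) {i j : ℕ} (hi : i ≤ k) (hj : j ≤ l) (u v : MixedSobolev k l d) :
    der i j (u - v) =ᵐ[cyl] fun p => der i j u p - der i j v p := by
  rw [der, MixedSobolev.weakDeriv_sub hk hi hj]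
  exact Lp.coeFn_sub _ _

theorem aestronglyMeasurable_der (i j : ℕ) (u : MixedSobolev k l d) :
    AEStronglyMeasurable (der i j u) cyl := Lp.aestronglyMeasurable _

theorem memLp_der (i j : ℕ) (u : MixedSobolev k l d) : MemLp (der i j u) 2 cyl := Lp.memLp _

theorem tendstoL2_der (hk : 1 ≤ k) {i j : ℕ} (hi : i ≤ k) (hj : j ≤ l) (c : MixedSobolev k l d) :
    TendstoL2 cyl (fun u : MixedSobolev k l d => der i j u) (𝓝 c) (der i j c) :=
  (Lp.tendsto_Lp_iff_tendsto_eLpNorm' _ _).1 ((MixedSobolev.continuous_weakDeriv hk hi hj).tendsto c)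

theorem exists_ae_bound_der (d : ℕ) (hk : 1 ≤ k) (hl : 2 ≤ l) : ∃ C, 0 ≤ C ∧
    ∀ u : MixedSobolev k l d, ∀ᵐ p ∂cyl, ‖der 0 1 u p‖ ≤ C * ‖u‖ := by
  obtain ⟨C, hC0, hC⟩ := exists_continuous_rep d hk hl
  refine ⟨C, hC0, fun u => ?_⟩
  obtain ⟨g, -, -, hg, hb⟩ := hC u
  filter_upwards [hg, ae_mem_rect] with p h1 h2
  rw [der, h1]
  exact hb p ⟨h2.1, trivial⟩

/-- The function `⟪u', v''⟫ ∂ₜ w'`. -/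
def cubicTerm (u v w : MixedSobolev k l d) (p : ℝ × ℝ) : Vec d :=
  (inner ℝ (der 0 1 u p) (der 0 2 v p) : ℝ) • der 1 1 w p

theorem aestronglyMeasurable_cubicTerm (u v w : MixedSobolev k l d) :
    AEStronglyMeasurable (cubicTerm u v w) cyl :=
  ((aestronglyMeasurable_der 0 1 u).inner (𝕜 := ℝ) (aestronglyMeasurable_der 0 2 v)).smul
    (aestronglyMeasurable_der 1 1 w)

/-- The first factor is bounded pointwise, and the product of the other two is bounded in `L²`. -/
theorem exists_eLpNorm_cubicTerm_le (d : ℕ) (hk : 1 ≤ k) (hl : 2 ≤ l) : ∃ C, 0 ≤ C ∧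
    ∀ u v w : MixedSobolev k l d,
      eLpNorm (cubicTerm u v w) 2 cyl ≤ ENNReal.ofReal (C * (‖u‖ * ‖v‖ * ‖w‖)) := by
  obtain ⟨A, hA0, hA⟩ := exists_ae_bound_der d hk hl
  obtain ⟨B, hB0, hB⟩ := exists_eLpNorm_product_bound d hk hl
  refine ⟨A * B, by positivity, fun u v w => ?_⟩
  have h : ∀ᵐ p ∂cyl, ‖cubicTerm u v w p‖ ≤ A * ‖u‖ * ‖‖der 0 2 v p‖ * ‖der 1 1 w p‖‖ := by
    filter_upwards [hA u] with p hp
    rw [cubicTerm, norm_smul, norm_mul, norm_norm, norm_norm, ← mul_assoc]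
    gcongr
    exact (norm_inner_le_norm _ _).trans (by gcongr)
  refine (eLpNorm_le_mul_eLpNorm_of_ae_le_mul h 2).trans ?_
  refine (mul_le_mul_right (hB v w) _).trans_eq ?_
  rw [← ENNReal.ofReal_mul (by positivity)]
  congr 1
  ring

theorem memLp_cubicTerm (hk : 1 ≤ k) (hl : 2 ≤ l) (u v w : MixedSobolev k l d) :
    MemLp (cubicTerm u v w) 2 cyl := by
  obtain ⟨C, -, hC⟩ := exists_eLpNorm_cubicTerm_le d hk hl
  exact ⟨aestronglyMeasurable_cubicTerm u v w, (hC u v w).trans_lt ENNReal.ofReal_lt_top⟩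

/-- A bounded trilinear map is continuous: the difference telescopes into three terms, each with one
argument `u - c`. -/
theorem tendstoL2_cubicTerm (hk : 1 ≤ k) (hl : 2 ≤ l) (c : MixedSobolev k l d) :
    TendstoL2 cyl (fun u => cubicTerm u u u) (𝓝 c) (cubicTerm c c c) := by
  obtain ⟨C, hC0, hC⟩ := exists_eLpNorm_cubicTerm_le d hk hl
  have h0 : Tendsto (fun u : MixedSobolev k l d =>
      ENNReal.ofReal (C * (‖u - c‖ * ‖u‖ * ‖u‖)) + ENNReal.ofReal (C * (‖c‖ * ‖u - c‖ * ‖u‖)) +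
        ENNReal.ofReal (C * (‖c‖ * ‖c‖ * ‖u - c‖))) (𝓝 c) (𝓝 0) := by
    refine Continuous.tendsto' ?_ _ _ (by simp)
    have hn : Continuous fun u : MixedSobolev k l d => ‖u - c‖ := by fun_prop
    exact ((ENNReal.continuous_ofReal.comp (by fun_prop)).add
      (ENNReal.continuous_ofReal.comp (by fun_prop))).add
      (ENNReal.continuous_ofReal.comp (by fun_prop))
  refine tendsto_of_tendsto_of_tendsto_of_le_of_le tendsto_const_nhds h0 (fun _ => zero_le) fun u => ?_
  have e : cubicTerm u u u - cubicTerm c c c =ᵐ[cyl]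
      cubicTerm (u - c) u u + cubicTerm c (u - c) u + cubicTerm c c (u - c) := by
    filter_upwards [der_sub hk (Nat.zero_le k) (show 1 ≤ l by omega) u c,
      der_sub hk (Nat.zero_le k) hl u c, der_sub hk hk (show 1 ≤ l by omega) u c] with p h1 h2 h3
    simp only [Pi.sub_apply, Pi.add_apply, cubicTerm, h1, h2, h3, inner_sub_left, inner_sub_right,
      sub_smul, smul_sub]
    abel
  simp only
  rw [eLpNorm_congr_ae e]
  have m := aestronglyMeasurable_cubicTerm (k := k) (l := l) (d := d)
  refine (eLpNorm_add_le ((m _ _ _).add (m _ _ _)) (m _ _ _) (by norm_num)).trans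
    (add_le_add ((eLpNorm_add_le (m _ _ _) (m _ _ _) (by norm_num)).trans
      (add_le_add ?_ ?_)) ?_)
  · exact hC _ _ _
  · exact hC _ _ _
  · exact hC _ _ _

/-- The three terms with `a₂` form a complete square, because they express the squared norm of the
second arc length derivative of the velocity. The constants stay outside the squares, so their signs
are irrelevant. -/
theorem density_eq (a₀ a₁ a₂ : ℝ) {u : Vec d} (hu : u ≠ 0) (v x y z : Vec d) :
    density a₀ a₁ a₂ u v x y z = a₀ * ‖√‖u‖ • x‖ ^ 2 + a₁ * ‖(√‖u‖)⁻¹ • y‖ ^ 2 +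
      a₂ * ‖((√‖u‖)⁻¹ ^ 3) • (z - (‖u‖⁻¹ ^ 2) • ((inner ℝ u v : ℝ) • y))‖ ^ 2 := by
  have hpos : 0 < ‖u‖ := norm_pos_iff.2 hu
  have hs : √‖u‖ ^ 2 = ‖u‖ := Real.sq_sqrt hpos.le
  have hs0 : √‖u‖ ≠ 0 := (Real.sqrt_pos.2 hpos).ne'
  simp only [density, ← real_inner_self_eq_norm_sq, real_inner_smul_left, real_inner_smul_right,
    inner_sub_left, inner_sub_right, real_inner_comm y z]
  generalize (inner ℝ u v : ℝ) = q
  generalize (inner ℝ x x : ℝ) = xx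
  generalize (inner ℝ y y : ℝ) = yy
  generalize (inner ℝ y z : ℝ) = yz
  generalize (inner ℝ z z : ℝ) = zz
  -- In terms of the square root the identity becomes rational.
  generalize √‖u‖ = r at hs hs0 ⊢
  rw [← hs]
  field_simp
  ring

/-- The weighted derivatives in terms of which the energy is a sum of squares of `L²` norms. -/
def weighted (u : MixedSobolev k l d) : Fin 3 → ℝ × ℝ → Vec d :=
  ![(fun p => √‖der 0 1 u p‖) • der 1 0 u,
    (fun p => (√‖der 0 1 u p‖)⁻¹) • der 1 1 u,
    (fun p => (√‖der 0 1 u p‖)⁻¹ ^ 3) •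
      (der 1 2 u - (fun p => ‖der 0 1 u p‖⁻¹ ^ 2) • cubicTerm u u u)]

theorem energyDensity_eq (a₀ a₁ a₂ : ℝ) {u : MixedSobolev k l d} {p : ℝ × ℝ}
    (h : der 0 1 u p ≠ 0) : energyDensity a₀ a₁ a₂ (MixedSobolev.fn u) p =
      a₀ * ‖weighted u 0 p‖ ^ 2 + a₁ * ‖weighted u 1 p‖ ^ 2 + a₂ * ‖weighted u 2 p‖ ^ 2 :=
  density_eq a₀ a₁ a₂ h _ _ _ _

section
variable (u : MixedSobolev k l d)

theorem aestronglyMeasurable_comp_norm_der {h : ℝ → ℝ} (hm : Measurable h) :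
    AEStronglyMeasurable (fun p => h ‖der 0 1 u p‖) cyl :=
  (hm.comp_aemeasurable (aestronglyMeasurable_der 0 1 u).norm.aemeasurable).aestronglyMeasurable

theorem measurable_weight₁ : Measurable fun r : ℝ => √r := by fun_prop
theorem measurable_weight₂ : Measurable fun r : ℝ => (√r)⁻¹ := by fun_prop
theorem measurable_weight₃ : Measurable fun r : ℝ => (√r)⁻¹ ^ 3 := by fun_prop
theorem measurable_weight₄ : Measurable fun r : ℝ => r⁻¹ ^ 2 := by fun_prop

theorem continuousOn_weight₁ : ContinuousOn (fun r : ℝ => √r) (Ioi 0) := by fun_prop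
theorem continuousOn_weight₂ : ContinuousOn (fun r : ℝ => (√r)⁻¹) (Ioi 0) :=
  continuousOn_weight₁.inv₀ fun _ h => (Real.sqrt_pos.2 h).ne'
theorem continuousOn_weight₃ : ContinuousOn (fun r : ℝ => (√r)⁻¹ ^ 3) (Ioi 0) :=
  continuousOn_weight₂.pow 3
theorem continuousOn_weight₄ : ContinuousOn (fun r : ℝ => r⁻¹ ^ 2) (Ioi 0) :=
  (continuousOn_id.inv₀ fun _ h => ne_of_gt h).pow 2

theorem aestronglyMeasurable_weighted (i : Fin 3) : AEStronglyMeasurable (weighted u i) cyl := by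
  fin_cases i
  · exact (aestronglyMeasurable_comp_norm_der u measurable_weight₁).smul
      (aestronglyMeasurable_der 1 0 u)
  · exact (aestronglyMeasurable_comp_norm_der u measurable_weight₂).smul
      (aestronglyMeasurable_der 1 1 u)
  · exact (aestronglyMeasurable_comp_norm_der u measurable_weight₃).smul
      ((aestronglyMeasurable_der 1 2 u).sub
        ((aestronglyMeasurable_comp_norm_der u measurable_weight₄).smul
          (aestronglyMeasurable_cubicTerm u u u)))

end

section
variable {c : MixedSobolev k l d} {m : ℝ}

theorem memLp_weighted (hk : 1 ≤ k) (hl : 2 ≤ l) (hm : 0 < m) (hc : ∀ᵐ p ∂cyl, m ≤ ‖der 0 1 c p‖)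
    (i : Fin 3) : MemLp (weighted c i) 2 cyl := by
  obtain ⟨C, -, hC⟩ := exists_ae_bound_der d hk hl
  have w {h : ℝ → ℝ} (h1 : Measurable h) (h2 : ContinuousOn h (Ioi 0)) :=
    memLp_top_comp_norm h1 h2 hm (aestronglyMeasurable_der 0 1 c) hc (hC c)
  fin_cases i
  · exact memLp_smul_top (w measurable_weight₁ continuousOn_weight₁) (memLp_der 1 0 c)
  · exact memLp_smul_top (w measurable_weight₂ continuousOn_weight₂) (memLp_der 1 1 c)
  · exact memLp_smul_top (w measurable_weight₃ continuousOn_weight₃) ((memLp_der 1 2 c).sub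
      (memLp_smul_top (w measurable_weight₄ continuousOn_weight₄) (memLp_cubicTerm hk hl c c c)))

theorem tendstoL2_weight_smul (hk : 1 ≤ k) (hl : 2 ≤ l) (hm : 0 < m)
    (hc : ∀ᵐ p ∂cyl, m ≤ ‖der 0 1 c p‖) {h : ℝ → ℝ} (h1 : Measurable h)
    (h2 : ContinuousOn h (Ioi 0)) {f : MixedSobolev k l d → ℝ × ℝ → Vec d} {g : ℝ × ℝ → Vec d}
    (hfg : TendstoL2 cyl f (𝓝 c) g) (hf : ∀ u, AEStronglyMeasurable (f u) cyl)
    (hg : MemLp g 2 cyl) :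
    TendstoL2 cyl (fun u => (fun p => h ‖der 0 1 u p‖) • f u) (𝓝 c)
      ((fun p => h ‖der 0 1 c p‖) • g) := by
  obtain ⟨C, -, hC⟩ := exists_ae_bound_der d hk hl
  have hρ : Tendsto (fun u : MixedSobolev k l d => C * ‖u - c‖) (𝓝 c) (𝓝 0) :=
    Continuous.tendsto' (by fun_prop) _ _ (by simp)
  have hu : ∀ u : MixedSobolev k l d, ∀ᵐ p ∂cyl, ‖der 0 1 u p - der 0 1 c p‖ ≤ C * ‖u - c‖ := by
    intro u
    filter_upwards [hC (u - c), der_sub hk (Nat.zero_le k) (show 1 ≤ l by omega) u c] with p h1 h2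
    rwa [← h2]
  exact TendstoL2.smul (w := fun u p => h ‖der 0 1 u p‖)
    (tendsto_eLpNorm_top_comp_norm h2 hm hc (hC c) hρ hu)
    (memLp_top_comp_norm h1 h2 hm (aestronglyMeasurable_der 0 1 c) hc (hC c))
    (fun u => aestronglyMeasurable_comp_norm_der u h1) hfg hf hg

theorem tendstoL2_weighted (hk : 1 ≤ k) (hl : 2 ≤ l) (hm : 0 < m)
    (hc : ∀ᵐ p ∂cyl, m ≤ ‖der 0 1 c p‖) (i : Fin 3) :
    TendstoL2 cyl (fun u => weighted u i) (𝓝 c) (weighted c i) := by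
  obtain ⟨C, -, hC⟩ := exists_ae_bound_der d hk hl
  fin_cases i
  · exact tendstoL2_weight_smul hk hl hm hc measurable_weight₁ continuousOn_weight₁
      (tendstoL2_der hk hk (Nat.zero_le l) c) (aestronglyMeasurable_der 1 0) (memLp_der 1 0 c)
  · exact tendstoL2_weight_smul hk hl hm hc measurable_weight₂ continuousOn_weight₂
      (tendstoL2_der hk hk (show 1 ≤ l by omega) c) (aestronglyMeasurable_der 1 1) (memLp_der 1 1 c)
  · have mP := memLp_smul_top (memLp_top_comp_norm measurable_weight₄ continuousOn_weight₄ hm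
      (aestronglyMeasurable_der 0 1 c) hc (hC c)) (memLp_cubicTerm hk hl c c c)
    have aP := fun u : MixedSobolev k l d =>
      (aestronglyMeasurable_comp_norm_der u measurable_weight₄).smul
        (aestronglyMeasurable_cubicTerm u u u)
    have tP := tendstoL2_weight_smul hk hl hm hc measurable_weight₄ continuousOn_weight₄
      (tendstoL2_cubicTerm hk hl c) (fun u => aestronglyMeasurable_cubicTerm u u u)
      (memLp_cubicTerm hk hl c c c)
    exact tendstoL2_weight_smul hk hl hm hc measurable_weight₃ continuousOn_weight₃
      (TendstoL2.sub (tendstoL2_der hk hk hl c) tP (aestronglyMeasurable_der 1 2) aP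
        (aestronglyMeasurable_der 1 2 c) mP.1)
      (fun u => (aestronglyMeasurable_der 1 2 u).sub (aP u)) ((memLp_der 1 2 c).sub mP)

end

theorem integrable_energyDensity (a₀ a₁ a₂ : ℝ) {u : MixedSobolev k l d}
    (h : ∀ᵐ p ∂cyl, der 0 1 u p ≠ 0) (hw : ∀ i, MemLp (weighted u i) 2 cyl) :
    Integrable (energyDensity a₀ a₁ a₂ (MixedSobolev.fn u)) cyl ∧
    energy a₀ a₁ a₂ (MixedSobolev.fn u) =
      a₀ * ∫ p, ‖weighted u 0 p‖ ^ 2 ∂cyl + a₁ * ∫ p, ‖weighted u 1 p‖ ^ 2 ∂cyl +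
        a₂ * ∫ p, ‖weighted u 2 p‖ ^ 2 ∂cyl := by
  have hi (i : Fin 3) : Integrable (fun p => ‖weighted u i p‖ ^ 2) cyl :=
    (hw i).integrable_norm_pow (by norm_num)
  have e : energyDensity a₀ a₁ a₂ (MixedSobolev.fn u) =ᵐ[cyl] fun p =>
      a₀ * ‖weighted u 0 p‖ ^ 2 + a₁ * ‖weighted u 1 p‖ ^ 2 + a₂ * ‖weighted u 2 p‖ ^ 2 := by
    filter_upwards [h] with p hp using energyDensity_eq a₀ a₁ a₂ hp
  have i01 := ((hi 0).const_mul a₀).add ((hi 1).const_mul a₁)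
  refine ⟨(i01.add ((hi 2).const_mul a₂)).congr e.symm, ?_⟩
  rw [energy, integral_congr_ae e, integral_add (by exact i01) ((hi 2).const_mul a₂),
    integral_add ((hi 0).const_mul a₀) ((hi 1).const_mul a₁), integral_const_mul,
    integral_const_mul, integral_const_mul]

/-- A nonvanishing continuous periodic function on the cylinder is bounded away from zero. -/
theorem exists_pos_le_norm {g : ℝ × ℝ → Vec d} (hg : ContinuousOn g (Icc 0 1 ×ˢ univ))
    (hper : ∀ t ∈ Icc (0:ℝ) 1, ∀ θ, g (t, θ + 2 * Real.pi) = g (t, θ))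
    (h0 : ∀ t ∈ Icc (0:ℝ) 1, ∀ θ, g (t, θ) ≠ 0) :
    ∃ m, 0 < m ∧ ∀ t ∈ Icc (0:ℝ) 1, ∀ θ, m ≤ ‖g (t, θ)‖ := by
  have hpi : 0 < 2 * Real.pi := by positivity
  obtain ⟨p, hp, hmin⟩ := (isCompact_Icc.prod isCompact_Icc :
    IsCompact (Icc (0:ℝ) 1 ×ˢ Icc 0 (2 * Real.pi))).exists_isMinOn
      ⟨(0, 0), ⟨le_rfl, zero_le_one⟩, ⟨le_rfl, hpi.le⟩⟩
      (hg.norm.mono (prod_mono_right (subset_univ _)))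
  refine ⟨‖g p‖, norm_pos_iff.2 (h0 p.1 hp.1 p.2), fun t ht θ => ?_⟩
  have hp' : Function.Periodic (fun θ => g (t, θ)) (2 * Real.pi) := hper t ht
  obtain ⟨θ', hθ', e⟩ := hp'.exists_mem_Ico₀ hpi θ
  rw [e]
  exact hmin ⟨ht, hθ'.1, hθ'.2.le⟩

/-- The continuous representative of `c'` is bounded away from zero by compactness, and that of `u'
- c'` is uniformly at most `C ‖u - c‖`. Hence their sum has no zero once `u` is close to `c`. -/
theorem eventually_mem_immersedPaths (hk : 1 ≤ k) (hl : 2 ≤ l) {c : MixedSobolev k l d}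
    (hc : MixedSobolev.fn c ∈ immersedPaths d) :
    ∀ᶠ u : MixedSobolev k l d in 𝓝 c, MixedSobolev.fn u ∈ immersedPaths d := by
  obtain ⟨-, g, hg, hper, hae, h0⟩ := hc
  obtain ⟨m, hm, hmg⟩ := exists_pos_le_norm hg hper h0
  obtain ⟨C, hC0, hC⟩ := exists_continuous_rep d hk hl
  have hρ : Tendsto (fun u : MixedSobolev k l d => C * ‖u - c‖) (𝓝 c) (𝓝 0) :=
    Continuous.tendsto' (by fun_prop) _ _ (by simp)
  filter_upwards [hρ.eventually (gt_mem_nhds hm)] with u hu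
  obtain ⟨r, hr, hrper, hrae, hrb⟩ := hC (u - c)
  refine ⟨MixedSobolev.fn_mem_range hk hl u, g + r, hg.add hr, fun t ht θ => ?_, ?_,
    fun t ht θ h => ?_⟩
  · simp only [Pi.add_apply, hper t ht, hrper t ht]
  · filter_upwards [hae, hrae, der_sub hk (Nat.zero_le k) (show 1 ≤ l by omega) u c] with p h1 h2 h3
    rw [Pi.add_apply, ← h1, ← h2]
    exact (add_eq_of_eq_sub' h3).symm
  · have h1 := hmg t ht θ
    have h2 := hrb (t, θ) ⟨ht, trivial⟩
    rw [Pi.add_apply, add_eq_zero_iff_eq_neg] at h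
    rw [h, norm_neg] at h1
    linarith

theorem exists_pos_ae_le_norm_der {c : MixedSobolev k l d} (hc : MixedSobolev.fn c ∈ immersedPaths d) :
    ∃ m, 0 < m ∧ ∀ᵐ p ∂cyl, m ≤ ‖der 0 1 c p‖ := by
  obtain ⟨-, g, hg, hper, hae, h0⟩ := hc
  obtain ⟨m, hm, hmg⟩ := exists_pos_le_norm hg hper h0
  refine ⟨m, hm, ?_⟩
  filter_upwards [hae, ae_mem_rect] with p h1 h2
  rw [der, h1]
  exact hmg p.1 h2.1 p.2

theorem integrable_energyDensity_of_mem (a₀ a₁ a₂ : ℝ) (hk : 1 ≤ k) (hl : 2 ≤ l)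
    {c : MixedSobolev k l d} (hc : MixedSobolev.fn c ∈ immersedPaths d) :
    Integrable (energyDensity a₀ a₁ a₂ (MixedSobolev.fn c)) cyl ∧
    energy a₀ a₁ a₂ (MixedSobolev.fn c) =
      a₀ * ∫ p, ‖weighted c 0 p‖ ^ 2 ∂cyl + a₁ * ∫ p, ‖weighted c 1 p‖ ^ 2 ∂cyl +
        a₂ * ∫ p, ‖weighted c 2 p‖ ^ 2 ∂cyl := by
  obtain ⟨m, hm, h⟩ := exists_pos_ae_le_norm_der hc
  refine integrable_energyDensity a₀ a₁ a₂ ?_ (memLp_weighted hk hl hm h)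
  filter_upwards [h] with p hp
  exact norm_pos_iff.1 (hm.trans_le hp)

/-- The energy is continuous on `U ∩ H^{k,l}`. -/
theorem tendsto_energy (a₀ a₁ a₂ : ℝ) (hk : 1 ≤ k) (hl : 2 ≤ l)
    {c : MixedSobolev k l d} (hc : MixedSobolev.fn c ∈ immersedPaths d) :
    Tendsto (fun u : MixedSobolev k l d => energy a₀ a₁ a₂ (MixedSobolev.fn u)) (𝓝 c)
      (𝓝 (energy a₀ a₁ a₂ (MixedSobolev.fn c))) := by
  obtain ⟨m, hm, h⟩ := exists_pos_ae_le_norm_der hc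
  have t (i : Fin 3) := (tendstoL2_weighted hk hl hm h i).tendsto_integral
    (fun u => aestronglyMeasurable_weighted u i) (memLp_weighted hk hl hm h i)
  rw [(integrable_energyDensity_of_mem a₀ a₁ a₂ hk hl hc).2]
  -- The representation of the energy by squares is valid only on `U`, which contains all `u` near
  -- `c`.
  refine ((((t 0).const_mul a₀).add ((t 1).const_mul a₁)).add ((t 2).const_mul a₂)).congr' ?_
  filter_upwards [eventually_mem_immersedPaths hk hl hc] with u hu
  exact (integrable_energyDensity_of_mem a₀ a₁ a₂ hk hl hu).2.symm

end

end CurvePath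

end

/-! ### Convergence of the energies of the spline projections -/

theorem lemma3p2 (d nt nθ k l : ℕ) (hk : 1 ≤ k) (hknt : k ≤ nt) (hl : 2 ≤ l) (hlnθ : l ≤ nθ)
    (a₀ a₁ a₂ : ℝ) (c : MixedSobolev k l d) (hc : MixedSobolev.fn c ∈ immersedPaths d) :
    Integrable (energyDensity a₀ a₁ a₂ (MixedSobolev.fn c)) cyl ∧
    (∀ᶠ N : ℕ × ℕ in atTop ×ˢ atTop,
      MixedSobolev.fn (splineProj nt nθ N.1 N.2 c) ∈ immersedPaths d ∧
      Integrable (energyDensity a₀ a₁ a₂ (MixedSobolev.fn (splineProj nt nθ N.1 N.2 c))) cyl) ∧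
    Tendsto (fun N : ℕ × ℕ => energy a₀ a₁ a₂ (MixedSobolev.fn (splineProj nt nθ N.1 N.2 c)))
      (atTop ×ˢ atTop) (𝓝 (energy a₀ a₁ a₂ (MixedSobolev.fn c))) := by
  have hlim := tendsto_splineProj hk hknt hlnθ c
  refine ⟨(integrable_energyDensity_of_mem a₀ a₁ a₂ hk hl hc).1, ?_,
    (tendsto_energy a₀ a₁ a₂ hk hl hc).comp hlim⟩
  filter_upwards [hlim.eventually (eventually_mem_immersedPaths hk hl hc)] with N hN
  exact ⟨hN, (integrable_energyDensity_of_mem a₀ a₁ a₂ hk hl hN).1⟩
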